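/- For $Q\ge 1$ let $\mathcal F_Q$ be the set of Farey fractions of order $Q$, i.e. the reduced fractions $a/q$ with $0<a\le q\le Q$. For $N\ge 1$ let $A=(e(n\theta))_{\theta\in\mathcal F_Q,\,1\le n\le N}$ with $e(x)=e^{2\pi i x}$, and for $\ell\ge 2$ put $$\mathfrak M_\ell(Q)=\frac1N\operatorname{Tr}\Big(\frac{A^*A}{N}\Big)^{\ell}.$$ Let $\operatorname{sinc}(x)=\frac{\sin x}{x}$ for $x\ne 0$ and $\operatorname{sinc}(0)=1$, let $h_{A,B}(x,y)=\frac{B}{y(Ay-Bx)}$, and for $\mathbf A=(A_1,\dots,A_{\ell-1})$, $\mathbf B=(B_1,\dots,B_{\ell-1})$ in $\mathbb Z^{\ell-1}$ let $$\mathcal D_{\mathbf A,\mathbf B}=\{(x,y):0\le x\le y\le 1,\ 0<A_iy-B_ix\le 1 \text{ for } 1\le i\le \ell-1\}.$$ For $\alpha>0$ define $$M_\ell(\alpha)=\frac{6}{\pi^2\alpha}\sum_{\mathbf A,\mathbf B}\iint_{\mathcal D_{\mathbf A,\mathbf B}}\operatorname{sinc}\big(\pi\alpha h_{A_1,B_1}(x,y)\big)\operatorname{sinc}\big(\pi\alpha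 h_{A_{\ell-1},B_{\ell-1}}(x,y)\big)\prod_{i=1}^{\ell-2}\operatorname{sinc}\big(\pi\alpha h_{A_i,B_i}(x,y)-\pi\alpha h_{A_{i+1},B_{i+1}}(x,y)\big)\,dx\,dy,$$ where the sum is over all $\mathbf A,\mathbf B\in\mathbb Z^{\ell-1}$ with $\gcd(A_i,B_i)=1$ and $(A_i,B_i)\ne(0,0)$ for all $i$ (with $\gcd(A,0)=|A|$). Let $\ell\ge 2$. (i) $M_\ell$ is a continuous function on $(0,\infty)$ with values in $[0,\infty)$, and there is an exponent $\theta_\ell>0$ such that, given $0<\gamma_1<\gamma_2$, $$\mathfrak M_\ell(Q)=M_\ell\Big(\frac{N}{Q^2}\Big)+O_{\ell,\gamma_1,\gamma_2}\big(Q^{-\theta_\ell}\big)$$ for all integers $Q,N\ge 1$ with $\gamma_1Q^2\le N\le\gamma_2Q^2$. (ii) For every $\alpha>0$ the expression defining $M_\ell(\alpha)$ is absolutely convergent: each integrand is integrable on $\mathcal D_{\mathbf A,\mathbf B}$, and the sum over $\mathbf A,\mathbf B$ of the integrals of the absolute values of the integrands is finite. (iii) There is $\kappa_\ell>0$ such that,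 given $0<\gamma_1<\gamma_2$, $$|M_\ell(\alpha)-M_\ell(\beta)|\ll_{\ell,\gamma_1,\gamma_2}|\alpha-\beta|^{\kappa_\ell}\qquad\text{for all }\alpha,\beta\in[\gamma_1,\gamma_2].$$ -/

import Mathlib

open scoped Matrix

noncomputable section

namespace LargeSieve

/-- The set `F_Q` of Farey fractions of order `Q`: the reduced fractions `a / q` with
`0 < a ≤ q ≤ Q`. -/
def farey (Q : ℕ) : Finset ℚ :=
  ((Finset.Icc 1 Q ×ˢ Finset.Icc 1 Q).filter
    (fun p : ℕ × ℕ => p.1 ≤ p.2 ∧ Nat.Coprime p.1 p.2)).image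
      (fun p : ℕ × ℕ => (p.1 : ℚ) / (p.2 : ℚ))

theorem mem_farey {Q : ℕ} {r : ℚ} : r ∈ farey Q ↔ 0 < r ∧ r ≤ 1 ∧ r.den ≤ Q := by
  unfold farey
  simp only [Finset.mem_image, Finset.mem_filter, Finset.mem_product, Finset.mem_Icc, Prod.exists]
  constructor
  · rintro ⟨a, q, ⟨⟨⟨ha, -⟩, hq, hqQ⟩, haq, -⟩, rfl⟩
    have hq0 : (0 : ℚ) < q := by exact_mod_cast hq
    have ha0 : (0 : ℚ) < a := by exact_mod_cast ha
    refine ⟨by positivity, ?_, ?_⟩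
    · rw [div_le_one hq0]
      exact_mod_cast haq
    · have hden := Rat.den_dvd a q
      rw [Rat.divInt_eq_div, Int.cast_natCast, Int.cast_natCast] at hden
      exact (Nat.le_of_dvd hq (Int.natCast_dvd_natCast.1 hden)).trans hqQ
  · rintro ⟨h0, h1, hd⟩
    have hnum : 0 < r.num := Rat.num_pos.2 h0
    have hle : r.num ≤ (r.den : ℤ) := by
      have h2 : (r.num : ℚ) / (r.den : ℚ) ≤ 1 := by rw [Rat.num_div_den]; exact h1
      have hd0 : (0 : ℚ) < r.den := by exact_mod_cast r.den_pos
      rw [div_le_one hd0] at h2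
      exact_mod_cast h2
    have hden := r.den_pos
    refine ⟨r.num.natAbs, r.den, ⟨⟨⟨by omega, by omega⟩, by omega, hd⟩, by omega, r.reduced⟩, ?_⟩
    have habs : ((r.num.natAbs : ℕ) : ℤ) = r.num := by omega
    rw [← Int.cast_natCast, habs, Rat.num_div_den]

/-- The matrix `A = (e(n θ))`, with rows indexed by `θ ∈ F_Q` and columns by `1 ≤ n ≤ N`, where
`e(x) = exp (2 π i x)`. The index `n : Fin N` stands for the integer `n + 1`. -/
def sieveMatrix (Q N : ℕ) : Matrix (farey Q) (Fin N) ℂ :=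
  Matrix.of fun θ n =>
    Complex.exp (2 * (Real.pi : ℂ) * Complex.I * (((n : ℕ) : ℂ) + 1) * ((θ : ℚ) : ℂ))

/-- The `ℓ`-th moment `𝔐_ℓ(Q) = N⁻¹ Tr ((A* A / N) ^ ℓ)` of the large sieve matrix `A* A`. -/
def moment (ℓ Q N : ℕ) : ℂ :=
  (N : ℂ)⁻¹ * (((N : ℂ)⁻¹ • ((sieveMatrix Q N)ᴴ * sieveMatrix Q N)) ^ ℓ).trace

/-- `h_{A,B}(x, y) = B / (y (A y - B x))`. -/
def h (A B : ℤ) (p : ℝ × ℝ) : ℝ :=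
  (B : ℝ) / (p.2 * ((A : ℝ) * p.2 - (B : ℝ) * p.1))

/-- The region `𝒟_{𝐀,𝐁}` of all `(x, y)` such that `0 ≤ x ≤ y ≤ 1` and `0 < A_i y - B_i x ≤ 1`
for all `i`. -/
def region {k : ℕ} (A B : Fin k → ℤ) : Set (ℝ × ℝ) :=
  {p | 0 ≤ p.1 ∧ p.1 ≤ p.2 ∧ p.2 ≤ 1 ∧
    ∀ i, 0 < (A i : ℝ) * p.2 - (B i : ℝ) * p.1 ∧ (A i : ℝ) * p.2 - (B i : ℝ) * p.1 ≤ 1}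

/-- The product of sinc factors that is integrated over `𝒟_{𝐀,𝐁}`. The vectors `𝐀` and `𝐁` have
length `m + 1 = ℓ - 1`, so that `ℓ = m + 2`; the index `0` is the first entry, `Fin.last m` is
the last one, and the product runs over the `m = ℓ - 2` pairs of neighbouring entries. -/
def integrand (m : ℕ) (α : ℝ) (A B : Fin (m + 1) → ℤ) (p : ℝ × ℝ) : ℝ :=
  Real.sinc (Real.pi * α * h (A 0) (B 0) p) *
    Real.sinc (Real.pi * α * h (A (Fin.last m)) (B (Fin.last m)) p) *
    ∏ i : Fin m, Real.sinc (Real.pi * α * h (A i.castSucc) (B i.castSucc) p -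
      Real.pi * α * h (A i.succ) (B i.succ) p)

/-- The pairs `(𝐀, 𝐁)` of integer vectors of length `k` with `(A_i, B_i) ≠ (0, 0)` and
`gcd (A_i, B_i) = 1` for all `i`, where `gcd (A, 0) = |A|`. -/
def coprimeVectors (k : ℕ) : Set ((Fin k → ℤ) × (Fin k → ℤ)) :=
  {v | ∀ i, Int.gcd (v.1 i) (v.2 i) = 1 ∧ (v.1 i) ^ 2 + (v.2 i) ^ 2 ≠ 0}

/-- The limiting moment `M_ℓ(α)`, for `ℓ ≥ 2`. -/
def limitMoment (ℓ : ℕ) (α : ℝ) : ℝ :=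
  6 / (Real.pi ^ 2 * α) *
    ∑' v : coprimeVectors (ℓ - 2 + 1),
      ∫ p in region v.1.1 v.1.2, integrand (ℓ - 2) α v.1.1 v.1.2 p

end LargeSieve

end

open scoped Matrix

noncomputable section

namespace LargeSieve

open MeasureTheory

/-! The traces of (A*A/N)^ℓ and (AA*/N)^ℓ agree, and the latter is a sum over closed paths θ₀, θ₁,
…, θ_{ℓ-1}, θ₀ in F_Q of products of the means N⁻¹ ∑ e(n(θ_i - θ_{i+1})) (`moment_eq_sum_chain`). At
a real number δ such a mean is the phase exp(πi(N+1)δ) times sinc(πNδ), up to an error π|δ|, and the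
phases cancel around a closed path.

Fix θ₀ = a/q and let x in [1, q] be the inverse of a modulo q. A unimodular change of basis turns
the representative p/r of θ modulo 1 that is nearest to θ₀ into a primitive pair (A, B). At the
point (x/Q, q/Q) one has Ay - Bx = r/Q, which lies in (0, 1], and h_{A,B} = Q²(p/r - θ₀)
(`form_fareyPair`, `h_fareyPair`). Hence paths based at θ₀ become vectors of pairs whose region
contains this point, and the product of sincs is the integrand at α = N/Q². Conversely, every
admissible pair with |h| < Q²/2 arises in this way (`exists_fareyPair_eq`). As θ₀ runs through F_Q,
(x, q) runs through the coprime pairs with x ≤ q ≤ Q. These are equidistributed with density 6/π²,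
so averaging over θ₀ produces M_ℓ(α) (`exists_abs_coprime_average_sub_le`).

All convergence rests on one fact: at a given point, distinct admissible pairs have values of h at
least 1 apart, because the difference is a nonzero integer determinant divided by a product of two
numbers in (0, 1] (`one_le_hdist`). Each sinc is O(1/(1 + |h_i - h_{i+1}|)), and the product of
these factors around the cycle, even raised to the power 1 - `loss`, has a sum over all vectors that
is bounded uniformly in the point (`sum_chain_rpow_le`, `exists_sum_majorant_le`). This gives
absolute convergence; the spare exponent `loss` gives power savings in all tails and, by
interpolation, Hölder continuity in α. The same argument bounds the paths of Farey fractions that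
stray far from θ₀. Finally M_ℓ is nonnegative as a limit of moments of positive semidefinite
matrices. -/

/-! ### Products of kernels along paths. -/

/-- The product of `k` over the edges of the path `a, v 0, …, v (n - 1), b`. -/
def chain {ι R : Type*} [CommMonoid R] {n : ℕ} (k : ι → ι → R) (a b : ι) (v : Fin n → ι) : R :=
  ∏ j : Fin (n + 1), k ((Fin.cons a v : Fin (n + 1) → ι) j) ((Fin.snoc v b : Fin (n + 1) → ι) j)

theorem chain_zero {ι R : Type*} [CommMonoid R] (k : ι → ι → R) (a b : ι) (v : Fin 0 → ι) :
    chain k a b v = k a b := by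
  rw [chain, Fin.prod_univ_succ, Fin.prod_univ_zero, mul_one]
  rfl

theorem chain_cons {ι R : Type*} [CommMonoid R] {n : ℕ} (k : ι → ι → R) (a b c : ι)
    (w : Fin n → ι) :
    chain k a b (Fin.cons c w : Fin (n + 1) → ι) = k a c * chain k c b w := by
  rw [chain, Fin.prod_univ_succ, ← Fin.cons_snoc_eq_snoc_cons]
  simp only [Fin.cons_zero, Fin.cons_succ]
  rfl

theorem chain_mul {ι R : Type*} [CommMonoid R] {n : ℕ} (k k' : ι → ι → R) (a b : ι)
    (v : Fin n → ι) :
    chain (fun x y => k x y * k' x y) a b v = chain k a b v * chain k' a b v :=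
  Finset.prod_mul_distrib

theorem chain_comp {ι κ R : Type*} [CommMonoid R] {n : ℕ} (f : κ → ι) (k : ι → ι → R) (a b : κ)
    (v : Fin n → κ) :
    chain (fun x y => k (f x) (f y)) a b v = chain k (f a) (f b) (f ∘ v) := by
  induction n generalizing a with
  | zero => simp only [chain_zero]
  | succ n ih =>
    rw [← Fin.cons_self_tail v, Fin.comp_cons, chain_cons, chain_cons, ih]

theorem map_chain {ι R S F : Type*} [CommMonoid R] [CommMonoid S] [FunLike F R S]
    [MonoidHomClass F R S] {n : ℕ} (f : F) (k : ι → ι → R) (a b : ι) (v : Fin n → ι) :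
    f (chain k a b v) = chain (fun x y => f (k x y)) a b v :=
  map_prod f _ _

/-- The factors `u` telescope along the path. On a closed path they disappear altogether, which is
how the phases of the exponential sums are removed. -/
theorem chain_mul_inv_cancel {ι : Type*} {n : ℕ} (u : ι → ℂ) (hu : ∀ x, u x ≠ 0)
    (k : ι → ι → ℂ) (a b : ι) (v : Fin n → ι) :
    chain (fun x y => u x * k x y * (u y)⁻¹) a b v = u a * chain k a b v * (u b)⁻¹ := by
  induction n generalizing a with
  | zero => simp only [chain_zero]
  | succ n ih =>
    rw [← Fin.cons_self_tail v, chain_cons, chain_cons, ih]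
    field_simp [hu]

theorem sum_piFinset_cons {ι R : Type*} [AddCommMonoid R] [DecidableEq ι] {n : ℕ} (S : Finset ι)
    (f : (Fin (n + 1) → ι) → R) :
    ∑ v ∈ Fintype.piFinset (fun _ : Fin (n + 1) => S), f v =
      ∑ c ∈ S, ∑ w ∈ Fintype.piFinset (fun _ : Fin n => S), f (Fin.cons c w) := by
  rw [← Finset.sum_product']
  refine Finset.sum_nbij' (fun v => (v 0, Fin.tail v)) (fun p => Fin.cons p.1 p.2) ?_ ?_ ?_ ?_ ?_
  · intro v hv
    simp only [Fintype.mem_piFinset, Finset.mem_product] at hv ⊢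
    exact ⟨hv 0, fun i => hv i.succ⟩
  · rintro ⟨c, w⟩ h
    simp only [Fintype.mem_piFinset, Finset.mem_product] at h ⊢
    exact fun i => Fin.cases h.1 h.2 i
  · intro v _
    exact Fin.cons_self_tail v
  · rintro ⟨c, w⟩ _
    simp
  · intro v _
    simp

theorem chain_le_chain {ι : Type*} {n : ℕ} {k k' : ι → ι → ℝ} (hk : ∀ x y, 0 ≤ k x y)
    (hkk : ∀ x y, k x y ≤ k' x y) (a b : ι) (v : Fin n → ι) : chain k a b v ≤ chain k' a b v :=
  Finset.prod_le_prod (fun _ _ => hk _ _) fun _ _ => hkk _ _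

theorem chain_const_mul {ι : Type*} {n : ℕ} (c : ℝ) (k : ι → ι → ℝ) (a b : ι) (v : Fin n → ι) :
    chain (fun x y => c * k x y) a b v = c ^ (n + 1) * chain k a b v := by
  rw [chain_mul (fun _ _ => c)]
  simp [chain]

theorem chain_rpow {ι : Type*} {n : ℕ} {k : ι → ι → ℝ} (hk : ∀ x y, 0 ≤ k x y) (r : ℝ) (a b : ι)
    (v : Fin n → ι) : chain (fun x y => k x y ^ r) a b v = chain k a b v ^ r :=
  Real.finsetProd_rpow _ _ (fun _ _ => hk _ _) _

theorem one_le_chain {ι : Type*} {n : ℕ} {k : ι → ι → ℝ} (hk : ∀ x y, 1 ≤ k x y) (a b : ι)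
    (v : Fin n → ι) : 1 ≤ chain k a b v := by
  induction n generalizing a with
  | zero => simpa only [chain_zero] using hk a b
  | succ n ih =>
    rw [← Fin.cons_self_tail v, chain_cons]
    exact one_le_mul_of_one_le_of_one_le (hk _ _) (ih _ _)

/-- A product of factors 1 + d dominates 1 plus the sum of the distances, so by the triangle
inequality the weight of a path controls how far each vertex is from its start. -/
theorem one_add_le_chain {ι : Type*} {n : ℕ} {d : ι → ι → ℝ} (hd : ∀ x y, 0 ≤ d x y)
    (tri : ∀ x y z, d x z ≤ d x y + d y z) (a b : ι) (v : Fin n → ι) (i : Fin n) :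
    1 + d a (v i) ≤ chain (fun x y => 1 + d x y) a b v := by
  induction n generalizing a with
  | zero => exact i.elim0
  | succ n ih =>
    have hk : ∀ x y, 1 ≤ 1 + d x y := fun x y => by linarith [hd x y]
    obtain ⟨c, w, rfl⟩ : ∃ c w, v = Fin.cons c w := ⟨v 0, Fin.tail v, (Fin.cons_self_tail v).symm⟩
    rw [chain_cons]
    refine Fin.cases ?_ (fun j => ?_) i
    · simp only [Fin.cons_zero]
      exact le_mul_of_one_le_right (by linarith [hd a c]) (one_le_chain hk c b w)
    · simp only [Fin.cons_succ]
      have h1 := ih c w j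
      have h2 := tri a c (w j)
      calc 1 + d a (w j) ≤ (1 + d a c) * (1 + d c (w j)) := by
            nlinarith [hd a c, hd c (w j), mul_nonneg (hd a c) (hd c (w j))]
        _ ≤ _ := mul_le_mul_of_nonneg_left h1 (by linarith [hd a c])

/-- The factors are exchanged one at a time, all others having norm at most 1. The set `S` is there
because the kernels need only be close at the vertices visited. -/
theorem norm_chain_sub_chain_le {ι : Type*} {n : ℕ} {k k' : ι → ι → ℂ} {δ : ℝ} (a b : ι)
    (S : Set ι) (ha : a ∈ S) (hb : b ∈ S)
    (hk : ∀ x y, ‖k x y‖ ≤ 1) (hk' : ∀ x y, ‖k' x y‖ ≤ 1)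
    (h : ∀ x ∈ S, ∀ y ∈ S, ‖k x y - k' x y‖ ≤ δ) (v : Fin n → ι) (hv : ∀ i, v i ∈ S) :
    ‖chain k a b v - chain k' a b v‖ ≤ (n + 1) * δ := by
  induction n generalizing a with
  | zero => simpa only [chain_zero, Nat.cast_zero, zero_add, one_mul] using h a ha b hb
  | succ n ih =>
    obtain ⟨c, w, rfl⟩ : ∃ c w, v = Fin.cons c w := ⟨v 0, Fin.tail v, (Fin.cons_self_tail v).symm⟩
    have hc : c ∈ S := hv 0
    have hw : ∀ i, w i ∈ S := fun i => hv i.succ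
    rw [chain_cons, chain_cons]
    have h1 := ih c hc w hw
    have h2 := h a ha c hc
    have h3 : ‖chain k' c b w‖ ≤ 1 := by
      rw [chain, norm_prod]
      exact Finset.prod_le_one (fun _ _ => norm_nonneg _) fun _ _ => hk' _ _
    have e : k a c * chain k c b w - k' a c * chain k' c b w =
        k a c * (chain k c b w - chain k' c b w) + (k a c - k' a c) * chain k' c b w := by ring
    rw [e]
    calc _ ≤ ‖k a c‖ * ‖chain k c b w - chain k' c b w‖ + ‖k a c - k' a c‖ * ‖chain k' c b w‖ := by
          rw [← norm_mul, ← norm_mul]; exact norm_add_le _ _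
      _ ≤ 1 * ((n + 1) * δ) + δ * 1 := by
          gcongr
          · exact hk a c
          · exact (norm_nonneg _).trans h2
      _ = _ := by push_cast; ring

/-! ### Discrete convolution bounds over separated points. -/

/-- One step of a discrete convolution bound. -/
theorem sum_conv_rpow_le {ι : Type*} {d : ι → ι → ℝ} (hd : ∀ x y, 0 ≤ d x y)
    (tri : ∀ x y z, d x z ≤ d x y + d y z) (S : Finset ι) {ε C σ : ℝ} (hε : 0 < ε)
    (hσ : σ ≤ 1 - ε) (hσ2 : 0 ≤ σ - 2 * ε) (a b : ι)
    (h1 : ∑ c ∈ S, (1 + d a c) ^ (-(1 + ε)) ≤ C) (h2 : ∑ c ∈ S, (1 + d c b) ^ (-(1 + ε)) ≤ C) :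
    ∑ c ∈ S, (1 + d a c) ^ (-(1 - ε)) * (1 + d c b) ^ (-σ) ≤
      4 * C * (1 + d a b) ^ (-(σ - 2 * ε)) := by
  -- The larger factor `u` is at least half of 1 + d a b. Its power σ - 2ε is pulled out, and the
  -- rest of its exponent is moved to the smaller factor `w`, which then carries exactly 1 + ε, a
  -- summable exponent.
  have key : ∀ u w : ℝ, 1 ≤ u → 1 ≤ w → 1 + d a b ≤ u + w → ∀ p q : ℝ, 0 ≤ p → 0 ≤ q →
      p + q = 1 - ε + σ → σ - 2 * ε ≤ p → w ≤ u →
      u ^ (-p) * w ^ (-q) ≤ 2 * (1 + d a b) ^ (-(σ - 2 * ε)) * w ^ (-(1 + ε)) := by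
    intro u w hu hw huw p q hp hq hpq hp2 hwu
    have hD : 0 < 1 + d a b := by linarith [hd a b]
    have u0 : 0 < u := by linarith
    have w0 : 0 < w := by linarith
    have e1 : u ^ (-p) = u ^ (-(σ - 2 * ε)) * u ^ (-(p - (σ - 2 * ε))) := by
      rw [← Real.rpow_add u0]; congr 1; ring
    have e2 : u ^ (-(p - (σ - 2 * ε))) ≤ w ^ (-(p - (σ - 2 * ε))) :=
      Real.rpow_le_rpow_of_nonpos w0 hwu (by linarith)
    have e3 : w ^ (-(p - (σ - 2 * ε))) * w ^ (-q) = w ^ (-(1 + ε)) := by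
      rw [← Real.rpow_add w0]; congr 1; linarith
    have e4 : u ^ (-(σ - 2 * ε)) ≤ 2 * (1 + d a b) ^ (-(σ - 2 * ε)) := by
      calc u ^ (-(σ - 2 * ε)) ≤ ((1 + d a b) / 2) ^ (-(σ - 2 * ε)) :=
            Real.rpow_le_rpow_of_nonpos (by positivity) (by linarith) (by linarith)
        _ = (1 + d a b) ^ (-(σ - 2 * ε)) * 2 ^ (σ - 2 * ε) := by
            rw [Real.div_rpow hD.le (by norm_num), Real.rpow_neg (by norm_num : (0:ℝ) ≤ 2),
              div_inv_eq_mul]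
        _ ≤ (1 + d a b) ^ (-(σ - 2 * ε)) * 2 ^ (1 : ℝ) := by
            gcongr
            · norm_num
            · linarith
        _ = _ := by rw [Real.rpow_one]; ring
    calc u ^ (-p) * w ^ (-q)
        ≤ (2 * (1 + d a b) ^ (-(σ - 2 * ε))) * w ^ (-(p - (σ - 2 * ε))) * w ^ (-q) := by
          rw [e1]; gcongr
      _ = _ := by rw [mul_assoc, e3]
  calc ∑ c ∈ S, (1 + d a c) ^ (-(1 - ε)) * (1 + d c b) ^ (-σ)
      ≤ ∑ c ∈ S, 2 * (1 + d a b) ^ (-(σ - 2 * ε)) *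
          ((1 + d a c) ^ (-(1 + ε)) + (1 + d c b) ^ (-(1 + ε))) := by
        refine Finset.sum_le_sum fun c _ => ?_
        have hu : 1 ≤ 1 + d a c := by linarith [hd a c]
        have hw : 1 ≤ 1 + d c b := by linarith [hd c b]
        have htri : 1 + d a b ≤ (1 + d a c) + (1 + d c b) := by linarith [tri a c b]
        have hD : 0 < 1 + d a b := by linarith [hd a b]
        have pos : 0 ≤ 2 * (1 + d a b) ^ (-(σ - 2 * ε)) := by positivity
        have p1 : 0 ≤ (1 + d a c) ^ (-(1 + ε)) := by positivity
        have p2 : 0 ≤ (1 + d c b) ^ (-(1 + ε)) := by positivity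
        rcases le_total (1 + d c b) (1 + d a c) with hle | hle
        · refine (key _ _ hu hw htri (1 - ε) σ (by linarith) (by linarith) (by ring)
            (by linarith) hle).trans ?_
          exact mul_le_mul_of_nonneg_left (by linarith) pos
        · rw [mul_comm]
          refine (key _ _ hw hu (by linarith) σ (1 - ε) (by linarith) (by linarith) (by ring)
            (by linarith) hle).trans ?_
          exact mul_le_mul_of_nonneg_left (by linarith) pos
    _ = 2 * (1 + d a b) ^ (-(σ - 2 * ε)) *
          (∑ c ∈ S, (1 + d a c) ^ (-(1 + ε)) + ∑ c ∈ S, (1 + d c b) ^ (-(1 + ε))) := by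
        rw [← Finset.mul_sum, Finset.sum_add_distrib]
    _ ≤ 2 * (1 + d a b) ^ (-(σ - 2 * ε)) * (C + C) := by
        have hD : 0 < 1 + d a b := by linarith [hd a b]
        gcongr
    _ = _ := by ring

/-- Summing out one vertex costs a factor 4C and 2ε in the exponent; `hn` says that the exponent
survives all `n` steps. The base point `b` is allowed to lie outside `S`. -/
theorem sum_chain_rpow_le {ι : Type*} [DecidableEq ι] {d : ι → ι → ℝ} (hd : ∀ x y, 0 ≤ d x y)
    (tri : ∀ x y z, d x z ≤ d x y + d y z) (S : Finset ι) {ε C : ℝ} (hε : 0 < ε)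
    (b : ι) (h1 : ∀ a ∈ insert b S, ∑ c ∈ S, (1 + d a c) ^ (-(1 + ε)) ≤ C)
    (h2 : ∑ c ∈ S, (1 + d c b) ^ (-(1 + ε)) ≤ C)
    (n : ℕ) (hn : 0 ≤ 1 - ε - 2 * ε * n) (a : ι) (ha : a ∈ insert b S) :
    ∑ v ∈ Fintype.piFinset (fun _ : Fin n => S), chain (fun x y => (1 + d x y) ^ (-(1 - ε))) a b v ≤
      (4 * C) ^ n * (1 + d a b) ^ (-(1 - ε - 2 * ε * n)) := by
  induction n generalizing a with
  | zero => simp [chain_zero]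
  | succ n ih =>
    have hC : 0 ≤ C := le_trans (Finset.sum_nonneg fun c _ =>
      Real.rpow_nonneg (by linarith [hd c b]) _) h2
    push_cast at hn
    have hn' : 0 ≤ 1 - ε - 2 * ε * n := by nlinarith
    rw [sum_piFinset_cons]
    calc _ = ∑ c ∈ S, (1 + d a c) ^ (-(1 - ε)) *
          ∑ w ∈ Fintype.piFinset (fun _ : Fin n => S),
            chain (fun x y => (1 + d x y) ^ (-(1 - ε))) c b w := by
          simp only [chain_cons, Finset.mul_sum]
      _ ≤ ∑ c ∈ S, (1 + d a c) ^ (-(1 - ε)) *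
          ((4 * C) ^ n * (1 + d c b) ^ (-(1 - ε - 2 * ε * n))) := by
          refine Finset.sum_le_sum fun c hc => ?_
          refine mul_le_mul_of_nonneg_left (ih hn' c (Finset.mem_insert_of_mem hc)) ?_
          exact Real.rpow_nonneg (by linarith [hd a c]) _
      _ = (4 * C) ^ n * ∑ c ∈ S, (1 + d a c) ^ (-(1 - ε)) *
          (1 + d c b) ^ (-(1 - ε - 2 * ε * n)) := by
          rw [Finset.mul_sum]
          exact Finset.sum_congr rfl fun c _ => by ring
      _ ≤ (4 * C) ^ n * (4 * C * (1 + d a b) ^ (-(1 - ε - 2 * ε * n - 2 * ε))) := by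
          refine mul_le_mul_of_nonneg_left ?_ (by positivity)
          exact sum_conv_rpow_le hd tri S hε (by nlinarith [n.cast_nonneg (α := ℝ)]) (by linarith) a b (h1 a ha) h2
      _ = _ := by
          rw [pow_succ]; push_cast
          rw [show 1 - ε - 2 * ε * n - 2 * ε = 1 - ε - 2 * ε * (n + 1) by ring]; ring

/-- The floor is injective on 1-separated reals, so the sum is compared with a convergent one over
the integers. -/
theorem exists_sum_separated_rpow_le {r : ℝ} (hr : 1 < r) : ∃ C : ℝ, 0 < C ∧
    ∀ {ι : Type} (S : Finset ι) (g : ι → ℝ),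
      (∀ x ∈ S, ∀ y ∈ S, x ≠ y → 1 ≤ |g x - g y|) → ∑ c ∈ S, (1 + |g c|) ^ (-r) ≤ C := by
  classical
  -- The second summand is needed at n = 0, where the real power `0 ^ (-r)` takes the value 0.
  let F : ℤ → ℝ := fun n => 2 ^ r * (|(n : ℝ)| ^ (-r) + if n = 0 then 1 else 0)
  have hF0 : ∀ n, 0 ≤ F n := fun n => by
    have : (0 : ℝ) ≤ if n = 0 then 1 else 0 := by split_ifs <;> norm_num
    have := Real.rpow_nonneg (abs_nonneg (n : ℝ)) (-r)
    positivity
  have hF : Summable F :=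
    ((Real.summable_abs_int_rpow hr).add (summable_of_hasFiniteSupport
      ((Set.finite_singleton (0 : ℤ)).subset fun n hn => by
        by_contra h
        exact hn (if_neg h)))).mul_left _
  refine ⟨(∑' n, F n) + 1, by have := tsum_nonneg (L := .unconditional ℤ) hF0; linarith, fun {ι} S g hg => ?_⟩
  have hinj : Set.InjOn (fun c => ⌊g c⌋) S := by
    intro x hx y hy hxy
    by_contra hne
    have := Int.abs_sub_lt_one_of_floor_eq_floor hxy
    linarith [hg x hx y hy hne]
  calc ∑ c ∈ S, (1 + |g c|) ^ (-r) ≤ ∑ c ∈ S, F ⌊g c⌋ := by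
        refine Finset.sum_le_sum fun c _ => ?_
        have h1 : 1 + |(⌊g c⌋ : ℝ)| ≤ 2 * (1 + |g c|) := by
          have e1 := Int.floor_le (g c)
          have e2 := Int.lt_floor_add_one (g c)
          have : |(⌊g c⌋ : ℝ)| ≤ |g c| + 1 := by
            rw [abs_le]; constructor <;> linarith [neg_abs_le (g c), le_abs_self (g c)]
          linarith [abs_nonneg (g c)]
        have h2 : (1 + |g c|) ^ (-r) ≤ 2 ^ r * (1 + |(⌊g c⌋ : ℝ)|) ^ (-r) := by
          calc (1 + |g c|) ^ (-r) ≤ ((1 + |(⌊g c⌋ : ℝ)|) / 2) ^ (-r) :=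
                Real.rpow_le_rpow_of_nonpos (by positivity) (by linarith) (by linarith)
            _ = _ := by
                rw [Real.div_rpow (by positivity) (by norm_num),
                  Real.rpow_neg (by norm_num : (0:ℝ) ≤ 2), div_inv_eq_mul, mul_comm]
        refine h2.trans (mul_le_mul_of_nonneg_left ?_ (by positivity))
        split_ifs with h0
        · simp only [h0, Int.cast_zero, abs_zero, add_zero, Real.one_rpow]
          linarith [Real.rpow_nonneg le_rfl (-r)]
        · rw [add_zero]
          exact Real.rpow_le_rpow_of_nonpos (by positivity) (by linarith) (by linarith)
    _ = ∑ n ∈ S.image (fun c => ⌊g c⌋), F n := (Finset.sum_image hinj).symm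
    _ ≤ ∑' n, F n := hF.sum_le_tsum _ fun _ _ => hF0 _
    _ ≤ _ := by linarith

/-! ### Estimates for sinc and for the exponential mean. -/

theorem sinc_eq_integral_cos (u : ℝ) : Real.sinc u = ∫ t in (0 : ℝ)..1, Real.cos (u * t) := by
  by_cases hu : u = 0
  · simp [hu]
  · rw [intervalIntegral.integral_comp_mul_left _ hu, integral_cos, Real.sinc_of_ne_zero hu]
    simp [div_eq_inv_mul]

theorem abs_sinc_sub_sinc_le (u v : ℝ) : |Real.sinc u - Real.sinc v| ≤ |u - v| := by
  have hc : ∀ w : ℝ, IntervalIntegrable (fun t => Real.cos (w * t)) MeasureTheory.volume 0 1 :=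
    fun w => (by fun_prop : Continuous fun t => Real.cos (w * t)).intervalIntegrable _ _
  rw [sinc_eq_integral_cos, sinc_eq_integral_cos, ← intervalIntegral.integral_sub (hc u) (hc v)]
  have := intervalIntegral.norm_integral_le_of_norm_le_const (a := (0 : ℝ)) (b := 1)
    (f := fun t => Real.cos (u * t) - Real.cos (v * t)) (C := |u - v|) (fun t ht => by
      rw [Set.uIoc_of_le zero_le_one] at ht
      refine (Real.abs_cos_sub_cos_le _ _).trans ?_
      rw [← sub_mul, abs_mul, abs_of_pos ht.1]
      exact mul_le_of_le_one_right (abs_nonneg _) ht.2)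
  simpa using this

/-- The Lipschitz bound would grow with t. Multiplying by at and using that sine is Lipschitz makes
t cancel, which matters because t will be an unbounded difference of values of `h`. -/
theorem abs_sinc_mul_sub_sinc_mul_le {a b : ℝ} (ha : 0 < a) (t : ℝ) :
    |Real.sinc (a * t) - Real.sinc (b * t)| ≤ 2 * |a - b| / a := by
  have h1 : ∀ u : ℝ, u * Real.sinc u = Real.sin u := fun u => by
    by_cases hu : u = 0
    · simp [hu]
    · rw [Real.sinc_of_ne_zero hu]; field_simp
  by_cases ht : t = 0
  · simp only [ht, mul_zero, sub_self, abs_zero]; positivity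
  have e : a * t * (Real.sinc (a * t) - Real.sinc (b * t)) =
      (Real.sin (a * t) - Real.sin (b * t)) + (b - a) * t * Real.sinc (b * t) := by
    rw [← h1 (a * t), ← h1 (b * t)]; ring
  have h2 : |a * t * (Real.sinc (a * t) - Real.sinc (b * t))| ≤ 2 * |a - b| * |t| := by
    rw [e]
    refine (abs_add_le _ _).trans ?_
    have e1 := Real.abs_sin_sub_sin_le (a * t) (b * t)
    rw [← sub_mul, abs_mul] at e1
    have e2 : |(b - a) * t * Real.sinc (b * t)| ≤ |a - b| * |t| := by
      rw [abs_mul, abs_mul, abs_sub_comm b a]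
      exact mul_le_of_le_one_right (by positivity) (Real.abs_sinc_le_one _)
    linarith
  rw [abs_mul, abs_mul, abs_of_pos ha] at h2
  rw [le_div_iff₀ ha]
  have ht' : 0 < |t| := abs_pos.2 ht
  nlinarith

theorem abs_sinc_le (u : ℝ) : |Real.sinc u| ≤ 2 * (1 + |u|)⁻¹ := by
  have h1 : |u| * |Real.sinc u| ≤ 1 := by
    by_cases hu : u = 0
    · simp [hu]
    · rw [← abs_mul, Real.sinc_of_ne_zero hu, mul_div_cancel₀ _ hu]
      exact Real.abs_sin_le_one u
  rw [← div_eq_mul_inv, le_div_iff₀ (by positivity)]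
  linarith [Real.abs_sinc_le_one u]

/-- The normalised exponential sum `N⁻¹ ∑_{n ≤ N} e(n x)`. -/
def expMean (N : ℕ) (x : ℝ) : ℂ :=
  (N : ℂ)⁻¹ * ∑ n : Fin N,
    Complex.exp (2 * (Real.pi : ℂ) * Complex.I * (((n : ℕ) : ℂ) + 1) * (x : ℂ))

theorem expMean_add_intCast (N : ℕ) (x : ℝ) (k : ℤ) : expMean N (x + k) = expMean N x := by
  unfold expMean
  congr 1
  refine Finset.sum_congr rfl fun n _ => ?_
  rw [Complex.exp_eq_exp_iff_exists_int]
  refine ⟨(n + 1) * k, ?_⟩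
  push_cast
  ring

theorem norm_expMean_le_one (N : ℕ) (x : ℝ) : ‖expMean N x‖ ≤ 1 := by
  have h1 : ‖∑ n : Fin N,
      Complex.exp (2 * (Real.pi : ℂ) * Complex.I * (((n : ℕ) : ℂ) + 1) * (x : ℂ))‖ ≤ N := by
    refine (norm_sum_le _ _).trans ?_
    have : ∀ n : Fin N,
        ‖Complex.exp (2 * (Real.pi : ℂ) * Complex.I * (((n : ℕ) : ℂ) + 1) * (x : ℂ))‖ = 1 := by
      intro n
      have := Complex.norm_exp_ofReal_mul_I (2 * Real.pi * (n + 1) * x)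
      push_cast at this
      rw [← this]
      congr 2
      ring
    simp [this]
  unfold expMean
  rw [norm_mul, norm_inv, Complex.norm_natCast]
  rcases Nat.eq_zero_or_pos N with rfl | hN
  · simp
  · have : (0 : ℝ) < N := by exact_mod_cast hN
    rw [inv_mul_le_iff₀ this, mul_one]
    exact h1

theorem expMean_mul_sin {N : ℕ} (hN : 1 ≤ N) (x : ℝ) :
    N * expMean N x * (Real.sin (Real.pi * x) : ℂ) =
      Complex.exp (Real.pi * Complex.I * (N + 1) * x) * (Real.sin (Real.pi * (N * x)) : ℂ) := by
  have hN0 : (N : ℂ) ≠ 0 := by exact_mod_cast (by omega : N ≠ 0)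
  -- With w = exp(πix) the mean is a geometric series in w², and both sines are Laurent polynomials
  -- in w.
  set w : ℂ := Complex.exp (Real.pi * x * Complex.I) with hw
  have hw0 : w ≠ 0 := Complex.exp_ne_zero _
  have hpow : ∀ k : ℕ, Complex.exp (Real.pi * (k * x) * Complex.I) = w ^ k := fun k => by
    rw [hw, ← Complex.exp_nat_mul]; congr 1; ring
  have hsum : (N : ℂ) * expMean N x = ∑ n ∈ Finset.range N, w ^ (2 * (n + 1)) := by
    unfold expMean
    rw [mul_inv_cancel_left₀ hN0, Fin.sum_univ_eq_sum_range (fun n : ℕ =>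
      Complex.exp (2 * (Real.pi : ℂ) * Complex.I * ((n : ℂ) + 1) * (x : ℂ)))]
    refine Finset.sum_congr rfl fun n _ => ?_
    rw [← hpow]; congr 1; push_cast; ring
  have hgeom : ∀ M : ℕ, (∑ n ∈ Finset.range M, w ^ (2 * (n + 1))) * (w ^ 2 - 1) =
      w ^ 2 * (w ^ (2 * M) - 1) := by
    intro M
    induction M with
    | zero => simp
    | succ M ih => rw [Finset.sum_range_succ, add_mul, ih]; ring
  have hs : ∀ k : ℕ, Complex.sin (Real.pi * (k * x)) = (w ^ k)⁻¹ * (1 - w ^ (2 * k)) * Complex.I / 2 := by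
    intro k
    rw [Complex.sin, neg_mul, Complex.exp_neg, hpow, pow_mul', sq]
    have := pow_ne_zero k hw0
    field_simp
  have hs1 := hs 1
  simp only [Nat.cast_one, one_mul, pow_one, mul_one] at hs1
  have hexp : Complex.exp (Real.pi * Complex.I * (N + 1) * x) = w ^ (N + 1) := by
    rw [← hpow]; congr 1; push_cast; ring
  rw [hsum, hexp]
  push_cast
  rw [hs, hs1]
  have := pow_ne_zero N hw0
  have hg := hgeom N
  calc (∑ n ∈ Finset.range N, w ^ (2 * (n + 1))) * (w⁻¹ * (1 - w ^ 2) * Complex.I / 2) =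
      -((∑ n ∈ Finset.range N, w ^ (2 * (n + 1))) * (w ^ 2 - 1)) * w⁻¹ * Complex.I / 2 := by ring
    _ = _ := by rw [hg]; field_simp; ring

/-- This form avoids division, so it also holds where sin(πx) vanishes. -/
theorem expMean_mul_sinc {N : ℕ} (hN : 1 ≤ N) (x : ℝ) :
    expMean N x * (Real.sinc (Real.pi * x) : ℂ) =
      Complex.exp (Real.pi * Complex.I * (N + 1) * x) * (Real.sinc (Real.pi * (N * x)) : ℂ) := by
  have hN0 : (N : ℂ) ≠ 0 := by exact_mod_cast (by omega : N ≠ 0)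
  have hN1 : (N : ℝ) ≠ 0 := by exact_mod_cast (by omega : N ≠ 0)
  by_cases hx : x = 0
  · simp [hx, expMean, hN0]
  · have hpi := Real.pi_ne_zero
    have hpi' : (Real.pi : ℂ) ≠ 0 := by exact_mod_cast hpi
    have hx' : (x : ℂ) ≠ 0 := by exact_mod_cast hx
    rw [Real.sinc_of_ne_zero (mul_ne_zero hpi hx),
      Real.sinc_of_ne_zero (mul_ne_zero hpi (mul_ne_zero hN1 hx))]
    have := expMean_mul_sin hN x
    rw [Complex.ofReal_div, Complex.ofReal_div, mul_div_assoc', mul_div_assoc', ← this]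
    push_cast
    field_simp

/-- By the preceding identity the difference is exactly the mean times 1 - sinc(πx). -/
theorem norm_expMean_sub_le {N : ℕ} (hN : 1 ≤ N) (x : ℝ) :
    ‖expMean N x -
      Complex.exp (Real.pi * Complex.I * (N + 1) * x) * (Real.sinc (Real.pi * (N * x)) : ℂ)‖ ≤
      Real.pi * |x| := by
  rw [← expMean_mul_sinc hN]
  have e : expMean N x - expMean N x * (Real.sinc (Real.pi * x) : ℂ) =
      expMean N x * ((Real.sinc 0 - Real.sinc (Real.pi * x) : ℝ) : ℂ) := by
    rw [Real.sinc_zero]; push_cast; ring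
  rw [e, norm_mul, Complex.norm_real, Real.norm_eq_abs]
  have h1 := abs_sinc_sub_sinc_le 0 (Real.pi * x)
  rw [zero_sub, abs_neg, abs_mul, abs_of_pos Real.pi_pos] at h1
  calc _ ≤ 1 * (Real.pi * |x|) := by gcongr; exact norm_expMean_le_one _ _
    _ = _ := one_mul _

/-- After reduction to |y| ≤ 1/2, periodicity and |sin(πy)| ≥ 2|y| give decay in the distance to the
nearest integer; R will be Q². -/
theorem norm_expMean_le {γ : ℝ} (hγ : 0 < γ) {N : ℕ} (hN : 1 ≤ N) {R : ℝ} (hR : γ * R ≤ N)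
    (hR0 : 0 ≤ R) (x : ℝ) :
    ‖expMean N x‖ ≤ (1 + 1 / γ) * (1 + R * |x - round x|)⁻¹ := by
  set y := x - round x with hy
  have hy2 : |y| ≤ 1 / 2 := abs_sub_round x
  have hK : expMean N x = expMean N y := by
    have := expMean_add_intCast N y (round x)
    rwa [hy, sub_add_cancel] at this
  have h1 := congrArg norm (expMean_mul_sin hN y)
  have hu : ‖Complex.exp (Real.pi * Complex.I * (N + 1) * y)‖ = 1 := by
    have := Complex.norm_exp_ofReal_mul_I (Real.pi * (N + 1) * y)
    push_cast at this
    rw [← this]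
    congr 2
    ring
  rw [norm_mul, norm_mul, norm_mul, hu, one_mul, Complex.norm_natCast, Complex.norm_real,
    Complex.norm_real, Real.norm_eq_abs, Real.norm_eq_abs] at h1
  have h2 := Real.abs_sin_le_one (Real.pi * (N * y))
  have h3 : 2 * |y| ≤ |Real.sin (Real.pi * y)| := by
    have := Real.mul_abs_le_abs_sin (x := Real.pi * y) (by
      rw [abs_mul, abs_of_pos Real.pi_pos]; nlinarith [Real.pi_pos])
    rw [abs_mul, abs_of_pos Real.pi_pos] at this
    refine le_trans (le_of_eq ?_) this
    have := Real.pi_ne_zero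
    field_simp
  rw [hK, ← div_eq_mul_inv, le_div_iff₀ (by positivity)]
  have hle := norm_expMean_le_one N y
  have h4 : ‖expMean N y‖ * (γ * R * |y|) ≤ 1 := by
    calc ‖expMean N y‖ * (γ * R * |y|) ≤ ‖expMean N y‖ * (N * |Real.sin (Real.pi * y)|) := by
          have : |y| ≤ |Real.sin (Real.pi * y)| := by linarith [abs_nonneg y]
          gcongr
      _ = N * ‖expMean N y‖ * |Real.sin (Real.pi * y)| := by ring
      _ ≤ 1 := by rw [h1]; exact h2
  have h5 : ‖expMean N y‖ * (R * |y|) ≤ 1 / γ := by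
    rw [le_div_iff₀ hγ]; linarith
  linarith

/-! ### Separation of the values of `h` and the pointwise majorant. -/

/-- The pairs of coprime integers `(A, B)` with `0 < A y - B x ≤ 1`. -/
def admissible (p : ℝ × ℝ) : Set (ℤ × ℤ) :=
  {w | Int.gcd w.1 w.2 = 1 ∧ 0 < (w.1 : ℝ) * p.2 - (w.2 : ℝ) * p.1 ∧
    (w.1 : ℝ) * p.2 - (w.2 : ℝ) * p.1 ≤ 1}

/-- The distance between the values of `h` at two pairs. -/
def hdist (p : ℝ × ℝ) (w w' : ℤ × ℤ) : ℝ := |h w.1 w.2 p - h w'.1 w'.2 p|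

/-- The sinc factor attached to two pairs. -/
def sincKernel (α : ℝ) (p : ℝ × ℝ) (w w' : ℤ × ℤ) : ℝ :=
  Real.sinc (Real.pi * α * h w.1 w.2 p - Real.pi * α * h w'.1 w'.2 p)

/-- The sequence of pairs `(A_i, B_i)`. -/
def pairs {k : ℕ} (v : (Fin k → ℤ) × (Fin k → ℤ)) (i : Fin k) : ℤ × ℤ := (v.1 i, v.2 i)

/-- The product of `1 + |h_i - h_{i+1}|` over the closed path through the pairs. -/
def weight {k : ℕ} (p : ℝ × ℝ) (w : Fin k → ℤ × ℤ) : ℝ :=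
  chain (fun w w' => 1 + hdist p w w') (1, 0) (1, 0) w

/-- The loss in the exponent of the summable majorant. -/
def loss (k : ℕ) : ℝ := 1 / (2 * (k + 1))

theorem loss_pos (k : ℕ) : 0 < loss k := by unfold loss; positivity

theorem loss_le (k : ℕ) : loss k ≤ 1 / 2 := by
  unfold loss
  rw [div_le_div_iff₀ (by positivity) (by norm_num)]
  nlinarith [k.cast_nonneg (α := ℝ)]

/-- The exponent left after `k` convolution steps, started from 1 - `loss k`, is in fact `loss k`
itself. -/
theorem loss_spec (k : ℕ) : 0 ≤ 1 - loss k - 2 * loss k * k := by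
  have : loss k * (2 * (k + 1)) = 1 := by unfold loss; field_simp
  nlinarith [loss_pos k]

theorem hdist_nonneg (p : ℝ × ℝ) (w w' : ℤ × ℤ) : 0 ≤ hdist p w w' := abs_nonneg _

theorem hdist_comm (p : ℝ × ℝ) (w w' : ℤ × ℤ) : hdist p w w' = hdist p w' w := abs_sub_comm _ _

theorem hdist_triangle (p : ℝ × ℝ) (w w' w'' : ℤ × ℤ) :
    hdist p w w'' ≤ hdist p w w' + hdist p w' w'' := abs_sub_le _ _ _

theorem h_one_zero (p : ℝ × ℝ) : h 1 0 p = 0 := by simp [h]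

theorem pairs_injective (k : ℕ) : Function.Injective (pairs (k := k)) := by
  intro v v' hv
  have h1 := fun i => congrArg Prod.fst (congrFun hv i)
  have h2 := fun i => congrArg Prod.snd (congrFun hv i)
  exact Prod.ext (funext h1) (funext h2)

/-- The pair (1, 0) has h = 0 and stands for the base point. The two unpaired sinc factors are the
edges joining it to the first and last pairs, so the integrand is a product around a closed path. -/
theorem integrand_eq_chain (m : ℕ) (α : ℝ) (v : (Fin (m + 1) → ℤ) × (Fin (m + 1) → ℤ))
    (p : ℝ × ℝ) :
    integrand m α v.1 v.2 p = chain (sincKernel α p) (1, 0) (1, 0) (pairs v) := by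
  rw [chain, Fin.prod_univ_succ, Fin.prod_univ_castSucc]
  simp only [Fin.cons_zero, Fin.cons_succ]
  simp only [Fin.succ_castSucc, Fin.snoc_castSucc]
  rw [← Fin.castSucc_zero, Fin.snoc_castSucc, Fin.succ_last, Fin.snoc_last]
  simp only [sincKernel, pairs, h_one_zero, integrand, mul_zero, zero_sub, sub_zero, Real.sinc_neg]
  ring

/-- The difference of the two values is the integer determinant BA' - B'A divided by the product of
the two forms. That product is at most 1, and the determinant is nonzero for distinct admissible
pairs. -/
theorem one_le_hdist {p : ℝ × ℝ} (hp : 0 < p.2) {w w' : ℤ × ℤ} (hw : w ∈ admissible p)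
    (hw' : w' ∈ admissible p) (hne : w ≠ w') : 1 ≤ hdist p w w' := by
  obtain ⟨A, B⟩ := w
  obtain ⟨A', B'⟩ := w'
  obtain ⟨g, y0, y1⟩ := hw
  obtain ⟨g', y0', y1'⟩ := hw'
  simp only at g g' y0 y1 y0' y1'
  have hdet : B * A' - B' * A ≠ 0 := by
    intro h0
    apply hne
    obtain ⟨u, v, huv⟩ := Int.isCoprime_iff_gcd_eq_one.2 g
    -- By Bézout, a vanishing determinant makes (A', B') equal to t(A, B). Primitivity forces t =
    -- ±1, and positivity of both forms excludes -1.
    set t := u * A' + v * B' with ht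
    have hA : A' = t * A := by linear_combination (-A') * huv + v * h0
    have hB : B' = t * B := by linear_combination (-B') * huv - u * h0
    have ht1 : IsUnit t := by
      have h1 : t ∣ A' := ⟨A, hA⟩
      have h2 : t ∣ B' := ⟨B, hB⟩
      exact (Int.isCoprime_iff_gcd_eq_one.2 g').isUnit_of_dvd' h1 h2
    have hpos : 0 < t := by
      by_contra hle
      have hle' : (t : ℝ) ≤ 0 := by exact_mod_cast not_lt.1 hle
      rw [hA, hB] at y0'
      push_cast at y0'
      nlinarith
    rcases Int.isUnit_iff.1 ht1 with h1 | h1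
    · rw [hA, hB, h1, one_mul, one_mul]
    · omega
  have e : h A B p - h A' B' p = ((B * A' - B' * A : ℤ) : ℝ) /
      (((A : ℝ) * p.2 - B * p.1) * ((A' : ℝ) * p.2 - B' * p.1)) := by
    unfold h
    push_cast
    rw [div_sub_div _ _ (mul_pos hp y0).ne' (mul_pos hp y0').ne',
      div_eq_div_iff (mul_pos (mul_pos hp y0) (mul_pos hp y0')).ne' (mul_pos y0 y0').ne']
    ring
  unfold hdist
  rw [e, abs_div, abs_of_pos (mul_pos y0 y0'), le_div_iff₀ (mul_pos y0 y0'), one_mul]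
  calc _ ≤ (1 : ℝ) := mul_le_one₀ y1 y0'.le y1'
    _ ≤ _ := by exact_mod_cast Int.one_le_abs hdet

theorem one_le_weight {k : ℕ} (p : ℝ × ℝ) (w : Fin k → ℤ × ℤ) : 1 ≤ weight p w :=
  one_le_chain (fun x y => by linarith [hdist_nonneg p x y]) _ _ _

theorem one_add_abs_h_le_weight {k : ℕ} (p : ℝ × ℝ) (w : Fin k → ℤ × ℤ) (i : Fin k) :
    1 + |h (w i).1 (w i).2 p| ≤ weight p w := by
  have := one_add_le_chain (hdist_nonneg p) (hdist_triangle p) (1, 0) (1, 0) w i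
  rwa [hdist, h_one_zero, zero_sub, abs_neg] at this

theorem exists_sum_hdist_rpow_le {r : ℝ} (hr : 1 < r) : ∃ C : ℝ, 0 < C ∧
    ∀ (p : ℝ × ℝ), 0 < p.2 → ∀ S : Finset (ℤ × ℤ), (∀ w ∈ S, w ∈ admissible p) → ∀ b : ℤ × ℤ,
      ∑ c ∈ S, (1 + hdist p c b) ^ (-r) ≤ C := by
  obtain ⟨C, hC, H⟩ := exists_sum_separated_rpow_le hr
  refine ⟨C, hC, fun p hp S hS b => H S (fun c => h c.1 c.2 p - h b.1 b.2 p) ?_⟩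
  intro x hx y hy hxy
  rw [sub_sub_sub_cancel_right]
  exact one_le_hdist hp (hS x hx) (hS y hy) hxy

/-- The constant depends on neither the point nor the set `S`: separation of the values of `h` is
all that the convolution bound uses. -/
theorem exists_sum_weight_le (k : ℕ) : ∃ C : ℝ, 0 < C ∧
    ∀ (p : ℝ × ℝ), 0 < p.2 → p.2 ≤ 1 → ∀ S : Finset (Fin k → ℤ × ℤ),
      (∀ w ∈ S, ∀ i, w i ∈ admissible p) → ∑ w ∈ S, weight p w ^ (-(1 - loss k)) ≤ C := by
  classical
  obtain ⟨C, hC, H⟩ := exists_sum_hdist_rpow_le (r := 1 + loss k) (by linarith [loss_pos k])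
  refine ⟨(4 * C) ^ k, by positivity, fun p hp hp1 S hS => ?_⟩
  -- `U` collects all entries of vectors in `S`; enlarging `S` to all vectors over `U` turns the sum
  -- into an iterated one.
  let U : Finset (ℤ × ℤ) := S.biUnion fun w => Finset.univ.image w
  have hU : ∀ w ∈ U, w ∈ admissible p := by
    intro w hw
    obtain ⟨s, hs, hw⟩ := Finset.mem_biUnion.1 hw
    obtain ⟨i, -, rfl⟩ := Finset.mem_image.1 hw
    exact hS s hs i
  have hsub : S ⊆ Fintype.piFinset (fun _ : Fin k => U) := by
    intro s hs
    rw [Fintype.mem_piFinset]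
    exact fun i => Finset.mem_biUnion.2 ⟨s, hs, Finset.mem_image_of_mem _ (Finset.mem_univ i)⟩
  have hpos : ∀ x y, 0 ≤ 1 + hdist p x y := fun x y => by linarith [hdist_nonneg p x y]
  calc ∑ w ∈ S, weight p w ^ (-(1 - loss k))
      ≤ ∑ w ∈ Fintype.piFinset (fun _ : Fin k => U), weight p w ^ (-(1 - loss k)) :=
        Finset.sum_le_sum_of_subset_of_nonneg hsub fun w _ _ =>
          Real.rpow_nonneg (zero_le_one.trans (one_le_weight p w)) _
    _ = ∑ w ∈ Fintype.piFinset (fun _ : Fin k => U),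
          chain (fun x y => (1 + hdist p x y) ^ (-(1 - loss k))) (1, 0) (1, 0) w := by
        refine Finset.sum_congr rfl fun w _ => ?_
        rw [chain_rpow hpos]; rfl
    _ ≤ (4 * C) ^ k * (1 + hdist p (1, 0) (1, 0)) ^ (-(1 - loss k - 2 * loss k * k)) := by
        refine sum_chain_rpow_le (hdist_nonneg p) (hdist_triangle p) U (loss_pos k) (1, 0) ?_ ?_ k
          (loss_spec k) (1, 0) (Finset.mem_insert_self _ _)
        · intro a _
          simp only [hdist_comm p a]
          exact H p hp U hU a
        · exact H p hp U hU (1, 0)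
    _ = (4 * C) ^ k := by simp [hdist]

theorem pos_of_mem_region {m : ℕ} {A B : Fin (m + 1) → ℤ} {p : ℝ × ℝ} (hp : p ∈ region A B) :
    0 < p.2 := by
  obtain ⟨h0, h1, -, h3⟩ := hp
  by_contra hle
  have e2 : p.2 = 0 := le_antisymm (not_lt.1 hle) (h0.trans h1)
  have e1 : p.1 = 0 := le_antisymm (e2 ▸ h1) h0
  have := (h3 0).1
  rw [e1, e2] at this
  simp at this

theorem pairs_mem_admissible {k : ℕ} {v : (Fin k → ℤ) × (Fin k → ℤ)} (hv : v ∈ coprimeVectors k)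
    {p : ℝ × ℝ} (hp : p ∈ region v.1 v.2) (i : Fin k) : pairs v i ∈ admissible p :=
  ⟨(hv i).1, hp.2.2.2 i⟩

/-- The majorant `weight ^ (-(1 - loss))` on the region. -/
def majorant {k : ℕ} (v : (Fin k → ℤ) × (Fin k → ℤ)) (p : ℝ × ℝ) : ℝ :=
  (region v.1 v.2).indicator (fun p => weight p (pairs v) ^ (-(1 - loss k))) p

theorem majorant_nonneg {k : ℕ} (v : (Fin k → ℤ) × (Fin k → ℤ)) (p : ℝ × ℝ) : 0 ≤ majorant v p :=
  Set.indicator_nonneg (fun p _ => Real.rpow_nonneg (zero_le_one.trans (one_le_weight p _)) _) _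

theorem exists_sum_majorant_le (m : ℕ) : ∃ C : ℝ, 0 < C ∧
    ∀ (p : ℝ × ℝ) (S : Finset ((Fin (m + 1) → ℤ) × (Fin (m + 1) → ℤ))),
      (∀ v ∈ S, v ∈ coprimeVectors (m + 1)) → ∑ v ∈ S, majorant v p ≤ C := by
  classical
  obtain ⟨C, hC, H⟩ := exists_sum_weight_le (m + 1)
  refine ⟨C, hC, fun p S hS => ?_⟩
  have e : ∑ v ∈ S, majorant v p = ∑ w ∈ (S.filter (fun v => p ∈ region v.1 v.2)).image pairs,
      weight p w ^ (-(1 - loss (m + 1))) := by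
    rw [Finset.sum_image (pairs_injective _).injOn, Finset.sum_filter]
    exact Finset.sum_congr rfl fun v _ => Set.indicator_apply _ _ _
  rw [e]
  rcases (S.filter (fun v => p ∈ region v.1 v.2)).eq_empty_or_nonempty with h0 | ⟨v, hv⟩
  · rw [h0]; simpa using hC.le
  · have hp := (Finset.mem_filter.1 hv).2
    refine H p (pos_of_mem_region hp) hp.2.2.1 _ fun w hw i => ?_
    obtain ⟨v', hv', rfl⟩ := Finset.mem_image.1 hw
    obtain ⟨h1, h2⟩ := Finset.mem_filter.1 hv'
    exact pairs_mem_admissible (hS _ h1) h2 i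

theorem abs_sincKernel_le {γ α : ℝ} (hγ : 0 < γ) (hα : γ ≤ α) (p : ℝ × ℝ) (w w' : ℤ × ℤ) :
    |sincKernel α p w w'| ≤ 2 * (1 + 1 / γ) * (1 + hdist p w w')⁻¹ := by
  unfold sincKernel
  rw [← mul_sub]
  refine (abs_sinc_le _).trans ?_
  rw [abs_mul, abs_of_pos (mul_pos Real.pi_pos (hγ.trans_le hα)), mul_assoc 2]
  change 2 * (1 + Real.pi * α * hdist p w w')⁻¹ ≤ _
  have hd := hdist_nonneg p w w'
  have h1 : γ * hdist p w w' ≤ Real.pi * α * hdist p w w' := by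
    have : γ ≤ Real.pi * α := by nlinarith [Real.pi_gt_three]
    gcongr
  have h0 : 0 ≤ γ * hdist p w w' := by positivity
  gcongr
  rw [inv_le_comm₀ (by linarith) (by positivity), mul_inv, inv_inv,
    inv_mul_le_iff₀ (by positivity)]
  have : 1 / γ * (γ * hdist p w w') = hdist p w w' := by field_simp
  have h3 : 1 / γ * (γ * hdist p w w') ≤ 1 / γ * (Real.pi * α * hdist p w w') := by gcongr
  have h4 : 0 < 1 / γ := by positivity
  nlinarith

theorem abs_integrand_le {m : ℕ} {γ α : ℝ} (hγ : 0 < γ) (hα : γ ≤ α)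
    (v : (Fin (m + 1) → ℤ) × (Fin (m + 1) → ℤ)) (p : ℝ × ℝ) :
    |integrand m α v.1 v.2 p| ≤ (2 * (1 + 1 / γ)) ^ (m + 2) * (weight p (pairs v))⁻¹ := by
  rw [integrand_eq_chain]
  calc _ = chain (fun x y => |sincKernel α p x y|) (1, 0) (1, 0) (pairs v) :=
        Finset.abs_prod _ _
    _ ≤ chain (fun x y => 2 * (1 + 1 / γ) * (1 + hdist p x y)⁻¹) (1, 0) (1, 0) (pairs v) :=
        chain_le_chain (fun _ _ => abs_nonneg _) (abs_sincKernel_le hγ hα p) _ _ _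
    _ = _ := by
        rw [chain_const_mul, weight, chain, chain, Finset.prod_inv_distrib]

/-- The majorant leaves the exponent `loss` unused; wherever the weight exceeds X it yields the
saving X^(-loss). -/
theorem inv_weight_le {k : ℕ} {p : ℝ × ℝ} {w : Fin k → ℤ × ℤ} {X : ℝ} (hX : 0 < X)
    (hXw : X ≤ weight p w) :
    (weight p w)⁻¹ ≤ X ^ (-loss k) * weight p w ^ (-(1 - loss k)) := by
  have h0 : 0 < weight p w := zero_lt_one.trans_le (one_le_weight p w)
  calc (weight p w)⁻¹ = weight p w ^ (-loss k) * weight p w ^ (-(1 - loss k)) := by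
        rw [← Real.rpow_add h0, ← Real.rpow_neg_one]; congr 1; ring
    _ ≤ _ := by
        gcongr ?_ * _
        exact Real.rpow_le_rpow_of_nonpos hX hXw (by linarith [loss_pos k])

theorem abs_indicator_integrand_le {m : ℕ} {γ α : ℝ} (hγ : 0 < γ) (hα : γ ≤ α)
    (v : (Fin (m + 1) → ℤ) × (Fin (m + 1) → ℤ)) (p : ℝ × ℝ) {X : ℝ} (hX : 0 < X)
    (hXw : p ∈ region v.1 v.2 → X ≤ weight p (pairs v)) :
    |(region v.1 v.2).indicator (integrand m α v.1 v.2) p| ≤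
      (2 * (1 + 1 / γ)) ^ (m + 2) * X ^ (-loss (m + 1)) * majorant v p := by
  by_cases hp : p ∈ region v.1 v.2
  · rw [Set.indicator_of_mem hp, majorant, Set.indicator_of_mem hp]
    refine (abs_integrand_le hγ hα v p).trans ?_
    rw [mul_assoc]
    exact mul_le_mul_of_nonneg_left (inv_weight_le hX (hXw hp)) (by positivity)
  · rw [Set.indicator_of_notMem hp, abs_zero]
    exact mul_nonneg (by positivity) (majorant_nonneg v p)

/-- Large entries force a large h. Since y and the form are at most 1, |B| ≤ |h|. Since Ay is the
form plus Bx, |A|y ≤ 1 + |h|, and y ≥ 1/t then explains the threshold t². -/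
theorem le_weight_of_not_mem_box {k : ℕ} {v : (Fin k → ℤ) × (Fin k → ℤ)} {p : ℝ × ℝ}
    (hp : p ∈ region v.1 v.2) {t : ℝ} (ht : 1 ≤ t) (hpt : 1 ≤ p.2 * t) {i : Fin k}
    (hi : t ^ 2 < |(v.1 i : ℝ)| ∨ t ^ 2 < |(v.2 i : ℝ)|) : t ≤ weight p (pairs v) := by
  refine le_trans ?_ (one_add_abs_h_le_weight p (pairs v) i)
  obtain ⟨h0, h1, h2, h3⟩ := hp
  obtain ⟨y0, y1⟩ := h3 i
  have hy : 0 < p.2 := by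
    by_contra hle
    nlinarith
  simp only [pairs]
  set H := |h (v.1 i) (v.2 i) p| with hH
  have hB : |(v.2 i : ℝ)| ≤ H := by
    rw [hH, h, abs_div, abs_of_pos (mul_pos hy y0), le_div_iff₀ (mul_pos hy y0)]
    exact mul_le_of_le_one_right (abs_nonneg _) (mul_le_one₀ h2 y0.le y1)
  rcases hi with hA | hB'
  · have hA' : |(v.1 i : ℝ)| * p.2 ≤ 1 + H := by
      calc |(v.1 i : ℝ)| * p.2 = |((v.1 i : ℝ) * p.2 - v.2 i * p.1) + v.2 i * p.1| := by
            rw [sub_add_cancel, abs_mul, abs_of_pos hy]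
        _ ≤ 1 + |(v.2 i : ℝ)| * 1 := by
            refine (abs_add_le _ _).trans ?_
            rw [abs_of_pos y0, abs_mul, abs_of_nonneg h0]
            gcongr
            linarith
        _ ≤ 1 + H := by linarith
    have : t ≤ t ^ 2 * p.2 := by nlinarith
    nlinarith
  · nlinarith

/-! ### Integration over the regions and absolute convergence. -/

/-- The closed unit square. -/
def unitSquare : Set (ℝ × ℝ) := Set.Icc 0 1 ×ˢ Set.Icc 0 1

theorem measurableSet_unitSquare : MeasurableSet unitSquare :=
  measurableSet_Icc.prod measurableSet_Icc

theorem volume_unitSquare : volume unitSquare = 1 := by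
  rw [unitSquare, Measure.volume_eq_prod, Measure.prod_prod]
  simp

/-- The points where `A y - B x` is within `η` of `c`. -/
def strip (A B : ℤ) (c η : ℝ) : Set (ℝ × ℝ) := {p | |(A : ℝ) * p.2 - (B : ℝ) * p.1 - c| ≤ η}

theorem measurableSet_strip (A B : ℤ) (c η : ℝ) : MeasurableSet (strip A B c η) :=
  measurableSet_le (by fun_prop) measurable_const

theorem volume_abs_linear_le {A : ℤ} (hA : A ≠ 0) (e η : ℝ) :
    volume {y : ℝ | |(A : ℝ) * y - e| ≤ η} ≤ ENNReal.ofReal (2 * η) := by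
  have h1 : (1 : ℝ) ≤ |(A : ℝ)| := by exact_mod_cast Int.one_le_abs hA
  have hA0 : (A : ℝ) ≠ 0 := by exact_mod_cast hA
  have hsub : {y : ℝ | |(A : ℝ) * y - e| ≤ η} ⊆ Set.Icc (e / A - η) (e / A + η) := by
    intro y hy
    have e1 : |(A : ℝ) * y - e| = |(A : ℝ)| * |y - e / A| := by
      rw [← abs_mul]; congr 1; field_simp
    have h2 : |y - e / A| ≤ η := by
      refine le_trans ?_ (e1.symm.le.trans hy)
      exact le_mul_of_one_le_left (abs_nonneg _) h1
    rw [abs_le] at h2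
    exact ⟨by linarith, by linarith⟩
  refine (measure_mono hsub).trans ?_
  rw [Real.volume_Icc]
  exact ENNReal.ofReal_le_ofReal (by linarith)

/-- By Fubini, slice along a variable whose integer coefficient is nonzero, hence at least 1 in
absolute value. -/
theorem volume_strip_le {A B : ℤ} (hAB : A ≠ 0 ∨ B ≠ 0) (c η : ℝ) :
    volume (unitSquare ∩ strip A B c η) ≤ ENNReal.ofReal (2 * η) := by
  have hm := measurableSet_unitSquare.inter (measurableSet_strip A B c η)
  have hint : ∫⁻ x : ℝ, (Set.Icc (0 : ℝ) 1).indicator (fun _ => ENNReal.ofReal (2 * η)) x ≤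
      ENNReal.ofReal (2 * η) := by
    rw [lintegral_indicator measurableSet_Icc]
    simp
  rw [Measure.volume_eq_prod]
  by_cases hA : A ≠ 0
  · rw [Measure.prod_apply hm]
    refine le_trans (lintegral_mono fun x => ?_) hint
    by_cases hx : x ∈ Set.Icc (0 : ℝ) 1
    · rw [Set.indicator_of_mem hx]
      refine le_trans (measure_mono ?_) (volume_abs_linear_le hA (B * x + c) η)
      intro y hy
      have := hy.2
      simp only [strip, Set.mem_ofPred_eq] at this ⊢
      rwa [← sub_sub]
    · rw [Set.indicator_of_notMem hx]
      refine le_of_eq (measure_mono_null (t := ∅) ?_ measure_empty)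
      exact fun y hy => hx hy.1.1
  · have hB : B ≠ 0 := hAB.resolve_left hA
    rw [Measure.prod_apply_symm hm]
    refine le_trans (lintegral_mono fun y => ?_) hint
    by_cases hy : y ∈ Set.Icc (0 : ℝ) 1
    · rw [Set.indicator_of_mem hy]
      refine le_trans (measure_mono ?_) (volume_abs_linear_le hB (A * y - c) η)
      intro x hx
      have := hx.2
      simp only [strip, Set.mem_ofPred_eq] at this ⊢
      rw [abs_sub_comm]
      refine le_trans (le_of_eq ?_) this
      congr 1; ring
    · rw [Set.indicator_of_notMem hy]
      refine le_of_eq (measure_mono_null (t := ∅) ?_ measure_empty)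
      exact fun x hx => hy hx.1.2

theorem measurable_h (A B : ℤ) : Measurable (h A B) := by unfold h; fun_prop

theorem measurable_integrand (m : ℕ) (α : ℝ) (A B : Fin (m + 1) → ℤ) :
    Measurable (integrand m α A B) := by
  have hs := Real.continuous_sinc.measurable
  unfold integrand
  refine ((hs.comp ((measurable_h _ _).const_mul _)).mul
    (hs.comp ((measurable_h _ _).const_mul _))).mul ?_
  exact Finset.measurable_fun_prod _ fun i _ =>
    hs.comp (((measurable_h _ _).const_mul _).sub ((measurable_h _ _).const_mul _))

theorem measurableSet_region {k : ℕ} (A B : Fin k → ℤ) : MeasurableSet (region A B) := by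
  have : region A B = {p | 0 ≤ p.1} ∩ ({p | p.1 ≤ p.2} ∩ ({p | p.2 ≤ 1} ∩
      ⋂ i, ({p | 0 < (A i : ℝ) * p.2 - (B i : ℝ) * p.1} ∩
        {p | (A i : ℝ) * p.2 - (B i : ℝ) * p.1 ≤ 1}))) := by
    ext p
    simp [region]
  rw [this]
  refine (measurableSet_le measurable_const measurable_fst).inter
    ((measurableSet_le measurable_fst measurable_snd).inter
    ((measurableSet_le measurable_snd measurable_const).inter (MeasurableSet.iInter fun i => ?_)))
  exact (measurableSet_lt measurable_const (by fun_prop)).inter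
    (measurableSet_le (by fun_prop) measurable_const)

theorem region_subset_unitSquare {k : ℕ} (A B : Fin k → ℤ) : region A B ⊆ unitSquare :=
  fun _ hp => ⟨⟨hp.1, hp.2.1.trans hp.2.2.1⟩, ⟨hp.1.trans hp.2.1, hp.2.2.1⟩⟩

theorem abs_integrand_le_one (m : ℕ) (α : ℝ) (A B : Fin (m + 1) → ℤ) (p : ℝ × ℝ) :
    |integrand m α A B p| ≤ 1 := by
  have := integrand_eq_chain m α (A, B) p
  simp only at this
  rw [this, chain, Finset.abs_prod]
  exact Finset.prod_le_one (fun _ _ => abs_nonneg _) fun _ _ => Real.abs_sinc_le_one _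

theorem integrableOn_of_abs_le {s : Set (ℝ × ℝ)} (hs : s ⊆ unitSquare)
    {f : ℝ × ℝ → ℝ} (hf : Measurable f) {c : ℝ} (hc : ∀ p, |f p| ≤ c) : IntegrableOn f s := by
  refine Measure.integrableOn_of_bounded (M := c) ?_ hf.aestronglyMeasurable ?_
  · refine ((measure_mono hs).trans_lt ?_).ne
    rw [volume_unitSquare]; exact ENNReal.one_lt_top
  · exact Filter.Eventually.of_forall hc

theorem integrableOn_integrand (m : ℕ) (α : ℝ) (A B : Fin (m + 1) → ℤ) :
    IntegrableOn (integrand m α A B) (region A B) :=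
  integrableOn_of_abs_le (region_subset_unitSquare A B) (measurable_integrand m α A B)
    (abs_integrand_le_one m α A B)

/-- All regions lie in the unit square, of area 1, so a bound for the sum at each point becomes a
bound for the sum of the integrals. -/
theorem sum_setIntegral_le {k : ℕ} (S : Finset ((Fin k → ℤ) × (Fin k → ℤ)))
    (G : ((Fin k → ℤ) × (Fin k → ℤ)) → ℝ × ℝ → ℝ)
    (hG : ∀ v, IntegrableOn (G v) (region v.1 v.2)) {Φ : ℝ × ℝ → ℝ} (hΦ : IntegrableOn Φ unitSquare)
    (hle : ∀ p, ∑ v ∈ S, (region v.1 v.2).indicator (G v) p ≤ Φ p) :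
    ∑ v ∈ S, ∫ p in region v.1 v.2, G v p ≤ ∫ p in unitSquare, Φ p := by
  have e : ∀ v, ∫ p in region v.1 v.2, G v p =
      ∫ p in unitSquare, (region v.1 v.2).indicator (G v) p := fun v => by
    rw [setIntegral_indicator (measurableSet_region _ _),
      Set.inter_eq_self_of_subset_right (region_subset_unitSquare _ _)]
  have hi : ∀ v, IntegrableOn ((region v.1 v.2).indicator (G v)) unitSquare := fun v =>
    ((integrable_indicator_iff (measurableSet_region _ _)).2 (hG v)).integrableOn
  calc _ = ∑ v ∈ S, ∫ p in unitSquare, (region v.1 v.2).indicator (G v) p :=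
        Finset.sum_congr rfl fun v _ => e v
    _ = ∫ p in unitSquare, ∑ v ∈ S, (region v.1 v.2).indicator (G v) p :=
        (integral_finsetSum _ fun v _ => hi v).symm
    _ ≤ _ := setIntegral_mono (integrable_finsetSum _ fun v _ => hi v) hΦ hle

theorem abs_indicator {s : Set (ℝ × ℝ)} (f : ℝ × ℝ → ℝ) (p : ℝ × ℝ) :
    s.indicator (fun p => |f p|) p = |s.indicator f p| :=
  Set.indicator_comp_of_zero (g := fun x : ℝ => |x|) abs_zero |>.symm ▸ rfl

theorem setIntegral_unitSquare_const (c : ℝ) : ∫ _ in unitSquare, c = c := by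
  rw [setIntegral_const, Measure.real, volume_unitSquare]; simp

theorem sum_setIntegral_abs_le {m : ℕ} {γ : ℝ} (hγ : 0 < γ) : ∃ C : ℝ, 0 < C ∧
    ∀ α, γ ≤ α → ∀ S : Finset ((Fin (m + 1) → ℤ) × (Fin (m + 1) → ℤ)),
      (∀ v ∈ S, v ∈ coprimeVectors (m + 1)) →
        ∑ v ∈ S, ∫ p in region v.1 v.2, |integrand m α v.1 v.2 p| ≤ C := by
  obtain ⟨C, hC, H⟩ := exists_sum_majorant_le m
  refine ⟨(2 * (1 + 1 / γ)) ^ (m + 2) * C, by positivity, fun α hα S hS => ?_⟩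
  rw [← setIntegral_unitSquare_const ((2 * (1 + 1 / γ)) ^ (m + 2) * C)]
  refine sum_setIntegral_le S _ (fun v => (integrableOn_integrand m α v.1 v.2).abs)
    (integrableOn_of_abs_le subset_rfl measurable_const fun _ => le_rfl) fun p => ?_
  calc _ ≤ ∑ v ∈ S, (2 * (1 + 1 / γ)) ^ (m + 2) * majorant v p := by
        refine Finset.sum_le_sum fun v _ => ?_
        rw [abs_indicator]
        have := abs_indicator_integrand_le hγ hα v p one_pos fun _ => one_le_weight p _
        rwa [Real.one_rpow, mul_one] at this
    _ ≤ _ := by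
        rw [← Finset.mul_sum]
        exact mul_le_mul_of_nonneg_left (H p S hS) (by positivity)

theorem summable_setIntegral_abs (m : ℕ) {α : ℝ} (hα : 0 < α) :
    Summable fun v : coprimeVectors (m + 1) =>
      ∫ p in region v.1.1 v.1.2, |integrand m α v.1.1 v.1.2 p| := by
  obtain ⟨C, -, H⟩ := sum_setIntegral_abs_le (m := m) hα
  refine summable_of_sum_le (c := C)
    (fun v => setIntegral_nonneg (measurableSet_region _ _) fun _ _ => abs_nonneg _) fun S => ?_
  have := H α le_rfl (S.map (Function.Embedding.subtype _)) (by simp +contextual)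
  rwa [Finset.sum_map] at this

/-- The integral attached to one pair of vectors. -/
def regionIntegral (m : ℕ) (α : ℝ) (v : (Fin (m + 1) → ℤ) × (Fin (m + 1) → ℤ)) : ℝ :=
  ∫ p in region v.1 v.2, integrand m α v.1 v.2 p

theorem abs_regionIntegral_le (m : ℕ) (α : ℝ) (v : (Fin (m + 1) → ℤ) × (Fin (m + 1) → ℤ)) :
    |regionIntegral m α v| ≤ ∫ p in region v.1 v.2, |integrand m α v.1 v.2 p| :=
  abs_integral_le_integral_abs

theorem summable_abs_regionIntegral (m : ℕ) {α : ℝ} (hα : 0 < α) :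
    Summable fun v : coprimeVectors (m + 1) => |regionIntegral m α v| :=
  (summable_setIntegral_abs m hα).of_nonneg_of_le (fun _ => abs_nonneg _)
    fun v => abs_regionIntegral_le m α v

theorem limitMoment_eq (m : ℕ) (α : ℝ) : limitMoment (m + 2) α =
    6 / (Real.pi ^ 2 * α) * ∑' v : coprimeVectors (m + 1), regionIntegral m α v := rfl

theorem abs_tsum_le_of_sum_abs_le {ι : Type*} {f : ι → ℝ} {c : ℝ}
    (hf : ∀ S : Finset ι, ∑ i ∈ S, |f i| ≤ c) : |∑' i, f i| ≤ c := by
  have hs : Summable fun i => |f i| := summable_of_sum_le (fun _ => abs_nonneg _) hf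
  have h1 : ‖∑' i, f i‖ ≤ ∑' i, |f i| := norm_tsum_le_tsum_norm hs
  exact h1.trans (hs.tsum_le_of_sum_le hf)

theorem sum_coprimeVectors_eq {k : ℕ} (S : Finset (coprimeVectors k))
    (f : (Fin k → ℤ) × (Fin k → ℤ) → ℝ) :
    ∑ v ∈ S, f v = ∑ v ∈ S.map (Function.Embedding.subtype _), f v := by
  rw [Finset.sum_map]
  rfl

theorem abs_tsum_regionIntegral_le {m : ℕ} {γ : ℝ} (hγ : 0 < γ) : ∃ C : ℝ, 0 < C ∧
    ∀ α, γ ≤ α → |∑' v : coprimeVectors (m + 1), regionIntegral m α v| ≤ C := by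
  obtain ⟨C, hC, H⟩ := sum_setIntegral_abs_le (m := m) hγ
  refine ⟨C, hC, fun α hα => ?_⟩
  refine abs_tsum_le_of_sum_abs_le fun S => ?_
  have h1 := H α hα (S.map (Function.Embedding.subtype _)) (by simp +contextual)
  rw [sum_coprimeVectors_eq S fun v => |regionIntegral m α v|]
  exact (Finset.sum_le_sum fun v _ => abs_regionIntegral_le m α v).trans h1

/-! ### Hölder continuity in α. -/

theorem abs_integrand_sub_le {m : ℕ} {γ α : ℝ} (β : ℝ) (hγ : 0 < γ) (hα : γ ≤ α)
    (v : (Fin (m + 1) → ℤ) × (Fin (m + 1) → ℤ)) (p : ℝ × ℝ) :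
    |integrand m α v.1 v.2 p - integrand m β v.1 v.2 p| ≤ (m + 2) * (2 * |α - β| / γ) := by
  have hα0 := hγ.trans_le hα
  have key := norm_chain_sub_chain_le (n := m + 1) (δ := 2 * |α - β| / γ)
    (k := fun x y => (sincKernel α p x y : ℂ)) (k' := fun x y => (sincKernel β p x y : ℂ))
    (1, 0) (1, 0) Set.univ trivial trivial
    (fun x y => by
      rw [Complex.norm_real]; exact Real.abs_sinc_le_one _)
    (fun x y => by
      rw [Complex.norm_real]; exact Real.abs_sinc_le_one _)
    (fun x _ y _ => by
      rw [← Complex.ofReal_sub, Complex.norm_real, Real.norm_eq_abs]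
      unfold sincKernel
      have := abs_sinc_mul_sub_sinc_mul_le (b := β) hα0 (Real.pi * (h x.1 x.2 p - h y.1 y.2 p))
      rw [show α * (Real.pi * (h x.1 x.2 p - h y.1 y.2 p)) =
          Real.pi * α * h x.1 x.2 p - Real.pi * α * h y.1 y.2 p by ring,
        show β * (Real.pi * (h x.1 x.2 p - h y.1 y.2 p)) =
          Real.pi * β * h x.1 x.2 p - Real.pi * β * h y.1 y.2 p by ring] at this
      refine this.trans ?_
      gcongr)
    (pairs v) (fun _ => trivial)
  have e : ∀ α', ((integrand m α' v.1 v.2 p : ℝ) : ℂ) =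
      chain (fun x y => (sincKernel α' p x y : ℂ)) (1, 0) (1, 0) (pairs v) := fun α' => by
    rw [integrand_eq_chain]
    exact map_chain Complex.ofRealHom _ _ _ _
  rw [← e, ← e, ← Complex.ofReal_sub, Complex.norm_real, Real.norm_eq_abs] at key
  refine key.trans (le_of_eq ?_)
  push_cast; ring

/-- Two bounds for the difference of integrands are interpolated: one linear in |α - β| but without
decay in the vector, and one of size 1/weight but without smallness. -/
theorem abs_tsum_regionIntegral_sub_le {m : ℕ} {γ : ℝ} (hγ : 0 < γ) : ∃ C : ℝ, 0 < C ∧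
    ∀ α β, γ ≤ α → γ ≤ β →
      |∑' v : coprimeVectors (m + 1), regionIntegral m α v -
        ∑' v : coprimeVectors (m + 1), regionIntegral m β v| ≤ C * |α - β| ^ loss (m + 1) := by
  obtain ⟨C, hC, H⟩ := exists_sum_majorant_le m
  set a := (2 * (1 + 1 / γ)) ^ (m + 2) with ha
  have ha0 : 0 < a := by positivity
  set ε := loss (m + 1) with hε
  have hε0 : 0 < ε := loss_pos _
  have hε1 : ε ≤ 1 / 2 := loss_le _
  refine ⟨((m + 2) * (2 / γ)) ^ ε * (2 * a) ^ (1 - ε) * C, by positivity, fun α β hα hβ => ?_⟩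
  have hα0 := hγ.trans_le hα
  have hβ0 := hγ.trans_le hβ
  set c := ((m + 2) * (2 / γ)) ^ ε * (2 * a) ^ (1 - ε) * |α - β| ^ ε with hc
  have hc0 : 0 ≤ c := by positivity
  have hpt : ∀ v p, |integrand m α v.1 v.2 p - integrand m β v.1 v.2 p| ≤
      c * weight p (pairs v) ^ (-(1 - ε)) := by
    intro v p
    have hw := zero_lt_one.trans_le (one_le_weight p (pairs v))
    set X := |integrand m α v.1 v.2 p - integrand m β v.1 v.2 p| with hX
    have hX0 : 0 ≤ X := abs_nonneg _
    have h1 : X ≤ (m + 2) * (2 / γ) * |α - β| := by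
      refine (abs_integrand_sub_le β hγ hα v p).trans (le_of_eq ?_); ring
    have h2 : X ≤ 2 * a * (weight p (pairs v))⁻¹ := by
      refine (abs_sub _ _).trans ?_
      have e1 := abs_integrand_le hγ hα v p
      have e2 := abs_integrand_le hγ hβ v p
      linarith
    -- The power ε uses closeness of α and β; the power 1 - ε uses decay and reproduces the
    -- majorant.
    calc X = X ^ ε * X ^ (1 - ε) := by
          rw [← Real.rpow_add_of_nonneg hX0 hε0.le (by linarith)]; simp
      _ ≤ ((m + 2) * (2 / γ) * |α - β|) ^ ε * (2 * a * (weight p (pairs v))⁻¹) ^ (1 - ε) := by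
          gcongr
          linarith
      _ = _ := by
          rw [Real.mul_rpow (by positivity) (abs_nonneg _), Real.mul_rpow (x := 2 * a) (by positivity)
            (by positivity), Real.inv_rpow hw.le, Real.rpow_neg hw.le, hc]
          ring
  have hsum : ∀ S : Finset (coprimeVectors (m + 1)),
      ∑ v ∈ S, |regionIntegral m α v - regionIntegral m β v| ≤ c * C := by
    intro S
    have key := sum_setIntegral_le (S.map (Function.Embedding.subtype _))
      (fun v p => |integrand m α v.1 v.2 p - integrand m β v.1 v.2 p|)
      (fun v => ((integrableOn_integrand m α v.1 v.2).sub
        (integrableOn_integrand m β v.1 v.2)).abs) (Φ := fun _ => c * C)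
      (integrableOn_of_abs_le subset_rfl measurable_const fun _ => le_rfl) (fun p => by
        refine le_trans ?_ (mul_le_mul_of_nonneg_left
          (H p (S.map (Function.Embedding.subtype _)) (by simp +contextual)) hc0)
        rw [Finset.mul_sum]
        refine Finset.sum_le_sum fun v _ => ?_
        unfold majorant
        by_cases hp : p ∈ region v.1 v.2
        · rw [Set.indicator_of_mem hp, Set.indicator_of_mem hp]
          exact hpt v p
        · simp [Set.indicator_of_notMem hp])
    rw [setIntegral_unitSquare_const] at key
    rw [sum_coprimeVectors_eq S fun v => |regionIntegral m α v - regionIntegral m β v|]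
    refine le_trans (Finset.sum_le_sum fun v _ => ?_) key
    unfold regionIntegral
    rw [← integral_sub (integrableOn_integrand m α _ _) (integrableOn_integrand m β _ _)]
    exact abs_integral_le_integral_abs
  rw [← ((summable_abs_regionIntegral m hα0).of_abs).tsum_sub
    ((summable_abs_regionIntegral m hβ0).of_abs)]
  refine (abs_tsum_le_of_sum_abs_le hsum).trans (le_of_eq ?_)
  rw [hc]; ring

theorem limitMoment_holder (m : ℕ) {γ₁ γ₂ : ℝ} (hγ : 0 < γ₁) : ∃ C : ℝ,
    ∀ α ∈ Set.Icc γ₁ γ₂, ∀ β ∈ Set.Icc γ₁ γ₂,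
      |limitMoment (m + 2) α - limitMoment (m + 2) β| ≤ C * |α - β| ^ loss (m + 1) := by
  obtain ⟨C₁, hC₁, H₁⟩ := abs_tsum_regionIntegral_le (m := m) hγ
  obtain ⟨C₂, hC₂, H₂⟩ := abs_tsum_regionIntegral_sub_le (m := m) hγ
  set ε := loss (m + 1) with hε
  have hε0 : 0 < ε := loss_pos _
  have hε1 : ε ≤ 1 / 2 := loss_le _
  refine ⟨6 / Real.pi ^ 2 * (1 / γ₁ * C₂ + (γ₂ - γ₁) ^ (1 - ε) / (γ₁ * γ₁) * C₁),
    fun α hα β hβ => ?_⟩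
  have hα0 := hγ.trans_le hα.1
  have hβ0 := hγ.trans_le hβ.1
  rw [limitMoment_eq, limitMoment_eq]
  set s := ∑' v : coprimeVectors (m + 1), regionIntegral m α v
  set s' := ∑' v : coprimeVectors (m + 1), regionIntegral m β v
  have hpi := Real.pi_ne_zero
  have e : 6 / (Real.pi ^ 2 * α) * s - 6 / (Real.pi ^ 2 * β) * s' =
      6 / Real.pi ^ 2 * (1 / α * (s - s') + (β - α) / (α * β) * s') := by
    field_simp; ring
  rw [e, abs_mul, abs_of_pos (by positivity : 0 < 6 / Real.pi ^ 2), mul_assoc]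
  refine mul_le_mul_of_nonneg_left ?_ (by positivity)
  refine (abs_add_le _ _).trans ?_
  rw [add_mul]
  refine add_le_add ?_ ?_
  · rw [abs_mul, abs_of_pos (by positivity : 0 < 1 / α), mul_assoc]
    have h1 := hα.1
    gcongr
    exact H₂ α β hα.1 hβ.1
  -- The prefactor 1/α is Lipschitz, and on a bounded interval a first power of |α - β| is dominated
  -- by its power ε.
  · have h1 : |α - β| ≤ (γ₂ - γ₁) ^ (1 - ε) * |α - β| ^ ε := by
      have h2 : |α - β| ≤ γ₂ - γ₁ := by
        rw [abs_le]; constructor <;> linarith [hα.1, hα.2, hβ.1, hβ.2]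
      calc |α - β| = |α - β| ^ (1 - ε) * |α - β| ^ ε := by
            rw [← Real.rpow_add_of_nonneg (abs_nonneg _) (by linarith) hε0.le]; simp
        _ ≤ _ := by
            gcongr
            linarith
    rw [abs_mul, abs_div, abs_of_pos (mul_pos hα0 hβ0), abs_sub_comm β α]
    have h3 : γ₁ * γ₁ ≤ α * β := mul_le_mul hα.1 hβ.1 hγ.le hα0.le
    calc |α - β| / (α * β) * |s'| ≤ ((γ₂ - γ₁) ^ (1 - ε) * |α - β| ^ ε) / (γ₁ * γ₁) * C₁ := by
          have h4 := (abs_nonneg (α - β)).trans h1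
          gcongr
          exact H₁ β hβ.1
      _ = _ := by ring

theorem continuousOn_limitMoment (m : ℕ) : ContinuousOn (limitMoment (m + 2)) (Set.Ioi 0) := by
  intro α hα
  have hα : 0 < α := hα
  refine ContinuousAt.continuousWithinAt ?_
  obtain ⟨C, H⟩ := limitMoment_holder m (γ₁ := α / 2) (γ₂ := 2 * α) (by linarith)
  rw [ContinuousAt, tendsto_iff_dist_tendsto_zero]
  have hlim : Filter.Tendsto (fun β => C * |β - α| ^ loss (m + 1)) (nhds α) (nhds 0) := by
    have : ContinuousAt (fun β => C * |β - α| ^ loss (m + 1)) α :=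
      continuousAt_const.mul ((by fun_prop : ContinuousAt (fun β => |β - α|) α).rpow_const
        (Or.inr (loss_pos _).le))
    have h2 := this.tendsto
    simpa [Real.zero_rpow (loss_pos (m + 1)).ne'] using h2
  refine squeeze_zero' (Filter.Eventually.of_forall fun _ => dist_nonneg) ?_ hlim
  filter_upwards [Icc_mem_nhds (by linarith : α / 2 < α) (by linarith : α < 2 * α)] with β hβ
  exact H β hβ α ⟨by linarith, by linarith⟩

/-! ### Truncation to vectors with bounded entries. -/

theorem sum_abs_indicator_integrand_le {m : ℕ} {γ : ℝ} (hγ : 0 < γ) : ∃ C : ℝ, 0 < C ∧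
    ∀ α, γ ≤ α → ∀ X : ℝ, 0 < X → ∀ p : ℝ × ℝ,
      ∀ S : Finset ((Fin (m + 1) → ℤ) × (Fin (m + 1) → ℤ)),
        (∀ v ∈ S, v ∈ coprimeVectors (m + 1)) →
        (∀ v ∈ S, p ∈ region v.1 v.2 → X ≤ weight p (pairs v)) →
          ∑ v ∈ S, |(region v.1 v.2).indicator (integrand m α v.1 v.2) p| ≤
            C * X ^ (-loss (m + 1)) := by
  obtain ⟨C, hC, H⟩ := exists_sum_majorant_le m
  refine ⟨(2 * (1 + 1 / γ)) ^ (m + 2) * C, by positivity, fun α hα X hX p S hS hSX => ?_⟩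
  calc _ ≤ ∑ v ∈ S, (2 * (1 + 1 / γ)) ^ (m + 2) * X ^ (-loss (m + 1)) * majorant v p :=
        Finset.sum_le_sum fun v hv => abs_indicator_integrand_le hγ hα v p hX (hSX v hv)
    _ ≤ (2 * (1 + 1 / γ)) ^ (m + 2) * X ^ (-loss (m + 1)) * C := by
        rw [← Finset.mul_sum]
        exact mul_le_mul_of_nonneg_left (H p S hS) (by positivity)
    _ = _ := by ring

open Classical in
/-- The coprime vectors with entries bounded by `K`. -/
def coprimeBox (k K : ℕ) : Finset ((Fin k → ℤ) × (Fin k → ℤ)) :=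
  (Fintype.piFinset (fun _ => Finset.Icc (-(K : ℤ)) K) ×ˢ
    Fintype.piFinset (fun _ => Finset.Icc (-(K : ℤ)) K)).filter (fun v => v ∈ coprimeVectors k)

open Classical in
theorem mem_coprimeBox {k K : ℕ} {v : (Fin k → ℤ) × (Fin k → ℤ)} :
    v ∈ coprimeBox k K ↔ (∀ i, |v.1 i| ≤ K ∧ |v.2 i| ≤ K) ∧ v ∈ coprimeVectors k := by
  rw [coprimeBox, Finset.mem_filter]
  simp only [Finset.mem_product, Fintype.mem_piFinset,
    Finset.mem_Icc, abs_le, forall_and]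

open Classical in
theorem card_coprimeBox_le (k K : ℕ) : (coprimeBox k K).card ≤ (2 * K + 1) ^ (2 * k) := by
  refine (Finset.card_filter_le _ _).trans (le_of_eq ?_)
  have : (Finset.Icc (-(K : ℤ)) K).card = 2 * K + 1 := by rw [Int.card_Icc]; omega
  rw [Finset.card_product, Fintype.card_piFinset_const, this, ← pow_add, two_mul k]

/-- For y ≥ 1/t an entry outside the box makes the weight at least t. For smaller y only the uniform
bound remains, and the indicator records this; such points are rare. -/
theorem sum_not_mem_coprimeBox_le {m : ℕ} {γ : ℝ} (hγ : 0 < γ) : ∃ C : ℝ, 0 < C ∧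
    ∀ α, γ ≤ α → ∀ t : ℝ, 1 ≤ t → ∀ K : ℕ, t ^ 2 ≤ K → ∀ p : ℝ × ℝ,
      ∀ S : Finset ((Fin (m + 1) → ℤ) × (Fin (m + 1) → ℤ)),
        (∀ v ∈ S, v ∈ coprimeVectors (m + 1) ∧ v ∉ coprimeBox (m + 1) K) →
          ∑ v ∈ S, |(region v.1 v.2).indicator (integrand m α v.1 v.2) p| ≤
            C * (t ^ (-loss (m + 1)) + if p.2 * t < 1 then 1 else 0) := by
  obtain ⟨C, hC, H⟩ := sum_abs_indicator_integrand_le (m := m) hγ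
  refine ⟨C, hC, fun α hα t ht K hK p S hS => ?_⟩
  have ht0 : 0 < t := by linarith
  split_ifs with hp
  · refine (H α hα 1 one_pos p S (fun v hv => (hS v hv).1) fun v _ _ => one_le_weight p _).trans ?_
    rw [Real.one_rpow]
    have := Real.rpow_nonneg ht0.le (-loss (m + 1))
    gcongr
    linarith
  · rw [add_zero]
    refine H α hα t ht0 p S (fun v hv => (hS v hv).1) fun v hv hr => ?_
    obtain ⟨h1, h2⟩ := hS v hv
    have : ∃ i, (K : ℤ) < |v.1 i| ∨ (K : ℤ) < |v.2 i| := by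
      by_contra hcon
      push Not at hcon
      exact h2 (mem_coprimeBox.2 ⟨hcon, h1⟩)
    obtain ⟨i, hi⟩ := this
    refine le_weight_of_not_mem_box hr ht (not_lt.1 hp) (i := i) ?_
    rcases hi with hi | hi
    · left; exact hK.trans_lt (by exact_mod_cast hi)
    · right; exact hK.trans_lt (by exact_mod_cast hi)

theorem setIntegral_low_le {t : ℝ} (ht : 1 ≤ t) {ε : ℝ} (hε : ε ≤ 1) {C : ℝ} (hC : 0 < C) :
    IntegrableOn (fun p : ℝ × ℝ => C * (t ^ (-ε) + if p.2 * t < 1 then 1 else 0)) unitSquare ∧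
    ∫ p in unitSquare, C * (t ^ (-ε) + if p.2 * t < 1 then 1 else 0) ≤ 3 * C * t ^ (-ε) := by
  have ht0 : 0 < t := by linarith
  have hle : ∀ p ∈ unitSquare, (if (p : ℝ × ℝ).2 * t < 1 then (1 : ℝ) else 0) ≤
      (unitSquare ∩ strip 1 0 0 (1 / t)).indicator (fun _ => 1) p := by
    intro p hp
    split_ifs with hpt
    · rw [Set.indicator_of_mem]
      refine ⟨hp, ?_⟩
      simp only [strip, Set.mem_ofPred_eq, Int.cast_one, one_mul, Int.cast_zero, zero_mul, sub_zero]
      rw [abs_of_nonneg hp.2.1, le_div_iff₀ ht0]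
      exact hpt.le
    · exact Set.indicator_nonneg (fun _ _ => zero_le_one) _
  have hm : MeasurableSet {p : ℝ × ℝ | p.2 * t < 1} :=
    measurableSet_lt (by fun_prop) measurable_const
  have hmeas : Measurable (fun p : ℝ × ℝ => (if p.2 * t < 1 then (1 : ℝ) else 0)) :=
    Measurable.ite hm measurable_const measurable_const
  have hi1 : IntegrableOn (fun p : ℝ × ℝ => (if p.2 * t < 1 then (1 : ℝ) else 0)) unitSquare :=
    integrableOn_of_abs_le subset_rfl hmeas (c := 1) fun p => by split_ifs <;> simp
  have hi0 : IntegrableOn (fun _ : ℝ × ℝ => t ^ (-ε)) unitSquare :=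
    integrableOn_of_abs_le subset_rfl measurable_const fun _ => le_rfl
  refine ⟨(hi0.add hi1).const_mul C, ?_⟩
  have hbad : ∫ p in unitSquare, (if (p : ℝ × ℝ).2 * t < 1 then (1 : ℝ) else 0) ≤ 2 * (1 / t) := by
    have hms := measurableSet_unitSquare.inter (measurableSet_strip 1 0 0 (1 / t))
    calc _ ≤ ∫ p in unitSquare,
          (unitSquare ∩ strip 1 0 0 (1 / t)).indicator (fun _ => (1 : ℝ)) p := by
          refine setIntegral_mono_on hi1 ?_ measurableSet_unitSquare hle
          refine integrableOn_of_abs_le subset_rfl (measurable_const.indicator hms) (c := 1) ?_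
          intro p
          by_cases hp : p ∈ unitSquare ∩ strip 1 0 0 (1 / t)
          · rw [Set.indicator_of_mem hp, abs_one]
          · rw [Set.indicator_of_notMem hp, abs_zero]
            exact zero_le_one
      _ = (volume (unitSquare ∩ strip 1 0 0 (1 / t))).toReal := by
          rw [setIntegral_indicator hms, ← Set.inter_assoc, Set.inter_self, setIntegral_const]
          simp [Measure.real]
      _ ≤ _ := ENNReal.toReal_le_of_le_ofReal (by positivity)
          (volume_strip_le (Or.inl one_ne_zero) _ _)
  -- The low strip has area at most 2/t, which the main tail term absorbs.
  have hinv : 1 / t ≤ t ^ (-ε) := by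
    rw [one_div, ← Real.rpow_neg_one]
    exact Real.rpow_le_rpow_of_exponent_le ht (by linarith)
  rw [integral_const_mul, integral_add hi0 hi1, setIntegral_unitSquare_const]
  nlinarith

theorem abs_tsum_sub_sum_coprimeBox_le {m : ℕ} {γ : ℝ} (hγ : 0 < γ) : ∃ C : ℝ, 0 < C ∧
    ∀ α, γ ≤ α → ∀ t : ℝ, 1 ≤ t → ∀ K : ℕ, t ^ 2 ≤ K →
      |∑' v : coprimeVectors (m + 1), regionIntegral m α v -
        ∑ v ∈ coprimeBox (m + 1) K, regionIntegral m α v| ≤ C * t ^ (-loss (m + 1)) := by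
  classical
  obtain ⟨C, hC, H⟩ := sum_not_mem_coprimeBox_le (m := m) hγ
  refine ⟨3 * C, by positivity, fun α hα t ht K hK => ?_⟩
  obtain ⟨hi, hle⟩ := setIntegral_low_le ht (ε := loss (m + 1))
    (by linarith [loss_le (m + 1)]) hC
  set B : Finset (coprimeVectors (m + 1)) := (coprimeBox (m + 1) K).subtype _ with hB
  have hBsum : ∑ v ∈ coprimeBox (m + 1) K, regionIntegral m α v =
      ∑ v ∈ B, regionIntegral m α v := by
    rw [sum_coprimeVectors_eq B (regionIntegral m α), hB, Finset.subtype_map]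
    refine Finset.sum_congr (Finset.filter_true_of_mem fun v hv => ?_).symm fun _ _ => rfl
    exact (mem_coprimeBox.1 hv).2
  have hs : Summable fun v : coprimeVectors (m + 1) => regionIntegral m α v :=
    (summable_abs_regionIntegral m (hγ.trans_le hα)).of_abs
  rw [hBsum, ← hs.sum_add_tsum_subtype_compl B, add_sub_cancel_left]
  refine abs_tsum_le_of_sum_abs_le fun S => ?_
  set S' : Finset ((Fin (m + 1) → ℤ) × (Fin (m + 1) → ℤ)) :=
    (S.map (Function.Embedding.subtype _)).map (Function.Embedding.subtype _) with hS'
  have e : ∑ v ∈ S, |regionIntegral m α v| = ∑ v ∈ S', |regionIntegral m α v| := by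
    rw [hS', ← sum_coprimeVectors_eq _ fun v => |regionIntegral m α v|, Finset.sum_map]
    rfl
  rw [e]
  calc _ ≤ ∑ v ∈ S', ∫ p in region v.1 v.2, |integrand m α v.1 v.2 p| :=
        Finset.sum_le_sum fun v _ => abs_regionIntegral_le m α v
    _ ≤ _ := by
        refine (sum_setIntegral_le S' _ (fun v => (integrableOn_integrand m α v.1 v.2).abs)
          hi fun p => ?_).trans hle
        simp only [abs_indicator]
        refine H α hα t ht K hK p S' fun v hv => ?_
        rw [hS'] at hv
        simp only [Finset.mem_map, Function.Embedding.subtype_apply] at hv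
        obtain ⟨w, ⟨u, hu, rfl⟩, rfl⟩ := hv
        refine ⟨u.1.2, fun hmem => u.2 ?_⟩
        exact Finset.mem_subtype.2 hmem

/-! ### Riemann sums. -/

/-- Comparison of a Riemann sum with mesh `e` with an integral. -/
theorem abs_riemannSum_sub_integral_le {f g : ℝ × ℝ → ℝ} (hf : Measurable f) {c : ℝ}
    (hfc : ∀ p, |f p| ≤ c) (hf0 : ∀ p, p ∉ unitSquare → f p = 0) (hg : Integrable g)
    (hg0 : ∀ p, 0 ≤ g p) {e : ℝ} (he : 0 < e) {K : ℕ} (hK : 1 ≤ K * e)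
    (H : ∀ p ∈ unitSquare, ∀ p' : ℝ × ℝ, p.1 ≤ p'.1 → p'.1 ≤ p.1 + e → p.2 ≤ p'.2 →
      p'.2 ≤ p.2 + e → |f p' - f p| ≤ g p) :
    |e ^ 2 * ∑ i ∈ Finset.range K, ∑ j ∈ Finset.range K, f ((i + 1) * e, (j + 1) * e) -
      ∫ p, f p| ≤ ∫ p, g p := by
  have hfi : Integrable f := by
    have := (integrable_indicator_iff measurableSet_unitSquare).2
      (integrableOn_of_abs_le subset_rfl hf hfc)
    rwa [Set.indicator_eq_self.2 (fun p hp => by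
      by_contra hcon; exact hp (hf0 p hcon))] at this
  let cell : ℕ × ℕ → Set (ℝ × ℝ) := fun i =>
    Set.Ioc (i.1 * e) ((i.1 + 1) * e) ×ˢ Set.Ioc (i.2 * e) ((i.2 + 1) * e)
  let J := Finset.range K ×ˢ Finset.range K
  have hcm : ∀ i, MeasurableSet (cell i) := fun i => measurableSet_Ioc.prod measurableSet_Ioc
  have hIoc : ∀ (a b : ℕ) (x : ℝ), x ∈ Set.Ioc (a * e) ((a + 1) * e) →
      x ∈ Set.Ioc (b * e) ((b + 1) * e) → a ≤ b := by
    intro a b x h1 h2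
    by_contra hcon
    have : (b : ℝ) + 1 ≤ a := by exact_mod_cast not_le.1 hcon
    have h3 : ((b : ℝ) + 1) * e ≤ a * e := by gcongr
    exact absurd (h1.1.trans_le (h2.2.trans h3)) (lt_irrefl _)
  have hdisj : Set.Pairwise (J : Set (ℕ × ℕ)) (Function.onFun Disjoint cell) := by
    intro i _ j _ hij
    rw [Function.onFun, Set.disjoint_left]
    intro p hp hp'
    exact hij (Prod.ext (le_antisymm (hIoc _ _ _ hp.1 hp'.1) (hIoc _ _ _ hp'.1 hp.1))
      (le_antisymm (hIoc _ _ _ hp.2 hp'.2) (hIoc _ _ _ hp'.2 hp.2)))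
  have hcover : ∀ x ∈ Set.Ioc (0 : ℝ) 1, ∃ i < K, x ∈ Set.Ioc (i * e) (((i : ℕ) + 1 : ℝ) * e) := by
    intro x hx
    have h0 : 0 < ⌈x / e⌉₊ := Nat.ceil_pos.2 (div_pos hx.1 he)
    obtain ⟨n, hn⟩ : ∃ n, ⌈x / e⌉₊ = n + 1 := ⟨⌈x / e⌉₊ - 1, by omega⟩
    have h1 : x / e ≤ n + 1 := by
      have := Nat.le_ceil (x / e); rw [hn] at this; exact_mod_cast this
    have h2 : (n : ℝ) < x / e := Nat.lt_ceil.1 (by omega)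
    refine ⟨n, ?_, (lt_div_iff₀ he).1 h2, (div_le_iff₀ he).1 h1⟩
    have h3 : (n : ℝ) < K := h2.trans_le ((div_le_iff₀ he).2 (hx.2.trans hK))
    exact_mod_cast h3
  have hvol : ∀ i, volume.real (cell i) = e ^ 2 := by
    intro i
    rw [Measure.real, Measure.volume_eq_prod, Measure.prod_prod, Real.volume_Ioc, Real.volume_Ioc,
      ← ENNReal.ofReal_mul (by nlinarith), ENNReal.toReal_ofReal (by nlinarith)]
    ring
  have hvol' : ∀ i, volume (cell i) ≠ ⊤ := fun i h => by
    have := hvol i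
    rw [Measure.real, h, ENNReal.toReal_top] at this
    nlinarith
  let U := ⋃ i ∈ J, cell i
  have hU : ∫ p, f p = ∫ p in U, f p := by
    symm
    refine setIntegral_eq_integral_of_ae_compl_eq_zero ?_
    -- The half-open cells miss the coordinate axes, a null set.
    have hae : (unitSquare : Set (ℝ × ℝ)) =ᵐ[volume]
        (Set.Ioc (0 : ℝ) 1 ×ˢ Set.Ioc (0 : ℝ) 1 : Set (ℝ × ℝ)) := by
      rw [Measure.volume_eq_prod]
      exact Measure.set_prod_ae_eq Ioc_ae_eq_Icc.symm Ioc_ae_eq_Icc.symm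
    filter_upwards [hae] with p hp hpU
    refine hf0 p fun hmem => hpU ?_
    have hmem' : p ∈ (Set.Ioc (0 : ℝ) 1 ×ˢ Set.Ioc (0 : ℝ) 1 : Set (ℝ × ℝ)) := hp.mp hmem
    obtain ⟨i, hi, hi'⟩ := hcover p.1 hmem'.1
    obtain ⟨j, hj, hj'⟩ := hcover p.2 hmem'.2
    exact Set.mem_biUnion (Finset.mem_coe.2 (Finset.mk_mem_product (Finset.mem_range.2 hi)
      (Finset.mem_range.2 hj))) ⟨hi', hj'⟩
  have hUf : ∫ p in U, f p = ∑ i ∈ J, ∫ p in cell i, f p :=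
    integral_biUnion_finset J (fun i _ => hcm i) hdisj fun i _ => hfi.integrableOn
  have hUg : ∑ i ∈ J, ∫ p in cell i, g p = ∫ p in U, g p :=
    (integral_biUnion_finset J (fun i _ => hcm i) hdisj fun i _ => hg.integrableOn).symm
  have hsum : e ^ 2 * ∑ i ∈ Finset.range K, ∑ j ∈ Finset.range K, f ((i + 1) * e, (j + 1) * e) =
      ∑ i ∈ J, ∫ _ in cell i, f ((i.1 + 1) * e, (i.2 + 1) * e) := by
    rw [← Finset.sum_product', Finset.mul_sum]
    refine Finset.sum_congr rfl fun i _ => ?_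
    rw [setIntegral_const, hvol, smul_eq_mul]
  rw [hU, hUf, hsum, ← Finset.sum_sub_distrib]
  have hconst : ∀ (i : ℕ × ℕ) (a : ℝ), IntegrableOn (fun _ => a) (cell i) := fun i a =>
    integrableOn_const (hvol' i)
  calc _ ≤ ∑ i ∈ J, ∫ p in cell i, g p := by
        refine (Finset.abs_sum_le_sum_abs _ _).trans (Finset.sum_le_sum fun i _ => ?_)
        rw [← integral_sub (hconst i _) hfi.integrableOn]
        refine (abs_integral_le_integral_abs).trans ?_
        refine setIntegral_mono_on ((hconst i _).sub hfi.integrableOn).abs hg.integrableOn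
          (hcm i) fun p hp => ?_
        obtain ⟨⟨h1, h2⟩, h3, h4⟩ := hp
        have a1 : (0 : ℝ) ≤ i.1 * e := by positivity
        have a2 : (0 : ℝ) ≤ i.2 * e := by positivity
        by_cases hpu : p ∈ unitSquare
        · exact H p hpu _ h2 (by simp only; linarith) h4 (by simp only; linarith)
        -- The cell has positive coordinates, so a point outside the square has a coordinate above
        -- 1, as then does the upper right corner; `f` vanishes at both.
        · rw [hf0 p hpu, hf0 _ fun hcon => hpu ⟨⟨by linarith, h2.trans hcon.1.2⟩,
            ⟨by linarith, h4.trans hcon.2.2⟩⟩, sub_zero, abs_zero]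
          exact hg0 p
    _ = ∫ p in U, g p := hUg
    _ ≤ _ := setIntegral_le_integral hg (Filter.Eventually.of_forall hg0)

/-! ### Equidistribution of coprime lattice points. -/

theorem sum_moebius_eq_ite (n : ℕ) :
    ∑ d ∈ n.divisors, (ArithmeticFunction.moebius d : ℝ) = if n = 1 then 1 else 0 := by
  have h1 := congrArg (fun f : ArithmeticFunction ℤ => f n) ArithmeticFunction.moebius_mul_coe_zeta
  simp only [ArithmeticFunction.coe_mul_zeta_apply, ArithmeticFunction.one_apply] at h1
  exact_mod_cast h1

theorem abs_moebius_cast_le_one (d : ℕ) : |(ArithmeticFunction.moebius d : ℝ)| ≤ 1 := by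
  exact_mod_cast ArithmeticFunction.abs_moebius_le_one (n := d)

theorem abs_moebius_div_sq_le (d : ℕ) :
    |(ArithmeticFunction.moebius d : ℝ) / (d : ℝ) ^ 2| ≤ 1 / (d : ℝ) ^ 2 := by
  rw [abs_div, abs_of_nonneg (by positivity : (0 : ℝ) ≤ (d : ℝ) ^ 2)]
  gcongr
  exact abs_moebius_cast_le_one d

theorem summable_moebius_div_sq :
    Summable fun d : ℕ => (ArithmeticFunction.moebius d : ℝ) / (d : ℝ) ^ 2 :=
  Summable.of_abs ((Real.summable_one_div_nat_pow.2 one_lt_two).of_nonneg_of_le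
    (fun _ => abs_nonneg _) abs_moebius_div_sq_le)

/-- The series is 1/ζ(2). -/
theorem tsum_moebius_div_sq :
    ∑' d : ℕ, (ArithmeticFunction.moebius d : ℝ) / (d : ℝ) ^ 2 = 6 / Real.pi ^ 2 := by
  have h1 := ArithmeticFunction.LSeries_zeta_mul_Lseries_moebius (s := 2) (by norm_num)
  rw [ArithmeticFunction.LSeries_zeta_eq_riemannZeta (by norm_num), riemannZeta_two] at h1
  have h2 : LSeries (fun n => (ArithmeticFunction.moebius n : ℂ)) 2 =
      ((∑' d : ℕ, (ArithmeticFunction.moebius d : ℝ) / (d : ℝ) ^ 2 : ℝ) : ℂ) := by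
    rw [LSeries, Complex.ofReal_tsum]
    refine tsum_congr fun d => ?_
    rw [LSeries.term_def]
    split_ifs with h0
    · simp [h0]
    · push_cast
      congr 1
      exact_mod_cast Complex.cpow_natCast (d : ℂ) 2
  rw [h2] at h1
  have h3 : Real.pi ^ 2 / 6 *
      ∑' d : ℕ, (ArithmeticFunction.moebius d : ℝ) / (d : ℝ) ^ 2 = 1 := by exact_mod_cast h1
  have := Real.pi_ne_zero
  field_simp
  field_simp at h3
  linarith

/-- The range on the right is not cut at Q/d: the extra multiples exceed Q, where `G` vanishes.
Every divisor thus gets a Riemann sum with the same number of terms. -/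
theorem sum_filter_dvd_eq {Q d : ℕ} (hd : 1 ≤ d) (G : ℕ → ℝ) (hG : ∀ x, Q < x → G x = 0) :
    ∑ x ∈ (Finset.Icc 1 Q).filter (d ∣ ·), G x = ∑ i ∈ Finset.range Q, G (d * (i + 1)) := by
  have hinj : Set.InjOn (fun i => d * (i + 1)) (Finset.range Q : Set ℕ) := by
    intro i _ j _ hij
    have := Nat.eq_of_mul_eq_mul_left (by omega) hij
    omega
  rw [← Finset.sum_image (f := G) hinj]
  refine Finset.sum_subset ?_ ?_
  · intro x hx
    simp only [Finset.mem_filter, Finset.mem_Icc] at hx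
    obtain ⟨⟨h1, h2⟩, c, rfl⟩ := hx
    have hc : 1 ≤ c := Nat.pos_of_ne_zero fun h => by simp [h] at h1
    refine Finset.mem_image.2 ⟨c - 1, Finset.mem_range.2 ?_, ?_⟩
    · have : c ≤ d * c := Nat.le_mul_of_pos_left c (by omega)
      omega
    · rw [Nat.sub_add_cancel hc]
  · intro x hx hx2
    obtain ⟨i, -, rfl⟩ := Finset.mem_image.1 hx
    refine hG _ ?_
    by_contra hle
    refine hx2 ?_
    simp only [Finset.mem_filter, Finset.mem_Icc]
    exact ⟨⟨Nat.mul_pos (by omega) (by omega), not_lt.1 hle⟩, dvd_mul_right _ _⟩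

theorem sum_coprime_eq (Q : ℕ) (F : ℕ → ℕ → ℝ) (hF1 : ∀ x q, Q < x → F x q = 0)
    (hF2 : ∀ x q, Q < q → F x q = 0) :
    ∑ x ∈ Finset.Icc 1 Q, ∑ q ∈ Finset.Icc 1 Q, (if Nat.Coprime x q then F x q else 0) =
      ∑ d ∈ Finset.Icc 1 Q, (ArithmeticFunction.moebius d : ℝ) *
        ∑ i ∈ Finset.range Q, ∑ j ∈ Finset.range Q, F (d * (i + 1)) (d * (j + 1)) := by
  calc _ = ∑ x ∈ Finset.Icc 1 Q, ∑ q ∈ Finset.Icc 1 Q, ∑ d ∈ Finset.Icc 1 Q,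
        if d ∣ x then (if d ∣ q then (ArithmeticFunction.moebius d : ℝ) * F x q else 0) else 0 := by
        refine Finset.sum_congr rfl fun x hx => Finset.sum_congr rfl fun q hq => ?_
        have hx1 := (Finset.mem_Icc.1 hx)
        have hg : Nat.gcd x q ≠ 0 := by
          intro h0; have := (Nat.gcd_eq_zero_iff.1 h0).1; omega
        have h1 := sum_moebius_eq_ite (Nat.gcd x q)
        have h2 : (Nat.gcd x q).divisors =
            (Finset.Icc 1 Q).filter (fun d => d ∣ x ∧ d ∣ q) := by
          ext d
          simp only [Nat.mem_divisors, Finset.mem_filter, Finset.mem_Icc, Nat.dvd_gcd_iff]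
          constructor
          · rintro ⟨h3, -⟩
            have := Nat.le_of_dvd (by omega) h3.1
            have := Nat.pos_of_dvd_of_pos h3.1 (by omega)
            exact ⟨⟨by omega, by omega⟩, h3⟩
          · rintro ⟨-, h3⟩
            exact ⟨h3, hg⟩
        rw [h2, Finset.sum_filter] at h1
        have h3 : (if Nat.Coprime x q then F x q else 0) =
            (if Nat.gcd x q = 1 then 1 else 0) * F x q := by
          simp only [Nat.Coprime]; split_ifs <;> simp
        rw [h3, ← h1, Finset.sum_mul]
        refine Finset.sum_congr rfl fun d _ => ?_
        by_cases hdx : d ∣ x <;> by_cases hdq : d ∣ q <;> simp [hdx, hdq]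
    _ = ∑ d ∈ Finset.Icc 1 Q, ∑ x ∈ Finset.Icc 1 Q, ∑ q ∈ Finset.Icc 1 Q,
        if d ∣ x then (if d ∣ q then (ArithmeticFunction.moebius d : ℝ) * F x q else 0) else 0 := by
        rw [Finset.sum_comm' (t' := Finset.Icc 1 Q) (s' := fun _ => Finset.Icc 1 Q) (by tauto)]
        rw [Finset.sum_congr rfl fun x _ => Finset.sum_comm, Finset.sum_comm]
        refine Finset.sum_congr rfl fun d _ => Finset.sum_comm
    _ = _ := by
        refine Finset.sum_congr rfl fun d hd => ?_
        have hd1 := (Finset.mem_Icc.1 hd).1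
        rw [← sum_filter_dvd_eq hd1 (fun x => ∑ j ∈ Finset.range Q, F x (d * (j + 1)))
          (fun x hx => Finset.sum_eq_zero fun j _ => hF1 _ _ hx), Finset.sum_filter, Finset.mul_sum]
        refine Finset.sum_congr rfl fun x _ => ?_
        by_cases hdx : d ∣ x
        · simp only [hdx, if_true]
          rw [← sum_filter_dvd_eq hd1 (fun q => F x q) (fun q hq => hF2 _ _ hq),
            Finset.sum_filter, Finset.mul_sum]
          exact Finset.sum_congr rfl fun q _ => by rw [mul_ite, mul_zero]
        · simp [hdx]

/-- Coprime lattice points are equidistributed with density `6 / π ^ 2`, quantitatively in terms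
of the quality of the Riemann sums. -/
theorem exists_abs_coprime_average_sub_le : ∃ C₀ : ℝ, 0 < C₀ ∧
    ∀ (f : ℝ × ℝ → ℝ) (I E : ℝ), 0 ≤ E → (∀ p : ℝ × ℝ, 1 < p.1 ∨ 1 < p.2 → f p = 0) →
      (∀ (e : ℝ) (K : ℕ), 0 < e → e ≤ 1 → 1 ≤ K * e →
        |e ^ 2 * ∑ i ∈ Finset.range K, ∑ j ∈ Finset.range K, f ((i + 1) * e, (j + 1) * e) - I| ≤
          E * e ^ (1 / 5 : ℝ)) →
      ∀ Q : ℕ, 1 ≤ Q →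
        |((Q : ℝ) ^ 2)⁻¹ * ∑ x ∈ Finset.Icc 1 Q, ∑ q ∈ Finset.Icc 1 Q,
            (if Nat.Coprime x q then f ((x : ℝ) / Q, (q : ℝ) / Q) else 0) -
          6 / Real.pi ^ 2 * I| ≤ C₀ * (E + |I|) * (Q : ℝ) ^ (-(1 / 5) : ℝ) := by
  have hsum : Summable fun d : ℕ => 1 / (d : ℝ) ^ (9 / 5 : ℝ) :=
    Real.summable_one_div_nat_rpow.2 (by norm_num)
  have hpos : ∀ d : ℕ, 0 ≤ 1 / (d : ℝ) ^ (9 / 5 : ℝ) := fun d => by positivity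
  refine ⟨(∑' d : ℕ, 1 / (d : ℝ) ^ (9 / 5 : ℝ)) + 1, add_pos_of_nonneg_of_pos (tsum_nonneg hpos) one_pos,
    fun f I E hE hf0 hR Q hQ => ?_⟩
  set Z := ∑' d : ℕ, 1 / (d : ℝ) ^ (9 / 5 : ℝ) with hZ
  have hQ0 : (0 : ℝ) < Q := by exact_mod_cast hQ
  set μ : ℕ → ℝ := fun d => (ArithmeticFunction.moebius d : ℝ) with hμ
  have hQc : (0 : ℝ) ≤ (Q : ℝ) ^ (-(1 / 5) : ℝ) := by positivity
  rw [sum_coprime_eq Q (fun x q => f ((x : ℝ) / Q, (q : ℝ) / Q))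
    (fun x q hx => hf0 _ (Or.inl (by
      simp only; rw [one_lt_div hQ0]; exact_mod_cast hx)))
    (fun x q hx => hf0 _ (Or.inr (by
      simp only; rw [one_lt_div hQ0]; exact_mod_cast hx)))]
  -- After Möbius inversion the divisor d contributes μ(d)/d² times the Riemann sum of mesh d/Q.
  set R : ℕ → ℝ := fun d => ((d : ℝ) / Q) ^ 2 *
    ∑ i ∈ Finset.range Q, ∑ j ∈ Finset.range Q, f ((i + 1) * ((d : ℝ) / Q), (j + 1) * ((d : ℝ) / Q))
    with hRdef
  have e1 : ((Q : ℝ) ^ 2)⁻¹ * ∑ d ∈ Finset.Icc 1 Q, (ArithmeticFunction.moebius d : ℝ) *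
      ∑ i ∈ Finset.range Q, ∑ j ∈ Finset.range Q,
        f (((d * (i + 1) : ℕ) : ℝ) / Q, ((d * (j + 1) : ℕ) : ℝ) / Q) =
      ∑ d ∈ Finset.Icc 1 Q, μ d / (d : ℝ) ^ 2 * R d := by
    rw [Finset.mul_sum]
    refine Finset.sum_congr rfl fun d hd => ?_
    have hd0 : (d : ℝ) ≠ 0 := by
      have := (Finset.mem_Icc.1 hd).1
      exact_mod_cast (by omega : d ≠ 0)
    have : ∀ i : ℕ, ((d * (i + 1) : ℕ) : ℝ) / Q = (i + 1) * ((d : ℝ) / Q) := fun i => by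
      push_cast; ring
    simp only [this, hRdef, hμ]
    generalize ∑ i ∈ Finset.range Q, ∑ j ∈ Finset.range Q,
      f ((i + 1) * ((d : ℝ) / Q), (j + 1) * ((d : ℝ) / Q)) = s
    field_simp
  rw [e1]
  have e2 : ∑ d ∈ Finset.Icc 1 Q, μ d / (d : ℝ) ^ 2 * R d - 6 / Real.pi ^ 2 * I =
      ∑ d ∈ Finset.Icc 1 Q, μ d / (d : ℝ) ^ 2 * (R d - I) -
        (∑' d : ℕ, μ d / (d : ℝ) ^ 2 - ∑ d ∈ Finset.Icc 1 Q, μ d / (d : ℝ) ^ 2) * I := by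
    rw [← tsum_moebius_div_sq]
    simp only [mul_sub, Finset.sum_sub_distrib, ← Finset.sum_mul]
    ring
  rw [e2]
  have b1 : |∑ d ∈ Finset.Icc 1 Q, μ d / (d : ℝ) ^ 2 * (R d - I)| ≤
      Z * (E * (Q : ℝ) ^ (-(1 / 5) : ℝ)) := by
    refine (Finset.abs_sum_le_sum_abs _ _).trans ?_
    calc _ ≤ ∑ d ∈ Finset.Icc 1 Q, 1 / (d : ℝ) ^ (9 / 5 : ℝ) * (E * (Q : ℝ) ^ (-(1 / 5) : ℝ)) := by
          refine Finset.sum_le_sum fun d hd => ?_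
          obtain ⟨h1, h2⟩ := Finset.mem_Icc.1 hd
          have hd0 : (0 : ℝ) < d := by exact_mod_cast h1
          have h3 := hR ((d : ℝ) / Q) Q (by positivity)
            (by rw [div_le_one hQ0]; exact_mod_cast h2)
            (by rw [mul_div_cancel₀ _ hQ0.ne']; exact_mod_cast h1)
          rw [abs_mul]
          calc _ ≤ 1 / (d : ℝ) ^ 2 * (E * ((d : ℝ) / Q) ^ (1 / 5 : ℝ)) :=
                mul_le_mul (abs_moebius_div_sq_le d) h3 (abs_nonneg _) (by positivity)
            _ = _ := by
                rw [Real.div_rpow hd0.le hQ0.le, Real.rpow_neg hQ0.le]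
                -- The error (d/Q)^(1/5) against the weight 1/d² leaves the summable d^(-9/5) and
                -- the saving Q^(-1/5).
                have : (d : ℝ) ^ 2 = (d : ℝ) ^ (9 / 5 : ℝ) * (d : ℝ) ^ (1 / 5 : ℝ) := by
                  rw [← Real.rpow_add hd0]; norm_num
                rw [this]
                have := (Real.rpow_pos_of_pos hd0 (1 / 5)).ne'
                field_simp
      _ ≤ _ := by
          rw [← Finset.sum_mul]
          gcongr
          exact hsum.sum_le_tsum _ fun d _ => hpos d
  have b2 : |∑' d : ℕ, μ d / (d : ℝ) ^ 2 - ∑ d ∈ Finset.Icc 1 Q, μ d / (d : ℝ) ^ 2| ≤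
      Z * (Q : ℝ) ^ (-(1 / 5) : ℝ) := by
    rw [← (summable_moebius_div_sq).sum_add_tsum_subtype_compl (Finset.Icc 1 Q),
      add_sub_cancel_left]
    refine abs_tsum_le_of_sum_abs_le fun S => ?_
    calc ∑ d ∈ S, |μ d / (d : ℝ) ^ 2| ≤
        ∑ d ∈ S, 1 / ((d : ℕ) : ℝ) ^ (9 / 5 : ℝ) * (Q : ℝ) ^ (-(1 / 5) : ℝ) := by
          refine Finset.sum_le_sum fun d _ => ?_
          refine (abs_moebius_div_sq_le d).trans ?_
          rcases Nat.eq_zero_or_pos (d : ℕ) with h0 | h0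
          · rw [h0]; simp
          · have hd0 : (0 : ℝ) < (d : ℕ) := by exact_mod_cast h0
            have hdQ : (Q : ℝ) ≤ (d : ℕ) := by
              have h4 := d.2
              rw [Finset.mem_Icc] at h4
              exact_mod_cast (by omega : Q ≤ (d : ℕ))
            -- In the tail d > Q the same splitting turns 1/d² into at most d^(-9/5) Q^(-1/5).
            have : ((d : ℕ) : ℝ) ^ 2 = ((d : ℕ) : ℝ) ^ (9 / 5 : ℝ) * ((d : ℕ) : ℝ) ^ (1 / 5 : ℝ) := by
              rw [← Real.rpow_add hd0]; norm_num
            rw [this, Real.rpow_neg hQ0.le, one_div, mul_inv, ← one_div]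
            gcongr
      _ = (∑ d ∈ S.map (Function.Embedding.subtype _), 1 / (d : ℝ) ^ (9 / 5 : ℝ)) *
            (Q : ℝ) ^ (-(1 / 5) : ℝ) := by
          rw [← Finset.sum_mul, Finset.sum_map]; rfl
      _ ≤ _ := by
          gcongr
          exact hsum.sum_le_tsum _ fun d _ => hpos d
  have hZ0 : 0 ≤ Z := tsum_nonneg hpos
  refine (abs_sub _ _).trans ?_
  rw [abs_mul]
  have b3 := mul_le_mul_of_nonneg_right b2 (abs_nonneg I)
  have : 0 ≤ (E + |I|) * (Q : ℝ) ^ (-(1 / 5) : ℝ) := by positivity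
  nlinarith

/-! ### Riemann sums of a single integrand. -/

/-- The linear form `A y - B x`. -/
def form (w : ℤ × ℤ) (p : ℝ × ℝ) : ℝ := (w.1 : ℝ) * p.2 - (w.2 : ℝ) * p.1

/-- Apart from x ≥ 0, which holds at all points compared below, every condition places a linear form
relative to 0 or 1. -/
theorem mem_region_iff {k : ℕ} (v : (Fin k → ℤ) × (Fin k → ℤ)) (p : ℝ × ℝ) :
    p ∈ region v.1 v.2 ↔ 0 ≤ p.1 ∧ 0 ≤ form (1, 1) p ∧ form (1, 0) p ≤ 1 ∧
      ∀ i, 0 < form (pairs v i) p ∧ form (pairs v i) p ≤ 1 := by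
  simp only [region, form, pairs, Int.cast_one, one_mul, Int.cast_zero, zero_mul, sub_zero,
    sub_nonneg]
  rfl

theorem abs_form_sub_le {w : ℤ × ℤ} {K : ℝ} (h1 : |(w.1 : ℝ)| ≤ K) (h2 : |(w.2 : ℝ)| ≤ K)
    {p p' : ℝ × ℝ} {e : ℝ} (e1 : |p'.1 - p.1| ≤ e) (e2 : |p'.2 - p.2| ≤ e) :
    |form w p' - form w p| ≤ 2 * K * e := by
  have hK : 0 ≤ K := (abs_nonneg _).trans h1
  have : form w p' - form w p = w.1 * (p'.2 - p.2) - w.2 * (p'.1 - p.1) := by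
    unfold form; ring
  rw [this]
  refine (abs_sub _ _).trans ?_
  rw [abs_mul, abs_mul]
  have a1 := mul_le_mul h1 e2 (abs_nonneg _) hK
  have a2 := mul_le_mul h2 e1 (abs_nonneg _) hK
  linarith

theorem abs_h_sub_le {w : ℤ × ℤ} {K : ℝ} (hK : 1 ≤ K) (h1 : |(w.1 : ℝ)| ≤ K)
    (h2 : |(w.2 : ℝ)| ≤ K) {p p' : ℝ × ℝ} {e η : ℝ} (hη : 0 < η) (e1 : |p'.1 - p.1| ≤ e)
    (e2 : |p'.2 - p.2| ≤ e) (hy : η ≤ p.2) (hy1 : p.2 ≤ 1) (hy' : η / 2 ≤ p'.2)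
    (hL : η ≤ form w p) (hL' : η / 2 ≤ form w p') (hL1' : form w p' ≤ 1) :
    |h w.1 w.2 p - h w.1 w.2 p'| ≤ 12 * K ^ 2 * e / η ^ 4 := by
  have hd := abs_form_sub_le h1 h2 e1 e2
  have he : 0 ≤ e := (abs_nonneg _).trans e1
  have y0 : 0 < p.2 := by linarith
  have y0' : 0 < p'.2 := by linarith
  have l0 : 0 < form w p := by linarith
  have l0' : 0 < form w p' := by linarith
  have eq : h w.1 w.2 p - h w.1 w.2 p' =
      w.2 * ((p'.2 - p.2) * form w p' + p.2 * (form w p' - form w p)) /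
        ((p.2 * form w p) * (p'.2 * form w p')) := by
    change (w.2 : ℝ) / (p.2 * form w p) - (w.2 : ℝ) / (p'.2 * form w p') = _
    rw [div_sub_div _ _ (mul_pos y0 l0).ne' (mul_pos y0' l0').ne']
    congr 1; ring
  have hnum : |(w.2 : ℝ) * ((p'.2 - p.2) * form w p' + p.2 * (form w p' - form w p))| ≤
      3 * K ^ 2 * e := by
    rw [abs_mul]
    have a1 : |(p'.2 - p.2) * form w p' + p.2 * (form w p' - form w p)| ≤ 3 * K * e := by
      refine (abs_add_le _ _).trans ?_
      rw [abs_mul, abs_mul, abs_of_pos l0', abs_of_pos y0]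
      have b1 := mul_le_mul e2 hL1' l0'.le he
      have b2 := mul_le_mul hy1 hd (abs_nonneg _) zero_le_one
      nlinarith
    calc _ ≤ K * (3 * K * e) := mul_le_mul h2 a1 (abs_nonneg _) (by linarith)
      _ = _ := by ring
  have hden : η ^ 4 / 4 ≤ (p.2 * form w p) * (p'.2 * form w p') := by
    calc η ^ 4 / 4 = (η * η) * (η / 2 * (η / 2)) := by ring
      _ ≤ _ := by gcongr
  rw [eq, abs_div, abs_of_pos (mul_pos (mul_pos y0 l0) (mul_pos y0' l0'))]
  calc _ ≤ 3 * K ^ 2 * e / (η ^ 4 / 4) := by gcongr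
    _ = _ := by ring

theorem abs_integrand_sub_integrand_le {m : ℕ} {α : ℝ} (hα : 0 < α)
    (v : (Fin (m + 1) → ℤ) × (Fin (m + 1) → ℤ)) (p p' : ℝ × ℝ) {δ : ℝ} (hδ : 0 ≤ δ)
    (H : ∀ i, |h (pairs v i).1 (pairs v i).2 p - h (pairs v i).1 (pairs v i).2 p'| ≤ δ) :
    |integrand m α v.1 v.2 p - integrand m α v.1 v.2 p'| ≤
      (m + 2) * (Real.pi * α * (2 * δ)) := by
  have key := norm_chain_sub_chain_le (n := m + 1) (δ := Real.pi * α * (2 * δ))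
    (k := fun x y => (sincKernel α p x y : ℂ)) (k' := fun x y => (sincKernel α p' x y : ℂ))
    (1, 0) (1, 0) {w | |h w.1 w.2 p - h w.1 w.2 p'| ≤ δ}
    (by simpa [h_one_zero] using hδ) (by simpa [h_one_zero] using hδ)
    (fun x y => by
      rw [Complex.norm_real]; exact Real.abs_sinc_le_one _)
    (fun x y => by
      rw [Complex.norm_real]; exact Real.abs_sinc_le_one _)
    (fun x hx y hy => by
      rw [← Complex.ofReal_sub, Complex.norm_real, Real.norm_eq_abs]
      refine (abs_sinc_sub_sinc_le _ _).trans ?_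
      have e : Real.pi * α * h x.1 x.2 p - Real.pi * α * h y.1 y.2 p -
          (Real.pi * α * h x.1 x.2 p' - Real.pi * α * h y.1 y.2 p') =
          Real.pi * α * ((h x.1 x.2 p - h x.1 x.2 p') - (h y.1 y.2 p - h y.1 y.2 p')) := by ring
      have hx' : |h x.1 x.2 p - h x.1 x.2 p'| ≤ δ := hx
      have hy' : |h y.1 y.2 p - h y.1 y.2 p'| ≤ δ := hy
      rw [e, abs_mul, abs_of_pos (mul_pos Real.pi_pos hα)]
      refine mul_le_mul_of_nonneg_left ?_ (by positivity)
      exact (abs_sub _ _).trans (by linarith))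
    (pairs v) H
  have e : ∀ q, ((integrand m α v.1 v.2 q : ℝ) : ℂ) =
      chain (fun x y => (sincKernel α q x y : ℂ)) (1, 0) (1, 0) (pairs v) := fun q => by
    rw [integrand_eq_chain]
    exact map_chain Complex.ofRealHom _ _ _ _
  rw [← e, ← e, ← Complex.ofReal_sub, Complex.norm_real, Real.norm_eq_abs] at key
  refine key.trans (le_of_eq ?_)
  push_cast; ring

/-- All linear forms that bound the region. -/
def boundaryForms {k : ℕ} (v : (Fin k → ℤ) × (Fin k → ℤ)) : Fin (k + 2) → ℤ × ℤ :=
  Fin.cons (1, 0) (Fin.cons (1, 1) (pairs v) : Fin (k + 1) → ℤ × ℤ)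

theorem forall_boundaryForms {k : ℕ} {v : (Fin k → ℤ) × (Fin k → ℤ)} {P : ℤ × ℤ → Prop} :
    (∀ j, P (boundaryForms v j)) ↔ P (1, 0) ∧ P (1, 1) ∧ ∀ i, P (pairs v i) := by
  simp [boundaryForms, Fin.forall_fin_succ (n := k + 1), Fin.forall_fin_succ (n := k)]

/-- A form at distance more than η from both 0 and 1 cannot cross either value when it moves by at
most η/2. -/
theorem mem_region_iff_of_far {k : ℕ} {v : (Fin k → ℤ) × (Fin k → ℤ)} {p p' : ℝ × ℝ} {η : ℝ}
    (hη : 0 < η) (hp : 0 ≤ p.1) (hp' : 0 ≤ p'.1)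
    (hfar : ∀ j, η < |form (boundaryForms v j) p| ∧ η < |form (boundaryForms v j) p - 1|)
    (hnear : ∀ j, |form (boundaryForms v j) p' - form (boundaryForms v j) p| ≤ η / 2) :
    p ∈ region v.1 v.2 ↔ p' ∈ region v.1 v.2 := by
  have key : ∀ x x' : ℝ, (η < |x| ∧ η < |x - 1|) → |x' - x| ≤ η / 2 →
      ((0 ≤ x ↔ 0 ≤ x') ∧ (x ≤ 1 ↔ x' ≤ 1) ∧ (0 < x ↔ 0 < x')) := by
    rintro x x' ⟨h1, h2⟩ h3
    rw [abs_le] at h3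
    rw [lt_abs] at h1 h2
    refine ⟨⟨fun h => ?_, fun h => ?_⟩, ⟨fun h => ?_, fun h => ?_⟩, ⟨fun h => ?_, fun h => ?_⟩⟩ <;>
    rcases h1 with h1 | h1 <;> rcases h2 with h2 | h2 <;> linarith
  have hall := fun j => key _ _ (hfar j) (hnear j)
  obtain ⟨⟨-, k2, -⟩, ⟨k1, -, -⟩, k3⟩ := (forall_boundaryForms (v := v) (P := fun w =>
    (0 ≤ form w p ↔ 0 ≤ form w p') ∧ (form w p ≤ 1 ↔ form w p' ≤ 1) ∧
      (0 < form w p ↔ 0 < form w p'))).1 hall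
  rw [mem_region_iff, mem_region_iff, k1, k2]
  simp only [hp, hp', true_and]
  exact and_congr_right fun _ => and_congr_right fun _ => forall_congr' fun i => by
    rw [(k3 i).2.2, (k3 i).2.1]

theorem abs_indicator_integrand_le_one (m : ℕ) (α : ℝ)
    (v : (Fin (m + 1) → ℤ) × (Fin (m + 1) → ℤ)) (p : ℝ × ℝ) :
    |(region v.1 v.2).indicator (integrand m α v.1 v.2) p| ≤ 1 := by
  by_cases hp : p ∈ region v.1 v.2
  · rw [Set.indicator_of_mem hp]; exact abs_integrand_le_one _ _ _ _ _
  · rw [Set.indicator_of_notMem hp, abs_zero]; exact zero_le_one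

theorem abs_indicator_sub_le_of_far {m : ℕ} {α : ℝ} (hα : 0 < α) {K : ℝ} (hK : 1 ≤ K)
    {v : (Fin (m + 1) → ℤ) × (Fin (m + 1) → ℤ)}
    (hv : ∀ j, |((boundaryForms v j).1 : ℝ)| ≤ K ∧ |((boundaryForms v j).2 : ℝ)| ≤ K)
    {p p' : ℝ × ℝ} {e η : ℝ} (hη : 0 < η) (heη : 2 * K * e ≤ η / 2) (hp : 0 ≤ p.1)
    (hp' : 0 ≤ p'.1) (e1 : |p'.1 - p.1| ≤ e) (e2 : |p'.2 - p.2| ≤ e)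
    (hfar : ∀ j, η < |form (boundaryForms v j) p| ∧ η < |form (boundaryForms v j) p - 1|) :
    |(region v.1 v.2).indicator (integrand m α v.1 v.2) p' -
      (region v.1 v.2).indicator (integrand m α v.1 v.2) p| ≤
        (m + 2) * (Real.pi * α * (24 * K ^ 2 * e / η ^ 4)) := by
  have he : 0 ≤ e := (abs_nonneg _).trans e1
  have hnear : ∀ j, |form (boundaryForms v j) p' - form (boundaryForms v j) p| ≤ η / 2 :=
    fun j => (abs_form_sub_le (hv j).1 (hv j).2 e1 e2).trans heη
  have hiff := mem_region_iff_of_far hη hp hp' hfar hnear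
  by_cases hr : p ∈ region v.1 v.2
  · have hr' := hiff.1 hr
    rw [Set.indicator_of_mem hr, Set.indicator_of_mem hr', abs_sub_comm]
    obtain ⟨v0, -, vi⟩ := (forall_boundaryForms (v := v) (P := fun w =>
      |(w.1 : ℝ)| ≤ K ∧ |(w.2 : ℝ)| ≤ K)).1 hv
    obtain ⟨f0, -, fi⟩ := (forall_boundaryForms (v := v) (P := fun w =>
      η < |form w p| ∧ η < |form w p - 1|)).1 hfar
    obtain ⟨n0, -, ni⟩ := (forall_boundaryForms (v := v) (P := fun w =>
      |form w p' - form w p| ≤ η / 2)).1 hnear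
    have hy : 0 < p.2 := pos_of_mem_region hr
    have f10 : ∀ q, form (1, 0) q = q.2 := fun q => by simp [form]
    rw [f10, f10] at *
    rw [abs_of_pos hy] at f0
    refine (abs_integrand_sub_integrand_le hα v p p' (δ := 12 * K ^ 2 * e / η ^ 4)
      (by positivity) fun i => ?_).trans (le_of_eq (by ring))
    have hi := hr.2.2.2 i
    have hi' := hr'.2.2.2 i
    have fi1 := (fi i).1
    rw [abs_of_pos (show 0 < form (pairs v i) p from hi.1)] at fi1
    have nn := abs_le.1 (ni i)
    have n0' := abs_le.1 n0
    exact abs_h_sub_le hK (vi i).1 (vi i).2 hη e1 e2 f0.1.le hr.2.2.1 (by linarith)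
      fi1.le (by linarith) hi'.2
  · rw [Set.indicator_of_notMem hr, Set.indicator_of_notMem (fun hcon => hr (hiff.2 hcon)),
      sub_zero, abs_zero]
    positivity

theorem integral_strip_indicator_le {w : ℤ × ℤ} (hw : w.1 ≠ 0 ∨ w.2 ≠ 0) (c : ℝ) {η : ℝ}
    (hη : 0 ≤ η) :
    IntegrableOn ((strip w.1 w.2 c η).indicator fun _ => (1 : ℝ)) unitSquare ∧
    ∫ p in unitSquare, (strip w.1 w.2 c η).indicator (fun _ => (1 : ℝ)) p ≤ 2 * η := by
  have hm := measurableSet_strip w.1 w.2 c η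
  refine ⟨integrableOn_of_abs_le subset_rfl (measurable_const.indicator hm) (c := 1) fun p => ?_, ?_⟩
  · by_cases hp : p ∈ strip w.1 w.2 c η
    · rw [Set.indicator_of_mem hp, abs_one]
    · rw [Set.indicator_of_notMem hp, abs_zero]
      exact zero_le_one
  · rw [setIntegral_indicator hm, setIntegral_const, smul_eq_mul, mul_one]
    exact ENNReal.toReal_le_of_le_ofReal (by positivity) (volume_strip_le hw _ _)

theorem integral_indicator_region (m : ℕ) (α : ℝ) (v : (Fin (m + 1) → ℤ) × (Fin (m + 1) → ℤ)) :
    ∫ p, (region v.1 v.2).indicator (integrand m α v.1 v.2) p = regionIntegral m α v :=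
  integral_indicator (measurableSet_region _ _)

theorem abs_regionIntegral_le_one (m : ℕ) (α : ℝ) (v : (Fin (m + 1) → ℤ) × (Fin (m + 1) → ℤ)) :
    |regionIntegral m α v| ≤ 1 := by
  have := sum_setIntegral_le {v} (fun v p => |integrand m α v.1 v.2 p|)
    (fun v => (integrableOn_integrand m α v.1 v.2).abs) (Φ := fun _ => 1)
    (integrableOn_of_abs_le subset_rfl measurable_const fun _ => le_rfl) (fun p => by
      rw [Finset.sum_singleton, abs_indicator]
      exact abs_indicator_integrand_le_one m α v p)
  rw [Finset.sum_singleton, setIntegral_unitSquare_const] at this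
  exact (abs_regionIntegral_le m α v).trans this

theorem abs_riemannSum_region_sub_le {m : ℕ} {α : ℝ} (hα : 0 < α) {K : ℕ} (hK : 1 ≤ K)
    {v : (Fin (m + 1) → ℤ) × (Fin (m + 1) → ℤ)} (hv : v ∈ coprimeBox (m + 1) K) {e : ℝ}
    (he : 0 < e) (he1 : e ≤ 1) {J : ℕ} (hJ : 1 ≤ J * e) :
    |e ^ 2 * ∑ i ∈ Finset.range J, ∑ j ∈ Finset.range J,
        (region v.1 v.2).indicator (integrand m α v.1 v.2) ((i + 1) * e, (j + 1) * e) -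
      regionIntegral m α v| ≤ ((m + 3) * (Real.pi * α + 32)) * K * e ^ (1 / 5 : ℝ) := by
  obtain ⟨hvb, hvc⟩ := mem_coprimeBox.1 hv
  have hK1 : (1 : ℝ) ≤ K := by exact_mod_cast hK
  -- The exponent 1/5 balances two errors. Strips of half-width η around the boundary have area of
  -- order η, while off them the integrand varies by order K²e/η⁴. With η = 4Ks and s⁵ = e, both are
  -- O(Ks).
  set s := e ^ (1 / 5 : ℝ) with hs
  have hs0 : 0 < s := Real.rpow_pos_of_pos he _
  have hs5 : s ^ 5 = e := by
    rw [hs, ← Real.rpow_natCast, ← Real.rpow_mul he.le]; norm_num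
  have hs1 : s ≤ 1 := Real.rpow_le_one he.le he1 (by norm_num)
  set η := 4 * K * s with hη
  have hη0 : 0 < η := by positivity
  have heη : 2 * K * e ≤ η / 2 := by
    have : e ≤ s := by
      rw [← hs5]
      calc s ^ 5 = s * s ^ 4 := by ring
        _ ≤ s * 1 := by gcongr; exact pow_le_one₀ hs0.le hs1
        _ = s := mul_one s
    rw [hη]
    nlinarith
  set Λ := (m + 2) * (Real.pi * α * (24 * K ^ 2 * e / η ^ 4)) with hΛ
  have hΛ0 : 0 ≤ Λ := by positivity
  have hΛs : Λ ≤ (m + 2) * (Real.pi * α * s) := by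
    rw [hΛ]
    gcongr
    rw [div_le_iff₀ (by positivity), hη, ← hs5]
    have : (K : ℝ) ^ 2 ≤ K ^ 4 := pow_le_pow_right₀ hK1 (by norm_num)
    nlinarith [pow_pos hs0 5]
  have hbound : ∀ j, |((boundaryForms v j).1 : ℝ)| ≤ K ∧ |((boundaryForms v j).2 : ℝ)| ≤ K := by
    refine (forall_boundaryForms (v := v) (P := fun w => |(w.1 : ℝ)| ≤ K ∧ |(w.2 : ℝ)| ≤ K)).2 ?_
    refine ⟨by simpa using hK1, by simpa using hK1, fun i => ?_⟩
    exact ⟨by exact_mod_cast (hvb i).1, by exact_mod_cast (hvb i).2⟩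
  have hne : ∀ j, (boundaryForms v j).1 ≠ 0 ∨ (boundaryForms v j).2 ≠ 0 := by
    refine (forall_boundaryForms (v := v) (P := fun w => w.1 ≠ 0 ∨ w.2 ≠ 0)).2 ?_
    refine ⟨by simp, by simp, fun i => ?_⟩
    by_contra hcon
    push Not at hcon
    have := (hvc i).2
    simp only [pairs] at hcon
    simp [hcon.1, hcon.2] at this
  let b : Fin (m + 1 + 2) → ℝ → ℝ × ℝ → ℝ := fun j c =>
    (strip (boundaryForms v j).1 (boundaryForms v j).2 c η).indicator fun _ => 1
  have hb : ∀ j c, IntegrableOn (b j c) unitSquare ∧ ∫ p in unitSquare, b j c p ≤ 2 * η :=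
    fun j c => integral_strip_indicator_le (hne j) c hη0.le
  have hbadd : ∀ j, IntegrableOn (fun p => b j 0 p + b j 1 p) unitSquare :=
    fun j => (hb j 0).1.add (hb j 1).1
  have hb0 : ∀ j c p, 0 ≤ b j c p := fun j c p => Set.indicator_nonneg (fun _ _ => zero_le_one) _
  -- The oscillation over a mesh step is at most Λ away from the strips, and at most 2 on them.
  let G : ℝ × ℝ → ℝ := fun p => Λ + 2 * ∑ j, (b j 0 p + b j 1 p)
  have hG0 : ∀ p, 0 ≤ G p := fun p => by
    have : 0 ≤ ∑ j, (b j 0 p + b j 1 p) :=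
      Finset.sum_nonneg fun j _ => add_nonneg (hb0 j 0 p) (hb0 j 1 p)
    simp only [G]; positivity
  have hGi1 : IntegrableOn (fun p => ∑ j, (b j 0 p + b j 1 p)) unitSquare :=
    integrable_finsetSum _ fun j _ => hbadd j
  have hGi2 : IntegrableOn (fun _ : ℝ × ℝ => Λ) unitSquare :=
    integrableOn_of_abs_le subset_rfl measurable_const fun _ => le_rfl
  have hGi : IntegrableOn G unitSquare := hGi2.add (hGi1.const_mul 2)
  have hGint : ∫ p in unitSquare, G p ≤ Λ + 2 * ((m + 3) * (4 * η)) := by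
    simp only [G]
    rw [integral_add hGi2 (hGi1.const_mul 2), setIntegral_unitSquare_const, integral_const_mul,
      integral_finsetSum _ fun j _ => hbadd j]
    gcongr
    calc _ ≤ ∑ _j : Fin (m + 1 + 2), 4 * η := by
          refine Finset.sum_le_sum fun j _ => ?_
          rw [integral_add (hb j 0).1 (hb j 1).1]
          linarith [(hb j 0).2, (hb j 1).2]
      _ = _ := by
          rw [Finset.sum_const, Finset.card_univ, Fintype.card_fin, nsmul_eq_mul]
          push_cast; ring
  have key := abs_riemannSum_sub_integral_le
    (f := (region v.1 v.2).indicator (integrand m α v.1 v.2)) (g := unitSquare.indicator G)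
    ((measurable_integrand m α _ _).indicator (measurableSet_region _ _))
    (abs_indicator_integrand_le_one m α v)
    (fun p hp => Set.indicator_of_notMem (fun hr => hp (region_subset_unitSquare _ _ hr)) _)
    ((integrable_indicator_iff measurableSet_unitSquare).2 hGi)
    (fun p => Set.indicator_nonneg (fun p _ => hG0 p) p) he hJ (by
      intro p hp p' h1 h2 h3 h4
      rw [Set.indicator_of_mem hp]
      by_cases hfar : ∀ j, η < |form (boundaryForms v j) p| ∧ η < |form (boundaryForms v j) p - 1|
      · refine (abs_indicator_sub_le_of_far hα hK1 hbound hη0 heη hp.1.1 (hp.1.1.trans h1)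
          (by rw [abs_of_nonneg] <;> linarith) (by rw [abs_of_nonneg] <;> linarith) hfar).trans ?_
        have : 0 ≤ ∑ j, (b j 0 p + b j 1 p) :=
          Finset.sum_nonneg fun j _ => add_nonneg (hb0 j 0 p) (hb0 j 1 p)
        simp only [G]
        linarith
      · push Not at hfar
        obtain ⟨j, hj⟩ := hfar
        have hbad : 1 ≤ b j 0 p + b j 1 p := by
          by_cases h0 : η < |form (boundaryForms v j) p|
          · have : b j 1 p = 1 := Set.indicator_of_mem (show p ∈ strip _ _ 1 η from hj h0) _
            linarith [hb0 j 0 p]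
          · have : b j 0 p = 1 := Set.indicator_of_mem (show p ∈ strip _ _ 0 η by
              simpa [strip, form] using h0) _
            linarith [hb0 j 1 p]
        have hsum : 1 ≤ ∑ j, (b j 0 p + b j 1 p) := hbad.trans
          (Finset.single_le_sum (f := fun j => b j 0 p + b j 1 p)
            (fun j _ => add_nonneg (hb0 j 0 p) (hb0 j 1 p)) (Finset.mem_univ j))
        refine (abs_sub _ _).trans ?_
        have a1 := abs_indicator_integrand_le_one m α v p
        have a2 := abs_indicator_integrand_le_one m α v p'
        simp only [G]
        linarith)
  rw [integral_indicator_region, integral_indicator measurableSet_unitSquare] at key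
  refine key.trans (hGint.trans ?_)
  have hKs : s ≤ K * s := le_mul_of_one_le_left hs0.le hK1
  have hpa : 0 ≤ Real.pi * α := by positivity
  calc Λ + 2 * ((m + 3) * (4 * η)) ≤ (m + 2) * (Real.pi * α * s) + 2 * ((m + 3) * (4 * η)) := by
        gcongr
    _ ≤ (m + 3) * (Real.pi * α * (K * s)) + 2 * ((m + 3) * (4 * η)) := by
        gcongr
        norm_num
    _ = _ := by rw [hη]; ring

/-- The average over coprime lattice points of the sum over a box of vectors. -/
theorem exists_abs_average_coprimeBox_sub_le (m : ℕ) (γ₂ : ℝ) : ∃ C : ℝ, 0 < C ∧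
    ∀ α, 0 < α → α ≤ γ₂ → ∀ K : ℕ, 1 ≤ K → ∀ Q : ℕ, 1 ≤ Q →
      |((Q : ℝ) ^ 2)⁻¹ * ∑ x ∈ Finset.Icc 1 Q, ∑ q ∈ Finset.Icc 1 Q,
          (if Nat.Coprime x q then ∑ v ∈ coprimeBox (m + 1) K,
            (region v.1 v.2).indicator (integrand m α v.1 v.2) ((x : ℝ) / Q, (q : ℝ) / Q) else 0) -
        6 / Real.pi ^ 2 * ∑ v ∈ coprimeBox (m + 1) K, regionIntegral m α v| ≤
      C * (3 * K : ℝ) ^ (2 * m + 3) * (Q : ℝ) ^ (-(1 / 5) : ℝ) := by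
  obtain ⟨C₀, hC₀, H⟩ := exists_abs_coprime_average_sub_le
  refine ⟨C₀ * ((m + 3) * (Real.pi * |γ₂| + 32) + 1), by positivity,
    fun α hα hα2 K hK Q hQ => ?_⟩
  have hK1 : (1 : ℝ) ≤ K := by exact_mod_cast hK
  set D := (m + 3) * (Real.pi * |γ₂| + 32) with hD
  have hD0 : 0 < D := by positivity
  have e1 : ∀ x q : ℕ, (if Nat.Coprime x q then ∑ v ∈ coprimeBox (m + 1) K,
      (region v.1 v.2).indicator (integrand m α v.1 v.2) ((x : ℝ) / Q, (q : ℝ) / Q) else 0) =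
      ∑ v ∈ coprimeBox (m + 1) K, (if Nat.Coprime x q then
        (region v.1 v.2).indicator (integrand m α v.1 v.2) ((x : ℝ) / Q, (q : ℝ) / Q) else 0) := by
    intro x q
    split_ifs <;> simp
  simp only [e1]
  rw [Finset.sum_congr rfl fun x _ => Finset.sum_comm, Finset.sum_comm, Finset.mul_sum,
    Finset.mul_sum, ← Finset.sum_sub_distrib]
  refine (Finset.abs_sum_le_sum_abs _ _).trans ?_
  have hQ0 : (0 : ℝ) ≤ (Q : ℝ) ^ (-(1 / 5) : ℝ) := by positivity
  calc _ ≤ ∑ v ∈ coprimeBox (m + 1) K, C₀ * (D * K + 1) * (Q : ℝ) ^ (-(1 / 5) : ℝ) := by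
        refine Finset.sum_le_sum fun v hv => ?_
        have key := H ((region v.1 v.2).indicator (integrand m α v.1 v.2)) (regionIntegral m α v)
          (D * K) (by positivity)
          (fun p hp => Set.indicator_of_notMem (fun hr => by
            have := region_subset_unitSquare _ _ hr
            rcases hp with hp | hp
            · exact absurd this.1.2 (not_le.2 hp)
            · exact absurd this.2.2 (not_le.2 hp)) _)
          (fun e J he he1 hJ => (abs_riemannSum_region_sub_le hα hK hv he he1 hJ).trans (by
            have := hα2.trans (le_abs_self γ₂)
            rw [hD]
            gcongr)) Q hQ
        refine key.trans ?_
        gcongr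
        exact abs_regionIntegral_le_one m α v
    _ = (coprimeBox (m + 1) K).card * (C₀ * (D * K + 1) * (Q : ℝ) ^ (-(1 / 5) : ℝ)) := by
        rw [Finset.sum_const, nsmul_eq_mul]
    -- The box has at most (2K+1)^(2(m+1)) vectors, and the error for each is linear in K; this
    -- accounts for the exponent 2m + 3.
    _ ≤ (3 * K : ℝ) ^ (2 * (m + 1)) * (C₀ * ((D + 1) * (3 * K)) * (Q : ℝ) ^ (-(1 / 5) : ℝ)) := by
        have hcard : ((coprimeBox (m + 1) K).card : ℝ) ≤ (3 * K : ℝ) ^ (2 * (m + 1)) := by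
          calc ((coprimeBox (m + 1) K).card : ℝ) ≤ (2 * K + 1 : ℝ) ^ (2 * (m + 1)) := by
                exact_mod_cast card_coprimeBox_le (m + 1) K
            _ ≤ _ := by gcongr; linarith
        gcongr
        nlinarith
    _ = _ := by ring

/-! ### Farey fractions as coprime lattice points. -/

theorem exists_modular_inverse {a : ℤ} {q : ℕ} (hq : 1 ≤ q) (h : IsCoprime a (q : ℤ)) :
    ∃ x : ℕ, 1 ≤ x ∧ x ≤ q ∧ (q : ℤ) ∣ a * x - 1 := by
  obtain ⟨u, v, huv⟩ := h
  have hq0 : (0 : ℤ) < q := by exact_mod_cast hq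
  have h0 := Int.emod_nonneg (u - 1) hq0.ne'
  have h1 := Int.emod_lt_of_pos (u - 1) hq0
  -- The shift by one selects the residue in [1, q] instead of [0, q - 1]; it matters for q = 1.
  refine ⟨((u - 1) % q + 1).toNat, by omega, by omega, ?_⟩
  rw [Int.toNat_of_nonneg (by omega)]
  refine ⟨-v - a * ((u - 1) / q), ?_⟩
  have h2 := Int.mul_ediv_add_emod (u - 1) q
  linear_combination huv + a * h2

theorem modular_inverse_unique {a : ℤ} {q x x' : ℕ} (h : IsCoprime a (q : ℤ)) (h1 : 1 ≤ x)
    (hx : x ≤ q) (h1' : 1 ≤ x') (hx' : x' ≤ q) (hd : (q : ℤ) ∣ a * x - 1)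
    (hd' : (q : ℤ) ∣ a * x' - 1) : x = x' := by
  have h3 : (q : ℤ) ∣ a * ((x : ℤ) - x') := by
    have := dvd_sub hd hd'
    rwa [show a * x - 1 - (a * x' - 1) = a * ((x : ℤ) - x') by ring] at this
  have h4 : (q : ℤ) ∣ (x : ℤ) - x' := h.symm.dvd_of_dvd_mul_left h3
  have h5 : |(x : ℤ) - x'| < q := by rw [abs_lt]; omega
  have := Int.eq_zero_of_abs_lt_dvd h4 h5
  omega

theorem isCoprime_num_den (θ : ℚ) : IsCoprime θ.num (θ.den : ℤ) := by
  rw [Int.isCoprime_iff_gcd_eq_one]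
  exact θ.reduced

/-- The inverse of the numerator modulo the denominator, in `[1, den]`. -/
def fareyInv (θ : ℚ) : ℕ :=
  (exists_modular_inverse θ.den_pos (isCoprime_num_den θ)).choose

theorem fareyInv_spec (θ : ℚ) :
    1 ≤ fareyInv θ ∧ fareyInv θ ≤ θ.den ∧ (θ.den : ℤ) ∣ θ.num * fareyInv θ - 1 :=
  (exists_modular_inverse θ.den_pos (isCoprime_num_den θ)).choose_spec

theorem isCoprime_of_dvd_mul_sub_one {a x q : ℤ} (h : q ∣ a * x - 1) : IsCoprime x q := by
  obtain ⟨c, hc⟩ := h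
  exact ⟨a, -c, by linear_combination hc⟩

theorem num_le_den_of_mem_farey {Q : ℕ} {θ : ℚ} (hθ : θ ∈ farey Q) :
    1 ≤ θ.num ∧ θ.num ≤ θ.den := by
  obtain ⟨h0, h1, -⟩ := mem_farey.1 hθ
  have h2 := Rat.num_pos.2 h0
  refine ⟨by omega, ?_⟩
  have h3 : (θ.num : ℚ) / (θ.den : ℚ) ≤ 1 := by rw [Rat.num_div_den]; exact h1
  have hd0 : (0 : ℚ) < θ.den := by exact_mod_cast θ.den_pos
  rw [div_le_one hd0] at h3
  exact_mod_cast h3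

/-- Inversion modulo the denominator is an involution, and the numerator is determined by its
residue in [1, den]. -/
theorem fareyInv_injOn (Q : ℕ) :
    Set.InjOn (fun θ : ℚ => (fareyInv θ, θ.den)) (farey Q : Set ℚ) := by
  intro θ hθ θ' hθ' heq
  obtain ⟨h1, h2⟩ := Prod.mk.injEq _ _ _ _ ▸ heq
  have a1 := num_le_den_of_mem_farey (Finset.mem_coe.1 hθ)
  have a2 := num_le_den_of_mem_farey (Finset.mem_coe.1 hθ')
  have s1 := (fareyInv_spec θ).2.2
  have s2 := (fareyInv_spec θ').2.2
  rw [← h1, ← h2, mul_comm] at s2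
  rw [mul_comm] at s1
  have e1 : ((θ.num.toNat : ℕ) : ℤ) = θ.num := Int.toNat_of_nonneg (by omega)
  have e2 : ((θ'.num.toNat : ℕ) : ℤ) = θ'.num := Int.toNat_of_nonneg (by omega)
  rw [← e1] at s1
  rw [← e2] at s2
  have := modular_inverse_unique (a := (fareyInv θ : ℤ)) (q := θ.den)
    (isCoprime_of_dvd_mul_sub_one (a := θ.num) (by rw [mul_comm, ← e1]; exact s1)) (by omega)
    (by omega) (by omega) (by omega) s1 s2
  refine Rat.ext ?_ h2
  omega

/-- The map (fareyInv θ, den θ) is a bijection from F_Q onto the coprime pairs x ≤ q ≤ Q; the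
remaining pairs on the right contribute nothing by `hG`. -/
theorem sum_farey_eq (Q : ℕ) (G : ℕ → ℕ → ℝ) (hG : ∀ x q, q < x → G x q = 0) :
    ∑ θ ∈ farey Q, G (fareyInv θ) θ.den =
      ∑ x ∈ Finset.Icc 1 Q, ∑ q ∈ Finset.Icc 1 Q, if Nat.Coprime x q then G x q else 0 := by
  rw [← Finset.sum_product', ← Finset.sum_filter,
    ← Finset.sum_image (f := fun p : ℕ × ℕ => G p.1 p.2) (fareyInv_injOn Q)]
  refine Finset.sum_subset ?_ ?_
  · intro p hp
    obtain ⟨θ, hθ, rfl⟩ := Finset.mem_image.1 hp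
    obtain ⟨-, -, hd⟩ := mem_farey.1 hθ
    obtain ⟨s1, s2, s3⟩ := fareyInv_spec θ
    simp only [Finset.mem_filter, Finset.mem_product, Finset.mem_Icc]
    refine ⟨⟨⟨s1, by omega⟩, θ.den_pos, hd⟩, ?_⟩
    exact Nat.isCoprime_iff_coprime.1 (isCoprime_of_dvd_mul_sub_one s3)
  · rintro ⟨x, q⟩ hp hnot
    simp only [Finset.mem_filter, Finset.mem_product, Finset.mem_Icc] at hp
    obtain ⟨⟨⟨hx1, hxQ⟩, hq1, hqQ⟩, hcop⟩ := hp
    refine hG x q ?_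
    by_contra hle
    refine hnot (Finset.mem_image.2 ?_)
    obtain ⟨a, ha1, haq, hdvd⟩ := exists_modular_inverse hq1 (Nat.isCoprime_iff_coprime.2 hcop)
    have hac : IsCoprime (a : ℤ) (q : ℤ) := isCoprime_of_dvd_mul_sub_one hdvd
    have hq0 : (0 : ℚ) < q := by exact_mod_cast hq1
    have hnum : ((a : ℤ) / (q : ℤ) : ℚ).num = a :=
      Rat.num_div_eq_of_coprime (by exact_mod_cast hq1) (by
        simpa using Nat.isCoprime_iff_coprime.1 hac)
    have hden : (((a : ℤ) / (q : ℤ) : ℚ).den : ℤ) = q :=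
      Rat.den_div_eq_of_coprime (by exact_mod_cast hq1) (by
        simpa using Nat.isCoprime_iff_coprime.1 hac)
    set θ : ℚ := (a : ℤ) / (q : ℤ) with hθ
    have hden' : θ.den = q := by exact_mod_cast hden
    refine ⟨θ, mem_farey.2 ⟨?_, ?_, by omega⟩, ?_⟩
    · exact Rat.num_pos.1 (by omega)
    · rw [hθ, Int.cast_natCast, Int.cast_natCast, div_le_one hq0]; exact_mod_cast haq
    · obtain ⟨s1, s2, s3⟩ := fareyInv_spec θ
      rw [hden'] at s2 s3
      rw [hnum] at s3
      rw [mul_comm] at hdvd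
      have := modular_inverse_unique hac s1 s2 hx1 (not_lt.1 hle) s3 hdvd
      rw [this, hden']

theorem sum_farey_le (Q : ℕ) (G : ℕ → ℕ → ℝ) (hG : ∀ x q, 0 ≤ G x q) :
    ∑ θ ∈ farey Q, G (fareyInv θ) θ.den ≤
      ∑ x ∈ Finset.Icc 1 Q, ∑ q ∈ Finset.Icc 1 Q, G x q := by
  rw [← Finset.sum_product',
    ← Finset.sum_image (f := fun p : ℕ × ℕ => G p.1 p.2) (fareyInv_injOn Q)]
  refine Finset.sum_le_sum_of_subset_of_nonneg ?_ fun _ _ _ => hG _ _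
  intro p hp
  obtain ⟨θ, hθ, rfl⟩ := Finset.mem_image.1 hp
  obtain ⟨-, -, hd⟩ := mem_farey.1 hθ
  obtain ⟨s1, s2, -⟩ := fareyInv_spec θ
  simp only [Finset.mem_product, Finset.mem_Icc]
  exact ⟨⟨s1, by omega⟩, θ.den_pos, hd⟩

/-- The point of the triangle attached to a Farey fraction. -/
def fareyPoint (Q : ℕ) (θ : ℚ) : ℝ × ℝ := ((fareyInv θ : ℝ) / Q, (θ.den : ℝ) / Q)

/-! ### Coordinates around a Farey fraction. -/

/-- The representative of `θ` modulo `1` that is nearest to `θ₀`. -/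
def nearLift (θ₀ θ : ℚ) : ℚ := θ - round (θ - θ₀)

/-- The coordinates of the nearest representative in the basis attached to `θ₀`. -/
def fareyPair (θ₀ θ : ℚ) : ℤ × ℤ :=
  ((nearLift θ₀ θ).num * fareyInv θ₀ -
      (nearLift θ₀ θ).den * ((θ₀.num * fareyInv θ₀ - 1) / θ₀.den),
    (nearLift θ₀ θ).num * θ₀.den - (nearLift θ₀ θ).den * θ₀.num)

/-- The change of basis is unimodular; it therefore preserves primitive vectors and can be inverted
over the integers. -/
theorem fareyInv_det (θ₀ : ℚ) :
    θ₀.num * fareyInv θ₀ - (θ₀.num * fareyInv θ₀ - 1) / θ₀.den * θ₀.den = 1 := by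
  rw [Int.ediv_mul_cancel (fareyInv_spec θ₀).2.2]; ring

theorem nearLift_self (θ₀ : ℚ) : nearLift θ₀ θ₀ = θ₀ := by simp [nearLift]

theorem fareyPair_self (θ₀ : ℚ) : fareyPair θ₀ θ₀ = (1, 0) := by
  have := fareyInv_det θ₀
  unfold fareyPair
  rw [nearLift_self]
  refine Prod.ext ?_ ?_
  · simp only; linear_combination this
  · simp only; ring

theorem nearLift_den (θ₀ θ : ℚ) : (nearLift θ₀ θ).den = θ.den := by
  rw [nearLift, Rat.sub_intCast_den]

theorem form_fareyPair (Q : ℕ) (θ₀ θ : ℚ) :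
    form (fareyPair θ₀ θ) (fareyPoint Q θ₀) = (θ.den : ℝ) / Q := by
  have h1 := fareyInv_det θ₀
  have h2 : (fareyPair θ₀ θ).1 * θ₀.den - (fareyPair θ₀ θ).2 * fareyInv θ₀ = θ.den := by
    rw [← nearLift_den θ₀ θ]
    simp only [fareyPair]
    linear_combination (nearLift θ₀ θ).den * h1
  have h3 : ((fareyPair θ₀ θ).1 : ℝ) * θ₀.den - (fareyPair θ₀ θ).2 * fareyInv θ₀ = θ.den := by
    exact_mod_cast h2
  simp only [form, fareyPoint]
  rw [← h3]; ring

theorem fareyPoint_mem {Q : ℕ} {θ₀ : ℚ} (hθ₀ : θ₀ ∈ farey Q) :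
    0 ≤ (fareyPoint Q θ₀).1 ∧ (fareyPoint Q θ₀).1 ≤ (fareyPoint Q θ₀).2 ∧
      0 < (fareyPoint Q θ₀).2 ∧ (fareyPoint Q θ₀).2 ≤ 1 := by
  obtain ⟨-, -, hd⟩ := mem_farey.1 hθ₀
  have hd0 := θ₀.den_pos
  have hQ : (0 : ℝ) < Q := by exact_mod_cast hd0.trans_le hd
  have hd0' : (0 : ℝ) < θ₀.den := by exact_mod_cast hd0
  have h1 : (fareyInv θ₀ : ℝ) ≤ θ₀.den := by exact_mod_cast (fareyInv_spec θ₀).2.1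
  simp only [fareyPoint]
  refine ⟨by positivity, by gcongr, by positivity, ?_⟩
  rw [div_le_one hQ]
  exact_mod_cast hd

theorem fareyPair_mem_admissible {Q : ℕ} (θ₀ : ℚ) {θ : ℚ} (hθ : θ ∈ farey Q) :
    fareyPair θ₀ θ ∈ admissible (fareyPoint Q θ₀) := by
  obtain ⟨-, -, hd⟩ := mem_farey.1 hθ
  have hd0 := θ.den_pos
  have hQ : (0 : ℝ) < Q := by exact_mod_cast hd0.trans_le hd
  have hd0' : (0 : ℝ) < θ.den := by exact_mod_cast hd0
  have hf := form_fareyPair Q θ₀ θ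
  refine ⟨?_, ?_, ?_⟩
  · rw [← Int.isCoprime_iff_gcd_eq_one]
    obtain ⟨u, v, huv⟩ := isCoprime_num_den (nearLift θ₀ θ)
    have h1 := fareyInv_det θ₀
    set b := (θ₀.num * fareyInv θ₀ - 1) / θ₀.den
    refine ⟨u * θ₀.num + v * θ₀.den, -(u * b + v * fareyInv θ₀), ?_⟩
    simp only [fareyPair]
    linear_combination huv + (u * (nearLift θ₀ θ).num + v * (nearLift θ₀ θ).den) * h1
  · change 0 < form _ _
    rw [hf]; positivity
  · change form _ _ ≤ 1
    rw [hf, div_le_one hQ]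
    exact_mod_cast hd

/-- The second entry B is the determinant of the two fractions, so their difference is B over the
product of denominators, and y(Ay - Bx) is that product divided by Q². -/
theorem h_fareyPair {Q : ℕ} (hQ : 1 ≤ Q) (θ₀ θ : ℚ) :
    h (fareyPair θ₀ θ).1 (fareyPair θ₀ θ).2 (fareyPoint Q θ₀) =
      (Q : ℝ) ^ 2 * ((nearLift θ₀ θ : ℝ) - θ₀) := by
  have hQ0 : (Q : ℝ) ≠ 0 := by exact_mod_cast (by omega : Q ≠ 0)
  have hd : (θ₀.den : ℝ) ≠ 0 := by exact_mod_cast θ₀.den_pos.ne'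
  have hd' : ((nearLift θ₀ θ).den : ℝ) ≠ 0 := by exact_mod_cast (nearLift θ₀ θ).den_pos.ne'
  have e1 : h (fareyPair θ₀ θ).1 (fareyPair θ₀ θ).2 (fareyPoint Q θ₀) =
      ((fareyPair θ₀ θ).2 : ℝ) / ((fareyPoint Q θ₀).2 *
        form (fareyPair θ₀ θ) (fareyPoint Q θ₀)) := rfl
  rw [e1, form_fareyPair, ← nearLift_den θ₀ θ, Rat.cast_def (nearLift θ₀ θ), Rat.cast_def θ₀]
  simp only [fareyPair, fareyPoint]
  push_cast
  field_simp

theorem nearLift_sub_eq (θ₀ θ : ℚ) : (nearLift θ₀ θ : ℝ) - θ₀ =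
    ((θ : ℝ) - θ₀) - round ((θ : ℝ) - θ₀) := by
  have : round ((θ : ℝ) - θ₀) = round (θ - θ₀) := by
    rw [← Rat.cast_sub, Rat.round_cast]
  rw [this, nearLift]
  push_cast; ring

theorem eq_of_mem_farey_of_sub_eq_intCast {Q : ℕ} {θ θ' : ℚ} (hθ : θ ∈ farey Q)
    (hθ' : θ' ∈ farey Q) {k : ℤ} (hk : θ - θ' = k) : θ = θ' := by
  obtain ⟨h0, h1, -⟩ := mem_farey.1 hθ
  obtain ⟨h0', h1', -⟩ := mem_farey.1 hθ'
  have a1 : (k : ℚ) < 1 := by linarith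
  have a2 : (-1 : ℚ) < k := by linarith
  have b1 : k < 1 := by exact_mod_cast a1
  have b2 : -1 < k := by exact_mod_cast a2
  have : k = 0 := by omega
  rw [this] at hk
  simpa [sub_eq_zero] using hk

/-- The value of `h` recovers the nearest lift, and two fractions in (0, 1] that agree modulo 1 are
equal. -/
theorem fareyPair_injOn {Q : ℕ} (hQ : 1 ≤ Q) (θ₀ : ℚ) :
    Set.InjOn (fareyPair θ₀) (farey Q : Set ℚ) := by
  intro θ hθ θ' hθ' heq
  have h1 := h_fareyPair hQ θ₀ θ
  rw [heq, h_fareyPair hQ θ₀ θ'] at h1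
  have hQ0 : (Q : ℝ) ^ 2 ≠ 0 := pow_ne_zero _ (by exact_mod_cast (by omega : Q ≠ 0))
  have h2 := mul_left_cancel₀ hQ0 h1
  have h3 : (nearLift θ₀ θ' : ℝ) = nearLift θ₀ θ := by linarith
  have h4 : nearLift θ₀ θ' = nearLift θ₀ θ := by exact_mod_cast h3
  refine eq_of_mem_farey_of_sub_eq_intCast (Finset.mem_coe.1 hθ) (Finset.mem_coe.1 hθ')
    (k := round (θ - θ₀) - round (θ' - θ₀)) ?_
  unfold nearLift at h4
  push_cast
  linarith

/-- Applying the inverse matrix to `w` gives a fraction P/r with 0 < r ≤ Q. The bound |h| < Q²/2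
puts it within 1/2 of θ₀, so it is the nearest lift of its class. -/
theorem exists_fareyPair_eq {Q : ℕ} (hQ : 1 ≤ Q) {θ₀ : ℚ} (hθ₀ : θ₀ ∈ farey Q) {w : ℤ × ℤ}
    (hw : w ∈ admissible (fareyPoint Q θ₀))
    (hH : |h w.1 w.2 (fareyPoint Q θ₀)| < (Q : ℝ) ^ 2 / 2) :
    ∃ θ ∈ farey Q, fareyPair θ₀ θ = w := by
  have hQ0 : (0 : ℝ) < Q := by exact_mod_cast hQ
  have hdet := fareyInv_det θ₀
  set b := (θ₀.num * fareyInv θ₀ - 1) / θ₀.den with hb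
  set P : ℤ := w.1 * θ₀.num - w.2 * b with hP
  set r : ℤ := w.1 * θ₀.den - w.2 * fareyInv θ₀ with hr
  have hform : form w (fareyPoint Q θ₀) = (r : ℝ) / Q := by
    simp only [form, fareyPoint, hr]; push_cast; ring
  have hpos : 0 < form w (fareyPoint Q θ₀) := hw.2.1
  have hle : form w (fareyPoint Q θ₀) ≤ 1 := hw.2.2
  rw [hform] at hpos hle
  have hr0' : (0 : ℝ) < r := by
    by_contra hcon
    exact absurd hpos (not_lt.2 (div_nonpos_of_nonpos_of_nonneg (not_lt.1 hcon) hQ0.le))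
  have hr0 : 0 < r := by exact_mod_cast hr0'
  rw [div_le_one hQ0] at hle
  have hrQ : r ≤ Q := by exact_mod_cast hle
  set ρ : ℚ := (P : ℚ) / (r : ℚ) with hρ
  -- Ceiling minus one, rather than the floor, translates into (0, 1].
  set θ : ℚ := ρ - (⌈ρ⌉ - 1 : ℤ) with hθ
  have hden : (ρ.den : ℤ) ∣ r := by
    have := Rat.den_dvd P r
    rwa [Rat.divInt_eq_div] at this
  have hmem : θ ∈ farey Q := by
    refine mem_farey.2 ⟨?_, ?_, ?_⟩
    · have := Int.ceil_lt_add_one ρ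
      rw [hθ]; push_cast; linarith
    · have := Int.le_ceil ρ
      rw [hθ]; push_cast; linarith
    · rw [hθ, Rat.sub_intCast_den]
      have := Int.le_of_dvd hr0 hden
      omega
  have hd0 : (0 : ℝ) < θ₀.den := by exact_mod_cast θ₀.den_pos
  have hdiff : h w.1 w.2 (fareyPoint Q θ₀) = (Q : ℝ) ^ 2 * ((ρ : ℝ) - θ₀) := by
    have e1 : h w.1 w.2 (fareyPoint Q θ₀) =
        (w.2 : ℝ) / ((fareyPoint Q θ₀).2 * form w (fareyPoint Q θ₀)) := rfl
    have e2 : (w.2 : ℝ) = P * θ₀.den - r * θ₀.num := by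
      have : w.2 = P * θ₀.den - r * θ₀.num := by
        rw [hP, hr]; linear_combination (-w.2) * hdet
      exact_mod_cast this
    rw [e1, hform, e2, hρ, Rat.cast_def θ₀]
    simp only [fareyPoint]
    push_cast
    field_simp
  have hsmall : |(ρ : ℝ) - θ₀| < 1 / 2 := by
    rw [hdiff, abs_mul, abs_of_pos (by positivity : (0 : ℝ) < (Q : ℝ) ^ 2)] at hH
    have : (0 : ℝ) < (Q : ℝ) ^ 2 := by positivity
    by_contra hcon
    nlinarith [not_lt.1 hcon]
  have hsmall' : |ρ - θ₀| < 1 / 2 := by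
    have : |((ρ - θ₀ : ℚ) : ℝ)| < ((1 / 2 : ℚ) : ℝ) := by push_cast; exact hsmall
    exact_mod_cast this
  have hround : round (θ - θ₀) = -(⌈ρ⌉ - 1) := by
    rw [hθ, show ρ - ((⌈ρ⌉ - 1 : ℤ) : ℚ) - θ₀ = (ρ - θ₀) - ((⌈ρ⌉ - 1 : ℤ) : ℚ) by ring,
      round_sub_intCast]
    have : round (ρ - θ₀) = 0 := by
      rw [round_eq_zero_iff]
      rw [abs_lt] at hsmall'
      exact ⟨hsmall'.1.le, hsmall'.2⟩
    omega
  have hlift : nearLift θ₀ θ = ρ := by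
    rw [nearLift, hround, hθ]; push_cast; ring
  refine ⟨θ, hmem, ?_⟩
  -- Both pairs are admissible and have the same value of `h`, so separation forces equality;
  -- coprimality of P and r need not be checked.
  by_contra hne
  have h1 := one_le_hdist (fareyPoint_mem hθ₀).2.2.1 (fareyPair_mem_admissible θ₀ hmem) hw hne
  rw [hdist, h_fareyPair hQ, hlift, hdiff, sub_self, abs_zero] at h1
  norm_num at h1

/-! ### The scaled circle distance on Farey fractions. -/

/-- The scaled circle distance. -/
def fareyDist (Q : ℕ) (θ θ' : ℚ) : ℝ :=
  (Q : ℝ) ^ 2 * |((θ : ℝ) - θ') - round ((θ : ℝ) - θ')|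

theorem fareyDist_eq (Q : ℕ) (θ θ' : ℚ) :
    fareyDist Q θ θ' = (Q : ℝ) ^ 2 * ‖(((θ : ℝ) - θ' : ℝ) : UnitAddCircle)‖ := by
  rw [fareyDist, UnitAddCircle.norm_eq]

theorem fareyDist_nonneg (Q : ℕ) (θ θ' : ℚ) : 0 ≤ fareyDist Q θ θ' := by
  unfold fareyDist; positivity

theorem fareyDist_comm (Q : ℕ) (θ θ' : ℚ) : fareyDist Q θ θ' = fareyDist Q θ' θ := by
  rw [fareyDist_eq, fareyDist_eq, ← norm_neg, ← AddCircle.coe_neg, neg_sub]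

theorem fareyDist_triangle (Q : ℕ) (θ θ' θ'' : ℚ) :
    fareyDist Q θ θ'' ≤ fareyDist Q θ θ' + fareyDist Q θ' θ'' := by
  simp only [fareyDist_eq]
  rw [← mul_add]
  refine mul_le_mul_of_nonneg_left ?_ (by positivity)
  have : (((θ : ℝ) - θ'' : ℝ) : UnitAddCircle) =
      (((θ : ℝ) - θ' : ℝ) : UnitAddCircle) + (((θ' : ℝ) - θ'' : ℝ) : UnitAddCircle) := by
    rw [← AddCircle.coe_add]; congr 1; ring
  rw [this]
  exact norm_add_le _ _

theorem fareyDist_eq_abs_h {Q : ℕ} (hQ : 1 ≤ Q) (θ₀ θ : ℚ) :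
    fareyDist Q θ θ₀ = |h (fareyPair θ₀ θ).1 (fareyPair θ₀ θ).2 (fareyPoint Q θ₀)| := by
  rw [h_fareyPair hQ, nearLift_sub_eq, abs_mul, abs_of_nonneg (by positivity : (0:ℝ) ≤ (Q:ℝ) ^ 2)]
  rfl

/-- In the coordinates centred at `b` the distance to `b` is |h|, so the separation of admissible
pairs applies. -/
theorem exists_sum_fareyDist_rpow_le {r : ℝ} (hr : 1 < r) : ∃ C : ℝ, 0 < C ∧
    ∀ Q : ℕ, 1 ≤ Q → ∀ S ⊆ farey Q, ∀ b ∈ farey Q,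
      ∑ c ∈ S, (1 + fareyDist Q c b) ^ (-r) ≤ C := by
  classical
  obtain ⟨C, hC, H⟩ := exists_sum_hdist_rpow_le hr
  refine ⟨C, hC, fun Q hQ S hS b hb => ?_⟩
  have key := H (fareyPoint Q b) (fareyPoint_mem hb).2.2.1 (S.image (fareyPair b)) (fun w hw => by
    obtain ⟨θ, hθ, rfl⟩ := Finset.mem_image.1 hw
    exact fareyPair_mem_admissible b (hS hθ)) (1, 0)
  rw [Finset.sum_image ((fareyPair_injOn hQ b).mono fun x hx => hS hx)] at key
  refine le_trans (le_of_eq (Finset.sum_congr rfl fun c _ => ?_)) key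
  rw [fareyDist_eq_abs_h hQ, hdist, h_one_zero, sub_zero]

/-! ### The moment as a sum over closed paths. -/

/-- The kernel `N⁻¹ ∑_{n ≤ N} e(n (θ - θ'))`. -/
def expKernel (N : ℕ) (θ θ' : ℚ) : ℂ := expMean N ((θ : ℝ) - θ')

theorem matrix_pow_apply_eq_sum_chain {ι : Type*} [DecidableEq ι] {S : Finset ι} (k : ι → ι → ℂ)
    (n : ℕ) (i j : S) :
    ((Matrix.of fun x y : S => k x y) ^ (n + 1)) i j =
      ∑ v ∈ Fintype.piFinset (fun _ : Fin n => S), chain k (i : ι) j v := by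
  induction n generalizing i with
  | zero => simp [chain_zero]
  | succ n ih =>
    rw [pow_succ', Matrix.mul_apply, sum_piFinset_cons, ← Finset.sum_coe_sort S]
    refine Finset.sum_congr rfl fun c _ => ?_
    simp only [ih, chain_cons, Matrix.of_apply, Finset.mul_sum]

theorem conjTranspose_mul_pow_mul {ι κ : Type*} [Fintype ι] [Fintype κ] [DecidableEq ι]
    [DecidableEq κ] (A : Matrix ι κ ℂ) (n : ℕ) : (Aᴴ * A) ^ n * Aᴴ = Aᴴ * (A * Aᴴ) ^ n := by
  induction n with
  | zero => simp
  | succ n ih =>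
    rw [pow_succ', Matrix.mul_assoc, ih, pow_succ']
    simp only [Matrix.mul_assoc]

/-- This passes from the matrix indexed by 1 ≤ n ≤ N to the one indexed by Farey fractions, whose
entries are exponential means. -/
theorem trace_conjTranspose_mul_pow {ι κ : Type*} [Fintype ι] [Fintype κ] [DecidableEq ι]
    [DecidableEq κ] (A : Matrix ι κ ℂ) (n : ℕ) :
    ((Aᴴ * A) ^ (n + 1)).trace = ((A * Aᴴ) ^ (n + 1)).trace := by
  rw [pow_succ, ← Matrix.mul_assoc, conjTranspose_mul_pow_mul, Matrix.mul_assoc,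
    Matrix.trace_mul_comm, Matrix.mul_assoc, ← pow_succ]

theorem smul_sieveMatrix_mul_conjTranspose (Q N : ℕ) :
    (N : ℂ)⁻¹ • (sieveMatrix Q N * (sieveMatrix Q N)ᴴ) =
      Matrix.of fun x y : farey Q => expKernel N x y := by
  ext θ θ'
  simp only [Matrix.smul_apply, Matrix.mul_apply, Matrix.conjTranspose_apply, sieveMatrix,
    Matrix.of_apply, expKernel, expMean, smul_eq_mul]
  congr 1
  refine Finset.sum_congr rfl fun n _ => ?_
  rw [Complex.star_def, ← Complex.exp_conj, ← Complex.exp_add]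
  congr 1
  simp only [map_mul, map_add, map_one, Complex.conj_ofReal, Complex.conj_I, map_natCast,
    map_ofNat, map_ratCast]
  push_cast
  ring

theorem moment_eq_sum_chain (m Q N : ℕ) :
    moment (m + 2) Q N = (N : ℂ)⁻¹ * ∑ θ₀ ∈ farey Q,
      ∑ v ∈ Fintype.piFinset (fun _ : Fin (m + 1) => farey Q), chain (expKernel N) θ₀ θ₀ v := by
  unfold moment
  rw [smul_pow, Matrix.trace_smul, trace_conjTranspose_mul_pow, ← Matrix.trace_smul, ← smul_pow,
    smul_sieveMatrix_mul_conjTranspose, Matrix.trace, ← Finset.sum_coe_sort (farey Q)]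
  congr 1
  refine Finset.sum_congr rfl fun θ _ => ?_
  rw [Matrix.diag_apply, matrix_pow_apply_eq_sum_chain]

open scoped ComplexOrder in
theorem moment_re_nonneg (ℓ Q N : ℕ) : 0 ≤ (moment ℓ Q N).re := by
  have h0 : (0 : ℂ) ≤ (N : ℂ)⁻¹ := by
    rw [← Complex.ofReal_natCast, ← Complex.ofReal_inv]
    exact Complex.zero_le_real.2 (by positivity)
  have h1 := ((Matrix.posSemidef_conjTranspose_mul_self (sieveMatrix Q N)).smul h0).pow ℓ
  have h2 := mul_nonneg h0 h1.trace_nonneg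
  exact (Complex.nonneg_iff.1 h2).1

/-! ### The local sum at one Farey fraction. -/

/-- The convolution argument, run on F_Q with the circle distance in place of `hdist`; the spare
exponent again saves X^(-loss) on paths of weight at least X. -/
theorem exists_sum_norm_chain_expKernel_le (m : ℕ) {γ : ℝ} (hγ : 0 < γ) : ∃ C : ℝ, 0 < C ∧
    ∀ Q N : ℕ, 1 ≤ Q → 1 ≤ N → γ * (Q : ℝ) ^ 2 ≤ N → ∀ θ₀ ∈ farey Q, ∀ X : ℝ, 0 < X →
      ∀ S ⊆ Fintype.piFinset (fun _ : Fin (m + 1) => farey Q),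
        (∀ v ∈ S, X ≤ chain (fun x y => 1 + fareyDist Q x y) θ₀ θ₀ v) →
          ∑ v ∈ S, ‖chain (expKernel N) θ₀ θ₀ v‖ ≤ C * X ^ (-loss (m + 1)) := by
  classical
  set ε := loss (m + 1) with hε
  have hε0 : 0 < ε := loss_pos _
  obtain ⟨C, hC, H⟩ := exists_sum_fareyDist_rpow_le (r := 1 + ε) (by linarith)
  refine ⟨(1 + 1 / γ) ^ (m + 2) * (4 * C) ^ (m + 1), by positivity,
    fun Q N hQ hN hNQ θ₀ hθ₀ X hX S hS hSX => ?_⟩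
  have hd0 := fareyDist_nonneg Q
  have hpos : ∀ x y, 0 ≤ 1 + fareyDist Q x y := fun x y => by linarith [hd0 x y]
  set W : (Fin (m + 1) → ℚ) → ℝ := fun v => chain (fun x y => 1 + fareyDist Q x y) θ₀ θ₀ v with hW
  have hW1 : ∀ v, 1 ≤ W v := fun v => one_le_chain (fun x y => by linarith [hd0 x y]) _ _ _
  have hpt : ∀ v ∈ S, ‖chain (expKernel N) θ₀ θ₀ v‖ ≤
      (1 + 1 / γ) ^ (m + 2) * X ^ (-ε) * W v ^ (-(1 - ε)) := by
    intro v hv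
    have hWv := zero_lt_one.trans_le (hW1 v)
    have e1 : ‖chain (expKernel N) θ₀ θ₀ v‖ ≤ (1 + 1 / γ) ^ (m + 2) * (W v)⁻¹ := by
      calc ‖chain (expKernel N) θ₀ θ₀ v‖ = chain (fun x y => ‖expKernel N x y‖) θ₀ θ₀ v :=
            norm_prod _ _
        _ ≤ chain (fun x y => (1 + 1 / γ) * (1 + fareyDist Q x y)⁻¹) θ₀ θ₀ v :=
            chain_le_chain (fun _ _ => norm_nonneg _)
              (fun x y => norm_expMean_le hγ hN hNQ (by positivity) _) _ _ _
        _ = _ := by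
            rw [chain_const_mul]
            simp only [hW, chain, Finset.prod_inv_distrib]
    refine e1.trans ?_
    rw [mul_assoc]
    refine mul_le_mul_of_nonneg_left ?_ (by positivity)
    calc (W v)⁻¹ = W v ^ (-ε) * W v ^ (-(1 - ε)) := by
          rw [← Real.rpow_add hWv, ← Real.rpow_neg_one]; congr 1; ring
      _ ≤ _ := by
          gcongr ?_ * _
          exact Real.rpow_le_rpow_of_nonpos hX (hSX v hv) (by linarith)
  calc _ ≤ ∑ v ∈ S, (1 + 1 / γ) ^ (m + 2) * X ^ (-ε) * W v ^ (-(1 - ε)) :=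
        Finset.sum_le_sum hpt
    _ ≤ ∑ v ∈ Fintype.piFinset (fun _ : Fin (m + 1) => farey Q),
          (1 + 1 / γ) ^ (m + 2) * X ^ (-ε) * W v ^ (-(1 - ε)) :=
        Finset.sum_le_sum_of_subset_of_nonneg hS fun v _ _ =>
          mul_nonneg (by positivity) (Real.rpow_nonneg (zero_le_one.trans (hW1 v)) _)
    _ ≤ (1 + 1 / γ) ^ (m + 2) * X ^ (-ε) * (4 * C) ^ (m + 1) := by
        rw [← Finset.mul_sum]
        refine mul_le_mul_of_nonneg_left ?_ (by positivity)
        have key := sum_chain_rpow_le hd0 (fareyDist_triangle Q) (farey Q) hε0 θ₀ (C := C) ?_ ?_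
          (m + 1) (loss_spec _) θ₀ (Finset.mem_insert_self _ _)
        · simp only [chain_rpow hpos] at key
          refine key.trans (le_of_eq ?_)
          simp [fareyDist]
        · intro a ha
          rw [Finset.insert_eq_of_mem hθ₀] at ha
          simp only [fareyDist_comm Q a]
          exact H Q hQ _ subset_rfl a ha
        · exact H Q hQ _ subset_rfl θ₀ hθ₀
    _ = _ := by ring

theorem exists_card_near_le : ∃ C : ℝ, 0 < C ∧ ∀ Q : ℕ, 1 ≤ Q → ∀ θ₀ ∈ farey Q, ∀ H : ℝ, 0 ≤ H →
    ∀ U ⊆ farey Q, (∀ θ ∈ U, fareyDist Q θ θ₀ ≤ H) → (U.card : ℝ) ≤ C * (1 + H) ^ 2 := by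
  obtain ⟨C, hC, key⟩ := exists_sum_fareyDist_rpow_le (r := 2) one_lt_two
  refine ⟨C, hC, fun Q hQ θ₀ hθ₀ H hH U hU hUH => ?_⟩
  have h1 : (U.card : ℝ) * (1 + H) ^ (-2 : ℝ) ≤ C := by
    rw [← nsmul_eq_mul, ← Finset.sum_const]
    refine (Finset.sum_le_sum fun θ hθ => ?_).trans (key Q hQ U hU θ₀ hθ₀)
    have := fareyDist_nonneg Q θ θ₀
    have := hUH θ hθ
    exact Real.rpow_le_rpow_of_nonpos (by linarith) (by linarith) (by norm_num)
  rw [Real.rpow_neg (by linarith), ← div_eq_mul_inv, div_le_iff₀ (by positivity)] at h1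
  exact_mod_cast h1

/-- The kernel has period 1, so fractions may be replaced by their lifts near θ₀; the inserted
phases cancel on the closed path and prepare the comparison with sinc. -/
theorem chain_expKernel_eq (N : ℕ) {n : ℕ} (θ₀ : ℚ) (v : Fin n → ℚ) :
    chain (expKernel N) θ₀ θ₀ v = chain (fun x y =>
      Complex.exp (-(Real.pi * Complex.I * (N + 1) * (nearLift θ₀ x : ℝ))) *
        expMean N ((nearLift θ₀ x : ℝ) - nearLift θ₀ y) *
        (Complex.exp (-(Real.pi * Complex.I * (N + 1) * (nearLift θ₀ y : ℝ))))⁻¹) θ₀ θ₀ v := by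
  rw [chain_mul_inv_cancel
    (fun x : ℚ => Complex.exp (-(Real.pi * Complex.I * (N + 1) * (nearLift θ₀ x : ℝ))))
    (fun _ => Complex.exp_ne_zero _) (fun x y => expMean N ((nearLift θ₀ x : ℝ) - nearLift θ₀ y)),
    mul_comm, ← mul_assoc, inv_mul_cancel₀ (Complex.exp_ne_zero _), one_mul]
  congr 1
  funext x y
  have : ((nearLift θ₀ x : ℝ) - nearLift θ₀ y) =
      ((x : ℝ) - y) + ((round (y - θ₀) - round (x - θ₀) : ℤ) : ℝ) := by
    unfold nearLift; push_cast; ring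
  rw [this, expMean_add_intCast, expKernel]

/-- All lifts lie within H/Q² of θ₀, so each edge has length at most 2H/Q² and costs π times that.
-/
theorem norm_chain_expKernel_sub_le {Q N : ℕ} (hQ : 1 ≤ Q) (hN : 1 ≤ N) {n : ℕ} (θ₀ : ℚ) {H : ℝ}
    (hH : 0 ≤ H) (v : Fin n → ℚ) (hv : ∀ i, fareyDist Q (v i) θ₀ ≤ H) :
    ‖chain (expKernel N) θ₀ θ₀ v -
      ((chain (sincKernel ((N : ℝ) / (Q : ℝ) ^ 2) (fareyPoint Q θ₀)) (1, 0) (1, 0)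
        (fareyPair θ₀ ∘ v) : ℝ) : ℂ)‖ ≤ (n + 1) * (Real.pi * (2 * H / (Q : ℝ) ^ 2)) := by
  have hQ0 : (0 : ℝ) < (Q : ℝ) ^ 2 := pow_pos (by exact_mod_cast hQ) 2
  have e1 : ((chain (sincKernel ((N : ℝ) / (Q : ℝ) ^ 2) (fareyPoint Q θ₀)) (1, 0) (1, 0)
      (fareyPair θ₀ ∘ v) : ℝ) : ℂ) = chain (fun x y =>
        ((Real.sinc (Real.pi * (N * ((nearLift θ₀ x : ℝ) - nearLift θ₀ y))) : ℝ) : ℂ)) θ₀ θ₀ v := by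
    rw [← fareyPair_self θ₀, ← chain_comp]
    refine (map_chain Complex.ofRealHom _ _ _ _).trans ?_
    congr 1
    funext x y
    simp only [sincKernel, Complex.ofRealHom_eq_coe, h_fareyPair hQ]
    congr 2
    field_simp
    ring
  have hu : ∀ x : ℚ,
      ‖Complex.exp (-(Real.pi * Complex.I * (N + 1) * (nearLift θ₀ x : ℝ)))‖ = 1 := by
    intro x
    have := Complex.norm_exp_ofReal_mul_I (-(Real.pi * (N + 1) * (nearLift θ₀ x : ℝ)))
    push_cast at this
    rw [← this]
    congr 2
    push_cast
    ring
  rw [e1, chain_expKernel_eq]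
  refine norm_chain_sub_chain_le θ₀ θ₀ {θ | fareyDist Q θ θ₀ ≤ H} ?_ ?_ ?_ ?_ ?_ v hv
  · simpa [fareyDist] using hH
  · simpa [fareyDist] using hH
  · intro x y
    rw [norm_mul, norm_mul, norm_inv, hu, hu, one_mul, inv_one, mul_one]
    exact norm_expMean_le_one _ _
  · intro x y
    rw [Complex.norm_real]
    exact Real.abs_sinc_le_one _
  · intro x hx y hy
    set δ := (nearLift θ₀ x : ℝ) - nearLift θ₀ y with hδ
    have hδH : |δ| ≤ 2 * H / (Q : ℝ) ^ 2 := by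
      have hx' : fareyDist Q x θ₀ ≤ H := hx
      have hy' : fareyDist Q y θ₀ ≤ H := hy
      rw [fareyDist, ← nearLift_sub_eq] at hx' hy'
      rw [le_div_iff₀ hQ0]
      have : |δ| ≤ |(nearLift θ₀ x : ℝ) - θ₀| + |(nearLift θ₀ y : ℝ) - θ₀| := by
        rw [hδ, ← sub_sub_sub_cancel_right _ _ (θ₀ : ℝ)]
        exact abs_sub _ _
      nlinarith
    have key := norm_expMean_sub_le hN δ
    have e2 : Complex.exp (-(Real.pi * Complex.I * (N + 1) * (nearLift θ₀ x : ℝ))) *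
          expMean N δ * (Complex.exp (-(Real.pi * Complex.I * (N + 1) * (nearLift θ₀ y : ℝ))))⁻¹ -
          ((Real.sinc (Real.pi * (N * δ)) : ℝ) : ℂ) =
        Complex.exp (-(Real.pi * Complex.I * (N + 1) * (nearLift θ₀ x : ℝ))) *
          (Complex.exp (-(Real.pi * Complex.I * (N + 1) * (nearLift θ₀ y : ℝ))))⁻¹ *
          (expMean N δ - Complex.exp (Real.pi * Complex.I * (N + 1) * δ) *
            ((Real.sinc (Real.pi * (N * δ)) : ℝ) : ℂ)) := by
      -- Because δ is a difference of lifts as real numbers, and not only modulo 1, its phase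
      -- factors over the two endpoints.
      have e3 : Complex.exp (Real.pi * Complex.I * (N + 1) * δ) =
          (Complex.exp (-(Real.pi * Complex.I * (N + 1) * (nearLift θ₀ x : ℝ))))⁻¹ *
          Complex.exp (-(Real.pi * Complex.I * (N + 1) * (nearLift θ₀ y : ℝ))) := by
        rw [← Complex.exp_neg, ← Complex.exp_add]
        congr 1
        rw [hδ]; push_cast; ring
      have n1 := Complex.exp_ne_zero (-(Real.pi * Complex.I * (N + 1) * (nearLift θ₀ x : ℝ)))
      have n2 := Complex.exp_ne_zero (-(Real.pi * Complex.I * (N + 1) * (nearLift θ₀ y : ℝ)))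
      rw [e3]
      generalize Complex.exp (-(Real.pi * Complex.I * (N + 1) * (nearLift θ₀ x : ℝ))) = a at *
      generalize Complex.exp (-(Real.pi * Complex.I * (N + 1) * (nearLift θ₀ y : ℝ))) = b at *
      field_simp
    rw [e2, norm_mul, norm_mul, norm_inv, hu, hu, inv_one, one_mul, one_mul]
    refine key.trans ?_
    gcongr

/-- The pair of vectors attached to a tuple of Farey fractions. -/
def fareyVector (θ₀ : ℚ) {k : ℕ} (v : Fin k → ℚ) : (Fin k → ℤ) × (Fin k → ℤ) :=
  (fun i => (fareyPair θ₀ (v i)).1, fun i => (fareyPair θ₀ (v i)).2)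

theorem pairs_fareyVector (θ₀ : ℚ) {k : ℕ} (v : Fin k → ℚ) :
    pairs (fareyVector θ₀ v) = fareyPair θ₀ ∘ v := rfl

theorem fareyVector_mem {Q : ℕ} {θ₀ : ℚ} (hθ₀ : θ₀ ∈ farey Q) {k : ℕ} {v : Fin k → ℚ}
    (hv : ∀ i, v i ∈ farey Q) : fareyVector θ₀ v ∈ coprimeVectors k ∧
      fareyPoint Q θ₀ ∈ region (fareyVector θ₀ v).1 (fareyVector θ₀ v).2 := by
  obtain ⟨p0, p1, -, p3⟩ := fareyPoint_mem hθ₀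
  refine ⟨fun i => ?_, p0, p1, p3, fun i => (fareyPair_mem_admissible θ₀ (hv i)).2⟩
  have h1 := (fareyPair_mem_admissible θ₀ (hv i)).1
  refine ⟨h1, fun h2 => ?_⟩
  have a1 : (fareyPair θ₀ (v i)).1 = 0 := by
    have : (fareyPair θ₀ (v i)).1 ^ 2 + (fareyPair θ₀ (v i)).2 ^ 2 = 0 := h2
    nlinarith [sq_nonneg (fareyPair θ₀ (v i)).1, sq_nonneg (fareyPair θ₀ (v i)).2]
  have a2 : (fareyPair θ₀ (v i)).2 = 0 := by
    have : (fareyPair θ₀ (v i)).1 ^ 2 + (fareyPair θ₀ (v i)).2 ^ 2 = 0 := h2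
    nlinarith [sq_nonneg (fareyPair θ₀ (v i)).1, sq_nonneg (fareyPair θ₀ (v i)).2]
  rw [a1, a2] at h1
  simp at h1

/-- Comparison of the local sum at a Farey fraction with the sum of the limiting integrands. -/
theorem exists_norm_local_sub_le (m : ℕ) {γ : ℝ} (hγ : 0 < γ) : ∃ C : ℝ, 0 < C ∧
    ∀ Q N : ℕ, 1 ≤ Q → 1 ≤ N → γ * (Q : ℝ) ^ 2 ≤ N → ∀ θ₀ ∈ farey Q, ∀ H : ℝ, 0 ≤ H →
      H < (Q : ℝ) ^ 2 / 2 → ∀ t : ℝ, 1 ≤ t → ∀ K : ℕ, t ^ 2 ≤ K →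
        ‖∑ v ∈ Fintype.piFinset (fun _ : Fin (m + 1) => farey Q), chain (expKernel N) θ₀ θ₀ v -
          ((∑ v ∈ coprimeBox (m + 1) K, (region v.1 v.2).indicator
            (integrand m ((N : ℝ) / (Q : ℝ) ^ 2) v.1 v.2) (fareyPoint Q θ₀) : ℝ) : ℂ)‖ ≤
        C * ((1 + H) ^ (-loss (m + 1)) + (1 + H) ^ (2 * m + 3) / (Q : ℝ) ^ 2 +
          t ^ (-loss (m + 1)) + if (fareyPoint Q θ₀).2 * t < 1 then 1 else 0) := by
  classical
  obtain ⟨C₁, hC₁, H₁⟩ := exists_sum_norm_chain_expKernel_le m hγ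
  obtain ⟨C₂, hC₂, H₂⟩ := exists_card_near_le
  obtain ⟨C₃, hC₃, H₃⟩ := sum_not_mem_coprimeBox_le (m := m) hγ
  obtain ⟨C₄, hC₄, H₄⟩ := sum_abs_indicator_integrand_le (m := m) hγ
  set ε := loss (m + 1) with hε
  refine ⟨C₁ + C₂ ^ (m + 1) * ((m + 2) * (Real.pi * 2)) + C₃ + C₄, by positivity,
    fun Q N hQ hN hNQ θ₀ hθ₀ H hH hHQ t ht K hK => ?_⟩
  have hQ0 : (0 : ℝ) < (Q : ℝ) ^ 2 := pow_pos (by exact_mod_cast hQ) 2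
  set α := (N : ℝ) / (Q : ℝ) ^ 2 with hα
  have hαγ : γ ≤ α := by rw [hα, le_div_iff₀ hQ0]; exact hNQ
  set p := fareyPoint Q θ₀ with hp
  set F : ((Fin (m + 1) → ℤ) × (Fin (m + 1) → ℤ)) → ℝ := fun v =>
    (region v.1 v.2).indicator (integrand m α v.1 v.2) p with hF
  set U := (farey Q).filter (fun θ => fareyDist Q θ θ₀ ≤ H) with hU
  have hUsub : U ⊆ farey Q := Finset.filter_subset _ _
  have hUH : ∀ θ ∈ U, fareyDist Q θ θ₀ ≤ H := fun θ hθ => (Finset.mem_filter.1 hθ).2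
  set PF := Fintype.piFinset (fun _ : Fin (m + 1) => farey Q) with hPF
  set PU := Fintype.piFinset (fun _ : Fin (m + 1) => U) with hPU
  have hPUsub : PU ⊆ PF := Fintype.piFinset_subset _ _ fun _ => hUsub
  set X := PU.image (fareyVector θ₀) with hX
  have hinj : Set.InjOn (fareyVector θ₀ (k := m + 1)) (PU : Set (Fin (m + 1) → ℚ)) := by
    intro v hv v' hv' heq
    have h1 := congrArg pairs heq
    rw [pairs_fareyVector, pairs_fareyVector] at h1
    have hv1 := Fintype.mem_piFinset.1 (Finset.mem_coe.1 hv)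
    have hv2 := Fintype.mem_piFinset.1 (Finset.mem_coe.1 hv')
    funext i
    exact fareyPair_injOn hQ θ₀ (hUsub (hv1 i)) (hUsub (hv2 i)) (congrFun h1 i)
  have hXmem : ∀ w ∈ X, w ∈ coprimeVectors (m + 1) := by
    intro w hw
    obtain ⟨v, hv, rfl⟩ := Finset.mem_image.1 hw
    exact (fareyVector_mem hθ₀ fun i => hUsub (Fintype.mem_piFinset.1 hv i)).1
  have hXsum : ∑ w ∈ X, F w = ∑ v ∈ PU, chain (sincKernel α p) (1, 0) (1, 0) (fareyPair θ₀ ∘ v) := by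
    rw [hX, Finset.sum_image hinj]
    refine Finset.sum_congr rfl fun v hv => ?_
    have := (fareyVector_mem hθ₀ fun i => hUsub (Fintype.mem_piFinset.1 hv i)).2
    simp only [hF]
    rw [Set.indicator_of_mem this, integrand_eq_chain, pairs_fareyVector]
  -- Paths leaving the H-neighbourhood of θ₀ have weight at least 1 + H.
  have bA : ‖∑ v ∈ PF \ PU, chain (expKernel N) θ₀ θ₀ v‖ ≤ C₁ * (1 + H) ^ (-ε) := by
    refine (norm_sum_le _ _).trans (H₁ Q N hQ hN hNQ θ₀ hθ₀ (1 + H) (by linarith) _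
      Finset.sdiff_subset fun v hv => ?_)
    obtain ⟨hv1, hv2⟩ := Finset.mem_sdiff.1 hv
    have : ∃ i, H < fareyDist Q (v i) θ₀ := by
      by_contra hcon
      push Not at hcon
      exact hv2 (Fintype.mem_piFinset.2 fun i =>
        Finset.mem_filter.2 ⟨Fintype.mem_piFinset.1 hv1 i, hcon i⟩)
    obtain ⟨i, hi⟩ := this
    have := one_add_le_chain (fareyDist_nonneg Q) (fareyDist_triangle Q) θ₀ θ₀ v i
    rw [fareyDist_comm] at this
    linarith
  -- There are O((1+H)^(2(m+1))) near paths, each with error O(H/Q²).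
  have bB : ‖∑ v ∈ PU, chain (expKernel N) θ₀ θ₀ v - ((∑ w ∈ X, F w : ℝ) : ℂ)‖ ≤
      C₂ ^ (m + 1) * ((m + 2) * (Real.pi * 2)) * ((1 + H) ^ (2 * m + 3) / (Q : ℝ) ^ 2) := by
    rw [hXsum, Complex.ofReal_sum, ← Finset.sum_sub_distrib]
    refine (norm_sum_le _ _).trans ?_
    calc _ ≤ ∑ v ∈ PU, (((m + 1 : ℕ) : ℝ) + 1) * (Real.pi * (2 * H / (Q : ℝ) ^ 2)) :=
          Finset.sum_le_sum fun v hv => norm_chain_expKernel_sub_le hQ hN θ₀ hH v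
            fun i => hUH _ (Fintype.mem_piFinset.1 hv i)
      _ = (U.card : ℝ) ^ (m + 1) * ((m + 2) * (Real.pi * (2 * H / (Q : ℝ) ^ 2))) := by
          rw [Finset.sum_const, nsmul_eq_mul, hPU, Fintype.card_piFinset_const]
          push_cast; ring
      _ ≤ (C₂ * (1 + H) ^ 2) ^ (m + 1) *
            ((m + 2) * (Real.pi * (2 * (1 + H) / (Q : ℝ) ^ 2))) := by
          gcongr
          · exact H₂ Q hQ θ₀ hθ₀ H hH U hUsub hUH
          · linarith
      _ = _ := by
          rw [mul_pow, ← pow_mul, show 2 * m + 3 = 2 * (m + 1) + 1 by ring, pow_succ (1 + H)]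
          ring
  -- The vectors coming from near paths and those of the box differ in two ways: vectors outside the
  -- box are handled by truncation, and box vectors missed by near paths by a large weight.
  have bD : |∑ w ∈ X, F w - ∑ w ∈ coprimeBox (m + 1) K, F w| ≤
      C₃ * (t ^ (-ε) + if p.2 * t < 1 then 1 else 0) + C₄ * (1 + H) ^ (-ε) := by
    rw [← Finset.sum_sdiff_sub_sum_sdiff]
    refine (abs_sub _ _).trans (add_le_add ?_ ?_)
    · refine (Finset.abs_sum_le_sum_abs _ _).trans (H₃ α hαγ t ht K hK p _ fun v hv => ?_)
      obtain ⟨h1, h2⟩ := Finset.mem_sdiff.1 hv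
      exact ⟨hXmem v h1, h2⟩
    · refine (Finset.abs_sum_le_sum_abs _ _).trans (H₄ α hαγ (1 + H) (by linarith) p _
        (fun v hv => (mem_coprimeBox.1 (Finset.mem_sdiff.1 hv).1).2) fun v hv hr => ?_)
      obtain ⟨h1, h2⟩ := Finset.mem_sdiff.1 hv
      have hvc := (mem_coprimeBox.1 h1).2
      -- If all values of |h| were at most H < Q²/2, every pair would come from a Farey fraction
      -- near θ₀ and the vector would be in `X`.
      have : ∃ i, H < |h (pairs v i).1 (pairs v i).2 p| := by
        by_contra hcon
        push Not at hcon
        refine h2 ?_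
        have hex := fun i => exists_fareyPair_eq hQ hθ₀ (pairs_mem_admissible hvc hr i)
          ((hcon i).trans_lt hHQ)
        choose θ hθ hθe using hex
        refine Finset.mem_image.2 ⟨θ, Fintype.mem_piFinset.2 fun i =>
          Finset.mem_filter.2 ⟨hθ i, ?_⟩, pairs_injective _ ?_⟩
        · rw [fareyDist_eq_abs_h hQ, hθe]
          exact hcon i
        · rw [pairs_fareyVector]
          exact funext hθe
      obtain ⟨i, hi⟩ := this
      linarith [one_add_abs_h_le_weight p (pairs v) i]
  have split : ∑ v ∈ PF, chain (expKernel N) θ₀ θ₀ v -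
      ((∑ w ∈ coprimeBox (m + 1) K, F w : ℝ) : ℂ) =
      ∑ v ∈ PF \ PU, chain (expKernel N) θ₀ θ₀ v +
      (∑ v ∈ PU, chain (expKernel N) θ₀ θ₀ v - ((∑ w ∈ X, F w : ℝ) : ℂ)) +
      ((∑ w ∈ X, F w - ∑ w ∈ coprimeBox (m + 1) K, F w : ℝ) : ℂ) := by
    rw [← Finset.sum_sdiff hPUsub, Complex.ofReal_sub]
    ring
  rw [split]
  have hind : (0 : ℝ) ≤ if p.2 * t < 1 then 1 else 0 := by split_ifs <;> norm_num
  have q1 : 0 ≤ (1 + H) ^ (-ε) := by positivity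
  have q2 : 0 ≤ (1 + H) ^ (2 * m + 3) / (Q : ℝ) ^ 2 := by positivity
  have q3 : 0 ≤ t ^ (-ε) := Real.rpow_nonneg (by linarith) _
  refine (norm_add₃_le).trans ?_
  rw [Complex.norm_real, Real.norm_eq_abs]
  refine (add_le_add (add_le_add bA bB) bD).trans ?_
  generalize (if p.2 * t < 1 then (1 : ℝ) else 0) = s at *
  set D := C₂ ^ (m + 1) * ((m + 2) * (Real.pi * 2)) with hD
  have hD0 : 0 < D := by positivity
  generalize (1 + H) ^ (-ε) = a at *
  generalize (1 + H) ^ (2 * m + 3) / (Q : ℝ) ^ 2 = b at *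
  generalize t ^ (-ε) = c at *
  nlinarith [mul_nonneg hC₁.le q2, mul_nonneg hC₁.le q3, mul_nonneg hC₁.le hind,
    mul_nonneg hD0.le q1, mul_nonneg hD0.le q3, mul_nonneg hD0.le hind,
    mul_nonneg hC₃.le q1, mul_nonneg hC₃.le q2, mul_nonneg hC₄.le q2, mul_nonneg hC₄.le q3,
    mul_nonneg hC₄.le hind]

/-! ### Averaging over Farey fractions and choice of parameters. -/

theorem card_farey_le (Q : ℕ) : ((farey Q).card : ℝ) ≤ (Q : ℝ) ^ 2 := by
  have := sum_farey_le Q (fun _ _ => 1) fun _ _ => zero_le_one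
  simp only [Finset.sum_const, Nat.card_Icc, add_tsub_cancel_right, nsmul_eq_mul, mul_one] at this
  rwa [sq]

theorem sum_farey_low_le {Q : ℕ} {t : ℝ} (ht : 0 < t) :
    ∑ θ ∈ farey Q, (if (fareyPoint Q θ).2 * t < 1 then (1 : ℝ) else 0) ≤ (Q : ℝ) ^ 2 / t := by
  refine (sum_farey_le Q (fun _ q => if (q : ℝ) / Q * t < 1 then (1 : ℝ) else 0)
    fun x q => by split_ifs <;> norm_num).trans ?_
  rcases Nat.eq_zero_or_pos Q with rfl | hQ
  · simp
  have hQ0 : (0 : ℝ) < Q := by exact_mod_cast hQ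
  have h1 : ∑ q ∈ Finset.Icc 1 Q, (if (q : ℝ) / Q * t < 1 then (1 : ℝ) else 0) ≤ Q / t := by
    rw [← Finset.sum_filter, Finset.sum_const, nsmul_eq_mul, mul_one]
    have hsub : (Finset.Icc 1 Q).filter (fun q : ℕ => (q : ℝ) / Q * t < 1) ⊆
        Finset.Icc 1 ⌊(Q : ℝ) / t⌋₊ := by
      intro q hq
      obtain ⟨h1, h2⟩ := Finset.mem_filter.1 hq
      refine Finset.mem_Icc.2 ⟨(Finset.mem_Icc.1 h1).1, Nat.le_floor ?_⟩
      rw [le_div_iff₀ ht]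
      have : (q : ℝ) / Q * t = q * t / Q := by ring
      rw [this, div_lt_one hQ0] at h2
      exact h2.le
    have h2 := Finset.card_le_card hsub
    rw [Nat.card_Icc, Nat.add_sub_cancel] at h2
    exact (Nat.cast_le.2 h2).trans (Nat.floor_le (by positivity))
  rw [Finset.sum_const, Nat.card_Icc, add_tsub_cancel_right, nsmul_eq_mul]
  calc _ ≤ (Q : ℝ) * (Q / t) := by gcongr
    _ = _ := by ring

theorem sum_farey_coprimeBox_eq (m K Q : ℕ) (α : ℝ) :
    ∑ θ ∈ farey Q, ∑ v ∈ coprimeBox (m + 1) K,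
        (region v.1 v.2).indicator (integrand m α v.1 v.2) (fareyPoint Q θ) =
      ∑ x ∈ Finset.Icc 1 Q, ∑ q ∈ Finset.Icc 1 Q,
          (if Nat.Coprime x q then ∑ v ∈ coprimeBox (m + 1) K,
            (region v.1 v.2).indicator (integrand m α v.1 v.2) ((x : ℝ) / Q, (q : ℝ) / Q)
          else 0) := by
  rcases Nat.eq_zero_or_pos Q with rfl | hQ
  · rfl
  have hQ0 : (0 : ℝ) < Q := by exact_mod_cast hQ
  refine sum_farey_eq Q (fun x q => ∑ v ∈ coprimeBox (m + 1) K,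
    (region v.1 v.2).indicator (integrand m α v.1 v.2) ((x : ℝ) / Q, (q : ℝ) / Q)) ?_
  intro x q hxq
  refine Finset.sum_eq_zero fun v _ => Set.indicator_of_notMem (fun hr => ?_) _
  have h1 : (x : ℝ) / Q ≤ (q : ℝ) / Q := hr.2.1
  rw [div_le_div_iff_of_pos_right hQ0] at h1
  have : x ≤ q := by exact_mod_cast h1
  omega

theorem exists_moment_bound (m : ℕ) {γ₁ γ₂ : ℝ} (hγ : 0 < γ₁) : ∃ C : ℝ, 0 < C ∧
    ∀ Q N : ℕ, 1 ≤ Q → γ₁ * (Q : ℝ) ^ 2 ≤ N → (N : ℝ) ≤ γ₂ * (Q : ℝ) ^ 2 →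
      ∀ H : ℝ, 0 ≤ H → H < (Q : ℝ) ^ 2 / 2 → ∀ t : ℝ, 1 ≤ t → ∀ K : ℕ, t ^ 2 ≤ K →
        ‖moment (m + 2) Q N - ((limitMoment (m + 2) ((N : ℝ) / (Q : ℝ) ^ 2) : ℝ) : ℂ)‖ ≤
          C * ((1 + H) ^ (-loss (m + 1)) + (1 + H) ^ (2 * m + 3) / (Q : ℝ) ^ 2 +
            t ^ (-loss (m + 1)) + (3 * K : ℝ) ^ (2 * m + 3) * (Q : ℝ) ^ (-(1 / 5) : ℝ)) := by
  obtain ⟨C₁, hC₁, H₁⟩ := exists_norm_local_sub_le m hγ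
  obtain ⟨C₂, hC₂, H₂⟩ := exists_abs_average_coprimeBox_sub_le m γ₂
  obtain ⟨C₃, hC₃, H₃⟩ := abs_tsum_sub_sum_coprimeBox_le (m := m) hγ
  set ε := loss (m + 1) with hε
  have hε1 : ε ≤ 1 / 2 := loss_le _
  refine ⟨1 / γ₁ * (2 * C₁ + C₂ + 6 / Real.pi ^ 2 * C₃), by positivity,
    fun Q N hQ hN1 hN2 H hH hHQ t ht K hK => ?_⟩
  have hQ0 : (0 : ℝ) < (Q : ℝ) ^ 2 := pow_pos (by exact_mod_cast hQ) 2
  have hN0 : (0 : ℝ) < N := (mul_pos hγ hQ0).trans_le hN1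
  have hN : 1 ≤ N := by exact_mod_cast hN0
  have ht0 : 0 < t := by linarith
  have hK1 : 1 ≤ K := by
    have : (1 : ℝ) ≤ K := (one_le_pow₀ ht).trans hK
    exact_mod_cast this
  set α := (N : ℝ) / (Q : ℝ) ^ 2 with hα
  have hα1 : γ₁ ≤ α := by rw [hα, le_div_iff₀ hQ0]; exact hN1
  have hα2 : α ≤ γ₂ := by rw [hα, div_le_iff₀ hQ0]; exact hN2
  have hα0 : 0 < α := hγ.trans_le hα1
  set J : ℚ → ℂ := fun θ₀ =>
    ∑ v ∈ Fintype.piFinset (fun _ : Fin (m + 1) => farey Q), chain (expKernel N) θ₀ θ₀ v with hJ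
  set G : ℚ → ℝ := fun θ₀ => ∑ v ∈ coprimeBox (m + 1) K,
    (region v.1 v.2).indicator (integrand m α v.1 v.2) (fareyPoint Q θ₀) with hG
  set B := ∑ v ∈ coprimeBox (m + 1) K, regionIntegral m α v with hB
  set T := ∑' v : coprimeVectors (m + 1), regionIntegral m α v with hT
  set e₁ := (1 + H) ^ (-ε) + (1 + H) ^ (2 * m + 3) / (Q : ℝ) ^ 2 + t ^ (-ε) with he₁
  have q1 : 0 ≤ (1 + H) ^ (-ε) := by positivity
  have q2 : 0 ≤ (1 + H) ^ (2 * m + 3) / (Q : ℝ) ^ 2 := by positivity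
  have q3 : 0 ≤ t ^ (-ε) := Real.rpow_nonneg ht0.le _
  have b1 : ‖∑ θ₀ ∈ farey Q, (J θ₀ - (G θ₀ : ℂ))‖ ≤ (Q : ℝ) ^ 2 * (2 * C₁ * e₁) := by
    refine (norm_sum_le _ _).trans ?_
    calc _ ≤ ∑ θ₀ ∈ farey Q, C₁ * (e₁ + if (fareyPoint Q θ₀).2 * t < 1 then 1 else 0) :=
          Finset.sum_le_sum fun θ₀ hθ₀ => H₁ Q N hQ hN hN1 θ₀ hθ₀ H hH hHQ t ht K hK
      _ = C₁ * ((farey Q).card * e₁ +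
            ∑ θ ∈ farey Q, (if (fareyPoint Q θ).2 * t < 1 then (1 : ℝ) else 0)) := by
          rw [← Finset.mul_sum, Finset.sum_add_distrib, Finset.sum_const, nsmul_eq_mul]
      _ ≤ C₁ * ((Q : ℝ) ^ 2 * e₁ + (Q : ℝ) ^ 2 * e₁) := by
          have h1 := card_farey_le Q
          have h2 := sum_farey_low_le (Q := Q) ht0
          have h3 : (Q : ℝ) ^ 2 / t ≤ (Q : ℝ) ^ 2 * e₁ := by
            rw [div_eq_mul_inv]
            refine mul_le_mul_of_nonneg_left ?_ hQ0.le
            have : t⁻¹ ≤ t ^ (-ε) := by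
              rw [← Real.rpow_neg_one]
              exact Real.rpow_le_rpow_of_exponent_le ht (by linarith)
            linarith
          have h4 : 0 ≤ e₁ := by positivity
          gcongr
          exact h2.trans h3
      _ = _ := by ring
  have b2 := H₂ α hα0 hα2 K hK1 Q hQ
  rw [← sum_farey_coprimeBox_eq, ← hB] at b2
  have b3 := H₃ α hα1 t ht K hK
  rw [← hT, ← hB] at b3
  have hpi := Real.pi_ne_zero
  have hQc : (Q : ℂ) ≠ 0 := by exact_mod_cast (by omega : Q ≠ 0)
  have hNc : (N : ℂ) ≠ 0 := by exact_mod_cast (by omega : N ≠ 0)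
  -- Since 1/N = (1/α)/Q², the error splits into the local comparison, the equidistribution of the
  -- base points, and the truncation of the series for M_ℓ.
  have split : moment (m + 2) Q N - ((limitMoment (m + 2) α : ℝ) : ℂ) =
      (N : ℂ)⁻¹ * ∑ θ₀ ∈ farey Q, (J θ₀ - (G θ₀ : ℂ)) +
      ((1 / α * (((Q : ℝ) ^ 2)⁻¹ * ∑ θ₀ ∈ farey Q, G θ₀ - 6 / Real.pi ^ 2 * B) : ℝ) : ℂ) -
      ((1 / α * (6 / Real.pi ^ 2 * (T - B)) : ℝ) : ℂ) := by
    have e1 : (1 / α * (((Q : ℝ) ^ 2)⁻¹ * ∑ θ₀ ∈ farey Q, G θ₀ - 6 / Real.pi ^ 2 * B) : ℝ) -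
        (1 / α * (6 / Real.pi ^ 2 * (T - B)) : ℝ) =
        (N : ℝ)⁻¹ * ∑ θ₀ ∈ farey Q, G θ₀ - limitMoment (m + 2) α := by
      rw [limitMoment_eq, ← hT]
      have hNr := hN0.ne'
      have hQr := hQ0.ne'
      have : 1 / α * ((Q : ℝ) ^ 2)⁻¹ = (N : ℝ)⁻¹ := by rw [hα]; field_simp
      rw [← this]
      field_simp
      ring
    rw [add_sub_assoc, ← Complex.ofReal_sub, e1, moment_eq_sum_chain, Finset.sum_sub_distrib]
    push_cast
    ring
  rw [split]
  have c1 : ‖(N : ℂ)⁻¹ * ∑ θ₀ ∈ farey Q, (J θ₀ - (G θ₀ : ℂ))‖ ≤ 1 / γ₁ * (2 * C₁ * e₁) := by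
    rw [norm_mul, norm_inv, Complex.norm_natCast]
    calc _ ≤ (N : ℝ)⁻¹ * ((Q : ℝ) ^ 2 * (2 * C₁ * e₁)) := by gcongr
      _ = 1 / α * (2 * C₁ * e₁) := by rw [hα]; field_simp
      _ ≤ _ := by gcongr
  have c2 : ‖((1 / α * (((Q : ℝ) ^ 2)⁻¹ * ∑ θ₀ ∈ farey Q, G θ₀ - 6 / Real.pi ^ 2 * B) : ℝ) : ℂ)‖ ≤
      1 / γ₁ * (C₂ * (3 * K : ℝ) ^ (2 * m + 3) * (Q : ℝ) ^ (-(1 / 5) : ℝ)) := by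
    rw [Complex.norm_real, Real.norm_eq_abs, abs_mul, abs_of_pos (by positivity : 0 < 1 / α)]
    gcongr
  have c3 : ‖((1 / α * (6 / Real.pi ^ 2 * (T - B)) : ℝ) : ℂ)‖ ≤
      1 / γ₁ * (6 / Real.pi ^ 2 * (C₃ * t ^ (-ε))) := by
    rw [Complex.norm_real, Real.norm_eq_abs, abs_mul, abs_mul,
      abs_of_pos (by positivity : 0 < 1 / α),
      abs_of_pos (by positivity : 0 < 6 / Real.pi ^ 2)]
    gcongr
  refine (norm_sub_le _ _).trans ((add_le_add ((norm_add_le _ _).trans (add_le_add c1 c2)) c3).trans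
    ?_)
  have q4 : 0 ≤ (3 * K : ℝ) ^ (2 * m + 3) * (Q : ℝ) ^ (-(1 / 5) : ℝ) := by positivity
  have hs : 0 < 6 / Real.pi ^ 2 * C₃ := by positivity
  rw [← mul_add, ← mul_add, mul_assoc (1 / γ₁)]
  refine mul_le_mul_of_nonneg_left ?_ (by positivity)
  rw [mul_assoc C₂, ← mul_assoc _ C₃]
  generalize (3 * K : ℝ) ^ (2 * m + 3) * (Q : ℝ) ^ (-(1 / 5) : ℝ) = d at *
  generalize 6 / Real.pi ^ 2 * C₃ = D at *
  have q5 : t ^ (-ε) ≤ e₁ := by rw [he₁]; linarith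
  have q6 : 0 ≤ e₁ := q3.trans q5
  nlinarith [mul_nonneg hC₁.le q4, mul_nonneg hC₂.le q6, mul_nonneg hs.le q4,
    mul_le_mul_of_nonneg_left q5 hs.le]

theorem moment_asymptotic (m : ℕ) : ∃ θ : ℝ, 0 < θ ∧ ∀ γ₁ γ₂ : ℝ, 0 < γ₁ → ∃ C : ℝ,
    ∀ Q N : ℕ, 1 ≤ Q → γ₁ * (Q : ℝ) ^ 2 ≤ (N : ℝ) → (N : ℝ) ≤ γ₂ * (Q : ℝ) ^ 2 →
      ‖moment (m + 2) Q N - ((limitMoment (m + 2) ((N : ℝ) / (Q : ℝ) ^ 2) : ℝ) : ℂ)‖ ≤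
        C * (Q : ℝ) ^ (-θ) := by
  set ε := loss (m + 1) with hε
  have hε0 : 0 < ε := loss_pos _
  have hε1 : ε ≤ 1 / 2 := loss_le _
  -- With t = Q^τ one has t^(2m+3) = Q^(1/20). Then K ≈ t² costs K^(2m+3) ≈ Q^(1/10), less than the
  -- gain Q^(1/5) from equidistribution.
  set τ : ℝ := 1 / (20 * (2 * m + 3)) with hτ
  have hτ0 : 0 < τ := by positivity
  have hτm : τ * (2 * m + 3) = 1 / 20 := by rw [hτ]; field_simp
  have hτ1 : τ ≤ 1 / 20 := by nlinarith [m.cast_nonneg (α := ℝ)]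
  refine ⟨τ * ε, by positivity, fun γ₁ γ₂ hγ => ?_⟩
  obtain ⟨C, hC, key⟩ := exists_moment_bound m (γ₂ := γ₂) hγ
  refine ⟨C * (5 + 2 ^ (2 * m + 3) + 6 ^ (2 * m + 3)), fun Q N hQ hN1 hN2 => ?_⟩
  have hQ1 : (1 : ℝ) ≤ Q := by exact_mod_cast hQ
  have hQ0 : (0 : ℝ) < Q := by linarith
  set t := (Q : ℝ) ^ τ with ht
  have ht1 : 1 ≤ t := Real.one_le_rpow hQ1 hτ0.le
  have ht0 : 0 < t := by linarith
  have htQ : t ≤ (Q : ℝ) ^ 2 := by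
    calc t ≤ (Q : ℝ) ^ (2 : ℝ) := Real.rpow_le_rpow_of_exponent_le hQ1 (by linarith)
      _ = _ := by norm_cast
  have htm : t ^ (2 * m + 3) = (Q : ℝ) ^ (1 / 20 : ℝ) := by
    rw [ht, ← Real.rpow_natCast, ← Real.rpow_mul hQ0.le]
    congr 1
    push_cast
    exact hτm
  have htε : t ^ (-ε) = (Q : ℝ) ^ (-(τ * ε)) := by
    rw [ht, ← Real.rpow_mul hQ0.le]; congr 1; ring
  have hK := Nat.le_ceil (t ^ 2)
  have hK2 : (⌈t ^ 2⌉₊ : ℝ) ≤ 2 * t ^ 2 := by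
    have h1 := (Nat.ceil_lt_add_one (by positivity : 0 ≤ t ^ 2)).le
    have h2 : 1 ≤ t ^ 2 := one_le_pow₀ ht1
    linarith
  -- H = t/4 satisfies H < Q²/2 for every Q ≥ 1, because t ≤ Q²; no separate treatment of small Q is
  -- needed.
  have main := key Q N hQ hN1 hN2 (t / 4) (by positivity) (by linarith) t ht1 ⌈t ^ 2⌉₊ hK
  refine main.trans ?_
  rw [mul_assoc]
  refine mul_le_mul_of_nonneg_left ?_ hC.le
  have hτε : τ * ε ≤ 1 / 40 := by nlinarith
  have b1 : (1 + t / 4) ^ (-ε) ≤ 4 * (Q : ℝ) ^ (-(τ * ε)) := by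
    calc (1 + t / 4) ^ (-ε) ≤ (t / 4) ^ (-ε) :=
          Real.rpow_le_rpow_of_nonpos (by positivity) (by linarith) (by linarith)
      _ = t ^ (-ε) * 4 ^ ε := by
          rw [Real.div_rpow ht0.le (by norm_num), Real.rpow_neg (by norm_num : (0:ℝ) ≤ 4),
            div_inv_eq_mul]
      _ ≤ t ^ (-ε) * 4 ^ (1 : ℝ) := by
          gcongr
          · norm_num
          · linarith
      _ = _ := by rw [Real.rpow_one, htε, mul_comm]
  have b2 : (1 + t / 4) ^ (2 * m + 3) / (Q : ℝ) ^ 2 ≤ 2 ^ (2 * m + 3) * (Q : ℝ) ^ (-(τ * ε)) := by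
    calc _ ≤ (2 * t) ^ (2 * m + 3) / (Q : ℝ) ^ 2 := by gcongr; linarith
      _ = 2 ^ (2 * m + 3) * ((Q : ℝ) ^ (1 / 20 : ℝ) * (Q : ℝ) ^ (-2 : ℝ)) := by
          rw [mul_pow, htm, Real.rpow_neg hQ0.le, mul_div_assoc, div_eq_mul_inv _ ((Q : ℝ) ^ 2)]
          norm_cast
      _ ≤ _ := by
          rw [← Real.rpow_add hQ0]
          gcongr
          linarith
  have b3 : (3 * (⌈t ^ 2⌉₊ : ℝ)) ^ (2 * m + 3) * (Q : ℝ) ^ (-(1 / 5) : ℝ) ≤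
      6 ^ (2 * m + 3) * (Q : ℝ) ^ (-(τ * ε)) := by
    have h6 : 3 * (⌈t ^ 2⌉₊ : ℝ) ≤ 6 * t ^ 2 := by linarith
    calc _ ≤ (6 * t ^ 2) ^ (2 * m + 3) * (Q : ℝ) ^ (-(1 / 5) : ℝ) :=
          mul_le_mul_of_nonneg_right (pow_le_pow_left₀ (by positivity) h6 _) (by positivity)
      _ = 6 ^ (2 * m + 3) * ((Q : ℝ) ^ (1 / 20 : ℝ) * (Q : ℝ) ^ (1 / 20 : ℝ) *
            (Q : ℝ) ^ (-(1 / 5) : ℝ)) := by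
          rw [mul_pow, ← pow_mul, mul_comm 2 (2 * m + 3), pow_mul, htm]; ring
      _ ≤ _ := by
          rw [← Real.rpow_add hQ0, ← Real.rpow_add hQ0]
          gcongr
          linarith
  rw [htε]
  linarith

/-! ### Nonnegativity of the limit. -/

/-- Take N = ⌈αn²⌉ with Q = n. Then N/n² tends to α within [α, α + 1], and by continuity the limit
inherits the sign of the moments, which are traces of positive semidefinite matrices. -/
theorem limitMoment_nonneg (m : ℕ) {α : ℝ} (hα : 0 < α) : 0 ≤ limitMoment (m + 2) α := by
  obtain ⟨θ, hθ, H⟩ := moment_asymptotic m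
  obtain ⟨C, key⟩ := H α (α + 1) hα
  have hcont : ContinuousAt (limitMoment (m + 2)) α :=
    (continuousOn_limitMoment m).continuousAt (Ioi_mem_nhds hα)
  have hlow : ∀ n : ℕ, 1 ≤ n → α * (n : ℝ) ^ 2 ≤ (⌈α * (n : ℝ) ^ 2⌉₊ : ℝ) := fun n _ => Nat.le_ceil _
  have hup : ∀ n : ℕ, (⌈α * (n : ℝ) ^ 2⌉₊ : ℝ) ≤ α * (n : ℝ) ^ 2 + 1 := fun n =>
    (Nat.ceil_lt_add_one (by positivity)).le
  have hlim : Filter.Tendsto (fun n : ℕ => (⌈α * (n : ℝ) ^ 2⌉₊ : ℝ) / (n : ℝ) ^ 2) Filter.atTop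
      (nhds α) := by
    have h1 : Filter.Tendsto (fun n : ℕ => α + ((n : ℝ) ^ 2)⁻¹) Filter.atTop (nhds (α + 0)) :=
      tendsto_const_nhds.add (tendsto_inv_atTop_zero.comp
        ((Filter.tendsto_pow_atTop two_ne_zero).comp tendsto_natCast_atTop_atTop))
    rw [add_zero] at h1
    refine tendsto_of_tendsto_of_tendsto_of_le_of_le' tendsto_const_nhds h1 ?_ ?_
    · filter_upwards [Filter.eventually_ge_atTop 1] with n hn
      have hn0 : (0 : ℝ) < (n : ℝ) ^ 2 := pow_pos (by exact_mod_cast hn) 2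
      rw [le_div_iff₀ hn0]
      exact hlow n hn
    · filter_upwards [Filter.eventually_ge_atTop 1] with n hn
      have hn0 : (0 : ℝ) < (n : ℝ) ^ 2 := pow_pos (by exact_mod_cast hn) 2
      rw [div_le_iff₀ hn0, add_mul, inv_mul_cancel₀ hn0.ne']
      exact hup n
  have hpow : Filter.Tendsto (fun n : ℕ => C * (n : ℝ) ^ (-θ)) Filter.atTop (nhds 0) := by
    have := ((tendsto_rpow_neg_atTop hθ).comp tendsto_natCast_atTop_atTop).const_mul C
    simpa using this
  have htot := (hcont.tendsto.comp hlim).add hpow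
  rw [add_zero] at htot
  refine ge_of_tendsto htot ?_
  filter_upwards [Filter.eventually_ge_atTop 1] with n hn
  have hn1 : (1 : ℝ) ≤ (n : ℝ) ^ 2 := one_le_pow₀ (by exact_mod_cast hn)
  have h1 := key n ⌈α * (n : ℝ) ^ 2⌉₊ hn (hlow n hn) ((hup n).trans (by linarith))
  have h2 := moment_re_nonneg (m + 2) n ⌈α * (n : ℝ) ^ 2⌉₊
  have h3 := (Complex.re_le_norm _).trans h1
  rw [Complex.sub_re, Complex.ofReal_re] at h3
  simp only [Function.comp_apply]
  linarith

end LargeSieve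

theorem theorem1 (ℓ : ℕ) (hℓ : 2 ≤ ℓ) :
    -- (i) continuity, non-negativity and the asymptotic formula
    (ContinuousOn (LargeSieve.limitMoment ℓ) (Set.Ioi 0) ∧
      (∀ α : ℝ, 0 < α → 0 ≤ LargeSieve.limitMoment ℓ α) ∧
      ∃ θ : ℝ, 0 < θ ∧ ∀ γ₁ γ₂ : ℝ, 0 < γ₁ → γ₁ < γ₂ → ∃ C : ℝ, ∀ Q N : ℕ, 1 ≤ Q →
        γ₁ * (Q : ℝ) ^ 2 ≤ (N : ℝ) → (N : ℝ) ≤ γ₂ * (Q : ℝ) ^ 2 →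
        ‖LargeSieve.moment ℓ Q N -
            ((LargeSieve.limitMoment ℓ ((N : ℝ) / (Q : ℝ) ^ 2) : ℝ) : ℂ)‖ ≤
          C * (Q : ℝ) ^ (-θ)) ∧
    -- (ii) absolute convergence
    (∀ α : ℝ, 0 < α →
      (∀ v ∈ LargeSieve.coprimeVectors (ℓ - 2 + 1),
        MeasureTheory.IntegrableOn (LargeSieve.integrand (ℓ - 2) α v.1 v.2)
          (LargeSieve.region v.1 v.2)) ∧
      Summable (fun v : LargeSieve.coprimeVectors (ℓ - 2 + 1) =>
        ∫ p in LargeSieve.region v.1.1 v.1.2,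
          |LargeSieve.integrand (ℓ - 2) α v.1.1 v.1.2 p|)) ∧
    -- (iii) Hölder continuity on compact subintervals
    (∃ κ : ℝ, 0 < κ ∧ ∀ γ₁ γ₂ : ℝ, 0 < γ₁ → γ₁ < γ₂ → ∃ C : ℝ,
      ∀ α ∈ Set.Icc γ₁ γ₂, ∀ β ∈ Set.Icc γ₁ γ₂,
        |LargeSieve.limitMoment ℓ α - LargeSieve.limitMoment ℓ β| ≤ C * |α - β| ^ κ) := by
  obtain ⟨m, rfl⟩ : ∃ m, ℓ = m + 2 := ⟨ℓ - 2, by omega⟩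
  refine ⟨⟨LargeSieve.continuousOn_limitMoment m, fun α hα => LargeSieve.limitMoment_nonneg m hα,
    ?_⟩, fun α hα => ⟨fun v _ => ?_, ?_⟩, LargeSieve.loss (m + 1), LargeSieve.loss_pos _,
    fun γ₁ γ₂ hγ _ => LargeSieve.limitMoment_holder m hγ⟩
  · obtain ⟨θ, hθ, H⟩ := LargeSieve.moment_asymptotic m
    exact ⟨θ, hθ, fun γ₁ γ₂ hγ _ => H γ₁ γ₂ hγ⟩
  · exact LargeSieve.integrableOn_integrand m α v.1 v.2
  · exact LargeSieve.summable_setIntegral_abs m hα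

end
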